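/- Let $q\in(-1,1)$, let $\mathsf H_{\mathbb R}$ be a real Hilbert space and $(U_t)_{t\in\mathbb R}$ a strongly continuous one-parameter group of orthogonal transformations of $\mathsf H_{\mathbb R}$, extended to a unitary group on the complexification $\mathsf H_{\mathbb C}=\mathsf H_{\mathbb R}+i\mathsf H_{\mathbb R}$, with canonical involution $\overline{\xi_1+i\xi_2}=\xi_1-i\xi_2$. Inner products are linear in the second variable. Let $A$ be the analytic generator of $(U_t)$, that is, the positive non-singular self-adjoint operator on $\mathsf H_{\mathbb C}$ with $U_t=A^{it}$, and let $\mathsf H_U$ be the completion of $\mathsf H_{\mathbb C}$ for $\langle\xi,\zeta\rangle_U=\langle 2(1+A^{-1})^{-1}\xi,\zeta\rangle$. Let $\mathcal F=\mathcal F_q(\mathsf H_U)$ be the $q$-Fock space over $\mathsf H_U$, with vacuum $\Omega$ and $$\langle\xi_1\otimes\cdots\otimes\xi_n,\zeta_1\otimes\cdots\otimes\zeta_m\rangle_q=\delta_{n,m}\sum_{\pi\in S_n}q^{|\pi|}\prod_{i=1}^n\langle\xi_i,\zeta_{\pi(i)}\rangle_U ,$$ where $|\pi|$ is the number of inversions of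 $\pi$. For $\xi\in\mathsf H_U$ let $c(\xi)$ be the left creation operator, $c(\xi)(\xi_1\otimes\cdots\otimes\xi_n)=\xi\otimes\xi_1\otimes\cdots\otimes\xi_n$, $c(\xi)\Omega=\xi$, and let $c^*(\xi)$ be its adjoint. Let $\mathsf M_q$ be the von Neumann algebra on $\mathcal F$ generated by $\{c(\xi)+c^*(\xi):\xi\in\mathsf H_{\mathbb R}\}$, and for $v\in\mathsf M_q\Omega$ let $W(v)$ be the unique element of $\mathsf M_q$ with $W(v)\Omega=v$. Put $d_n=\prod_{j=1}^n(1-q^j)$, $d_\infty=\prod_{j\ge1}(1-q^j)$ and $C_q=\prod_{j\ge1}(1-|q|^j)^{-1}$. Let $0<\lambda<1$ and let $f_1,f_2\in\mathsf H_{\mathbb R}$ be an orthonormal basis of a two-dimensional $U$-invariant subspace on which $U$ is ergodic, such that in this basis $$U_t=\begin{pmatrix}\cos(t\log\lambda)&-\sin(t\log\lambda)\\ \sin(t\log\lambda)&\cos(t\log\lambda)\end{pmatrix}\qquad(t\in\mathbb R).$$ Let $e=\frac{(\lambda+1)^{1/2}}{2\lambda^{1/4}}(f_1+if_2)\in\mathsf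 H_{\mathbb C}$, so that $Ae=\lambda^{-1}e$, $A\bar e=\lambda\bar e$, $\|e\|_U=\lambda^{-1/4}$ and $\|\bar e\|_U=\lambda^{1/4}$. Write $\bar e^me^m=\bar e^{\otimes m}\otimes e^{\otimes m}$. Then the operators $(1-q)^n\lambda^{n/2}c^*(e)^nc(e)^n$ converge in norm, as $n\to\infty$, to an operator $T$ which is positive and invertible; the series $$S=\sum_{k=0}^\infty\frac{d_\infty}{d_k}(1-q)^k\lambda^{k/2}\,c(\bar e)^k\,T\,c(e)^k$$ converges in norm; and $$S_n=\frac1n\sum_{m=1}^n(1-q)^{2m}\,W(\bar e^me^m)\,c(\bar e)^mc(e)^m$$ converges in norm to $S$. Moreover, $S$ is invertible if $\lambda<(1+C_q^4)^{-2}$. -/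

import Mathlib

open Filter Topology
open scoped ComplexInnerProductSpace ComplexOrder

noncomputable section

set_option linter.unusedSectionVars false

namespace QArakiWoods

/-! ### The complexification of a real Hilbert space -/

section Complexification

variable (H : Type*) [NormedAddCommGroup H] [InnerProductSpace ℝ H]

/-- The complexification `H + iH` of a real Hilbert space; `(a, b)` stands for `a + i b`. -/
def Cplx : Type _ := H × H

variable {H}

namespace Cplx

/-- The vector `a + i b`. -/
def mk (a b : H) : Cplx H := (a, b)

/-- The real part of a vector. -/
def re (x : Cplx H) : H := x.1

/-- The imaginary part of a vector. -/
def im (x : Cplx H) : H := x.2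

instance : AddCommGroup (Cplx H) := inferInstanceAs (AddCommGroup (H × H))

@[ext] theorem ext {x y : Cplx H} (h₁ : x.re = y.re) (h₂ : x.im = y.im) : x = y :=
  Prod.ext h₁ h₂

@[simp] theorem re_mk (a b : H) : (mk a b).re = a := rfl
@[simp] theorem im_mk (a b : H) : (mk a b).im = b := rfl
@[simp] theorem re_zero : (0 : Cplx H).re = 0 := rfl
@[simp] theorem im_zero : (0 : Cplx H).im = 0 := rfl
@[simp] theorem re_add (x y : Cplx H) : (x + y).re = x.re + y.re := rfl
@[simp] theorem im_add (x y : Cplx H) : (x + y).im = x.im + y.im := rfl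

instance : SMul ℂ (Cplx H) where
  smul z x := mk (z.re • x.re - z.im • x.im) (z.re • x.im + z.im • x.re)

@[simp] theorem re_smul (z : ℂ) (x : Cplx H) :
    (z • x).re = z.re • x.re - z.im • x.im := rfl
@[simp] theorem im_smul (z : ℂ) (x : Cplx H) :
    (z • x).im = z.re • x.im + z.im • x.re := rfl

instance : Module ℂ (Cplx H) where
  one_smul x := by ext <;> simp
  mul_smul z w x := by
    ext <;> simp [sub_smul, add_smul, mul_smul, smul_sub, smul_add] <;> abel
  smul_zero z := by ext <;> simp
  smul_add z x y := by ext <;> simp [smul_add] <;> abel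
  add_smul z w x := by ext <;> simp [add_smul] <;> abel
  zero_smul x := by ext <;> simp

/-- The inner product of the complexification, linear in the second variable. -/
@[reducible] def core : InnerProductSpace.Core ℂ (Cplx H) where
  inner x y := ⟨inner ℝ x.re y.re + inner ℝ x.im y.im, inner ℝ x.re y.im - inner ℝ x.im y.re⟩
  conj_inner_symm x y := by
    apply Complex.ext
    · simp [real_inner_comm]
    · simp [real_inner_comm]
  re_inner_nonneg x := by
    simpa using add_nonneg (real_inner_self_nonneg (x := x.re)) (real_inner_self_nonneg (x := x.im))
  add_left x y z := by
    apply Complex.ext <;> simp [inner_add_left] <;> ring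
  smul_left x y z := by
    apply Complex.ext <;>
      simp [inner_add_left, inner_sub_left, real_inner_smul_left] <;> ring
  definite x hx := by
    have h := congrArg Complex.re hx
    simp only [Complex.zero_re] at h
    have h₁ := real_inner_self_nonneg (x := x.re)
    have h₂ := real_inner_self_nonneg (x := x.im)
    ext
    · exact inner_self_eq_zero.mp (le_antisymm (by linarith) h₁)
    · exact inner_self_eq_zero.mp (le_antisymm (by linarith) h₂)

instance : NormedAddCommGroup (Cplx H) :=
  @InnerProductSpace.Core.toNormedAddCommGroup ℂ (Cplx H) _ _ _ core

instance : InnerProductSpace ℂ (Cplx H) := InnerProductSpace.ofCore core.toCore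

/-- The embedding of `H` into its complexification. -/
def ofReal (a : H) : Cplx H := mk a 0

/-- The canonical involution `a + i b ↦ a - i b`. -/
def conj (x : Cplx H) : Cplx H := mk x.re (-x.im)

end Cplx

end Complexification

/-! ### One-parameter groups, analytic generator, deformed inner product -/

section OneParameter

variable {H : Type*} [NormedAddCommGroup H] [InnerProductSpace ℝ H]

variable (H) in
/-- A strongly continuous one-parameter group of orthogonal transformations of a real Hilbert
space. -/
structure OrthogonalGroup where
  toFun : ℝ → (H ≃ₗᵢ[ℝ] H)
  map_add' : ∀ s t x, toFun (s + t) x = toFun s (toFun t x)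
  strongly_continuous' : ∀ x, Continuous fun t => toFun t x

instance : CoeFun (OrthogonalGroup H) fun _ => ℝ → (H ≃ₗᵢ[ℝ] H) := ⟨OrthogonalGroup.toFun⟩

/-- The extension of `U t` to the complexification. -/
def OrthogonalGroup.cplx (U : OrthogonalGroup H) (t : ℝ) (x : Cplx H) : Cplx H :=
  Cplx.mk (U t x.re) (U t x.im)

/-- The graph of the analytic generator `A` of the complexified group `U t = A ^ (i t)`:
`ξ` is in the domain of `A` and `A ξ = η` iff `t ↦ U t ξ` has a continuous extension `F` to the
closed strip `-1 ≤ Im z ≤ 0` which is holomorphic in its interior, and `F (-i) = η`. -/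
def OrthogonalGroup.IsGenerator (U : OrthogonalGroup H) (ξ η : Cplx H) : Prop :=
  ∃ F : ℂ → Cplx H,
    ContinuousOn F {z | -1 ≤ z.im ∧ z.im ≤ 0} ∧
    DifferentiableOn ℂ F {z | -1 < z.im ∧ z.im < 0} ∧
    (∀ t : ℝ, F t = U.cplx t ξ) ∧ F (-Complex.I) = η

/-- `R = (1 + A⁻¹)⁻¹`: a positive bounded everywhere defined operator such that, for every `ξ`,
the vector `η = R ξ` satisfies `η + A⁻¹ η = ξ`, that is, `A (ξ - η) = η`. -/
def OrthogonalGroup.IsResolvent (U : OrthogonalGroup H) (R : Cplx H →L[ℂ] Cplx H) : Prop :=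
  R.IsPositive ∧ ∀ ξ, U.IsGenerator (ξ - R ξ) (R ξ)

open Classical in
/-- The operator `(1 + A⁻¹)⁻¹`. It exists (as `A` is positive, self-adjoint and non-singular)
and is unique. -/
def OrthogonalGroup.resolvent (U : OrthogonalGroup H) : Cplx H →L[ℂ] Cplx H :=
  if h : ∃ R, U.IsResolvent R then h.choose else 0

theorem OrthogonalGroup.resolvent_isPositive (U : OrthogonalGroup H) :
    U.resolvent.IsPositive := by
  unfold OrthogonalGroup.resolvent
  split_ifs with h
  · exact h.choose_spec.1
  · exact ContinuousLinearMap.isPositive_zero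

/-- The complexification, to be equipped with the deformed inner product. -/
def PreHU (_U : OrthogonalGroup H) : Type _ := Cplx H

variable (U : OrthogonalGroup H)

instance : AddCommGroup (PreHU U) := inferInstanceAs (AddCommGroup (Cplx H))
instance : Module ℂ (PreHU U) := inferInstanceAs (Module ℂ (Cplx H))

/-- The identification of `PreHU U` with the complexification, forgetting the inner product. -/
def PreHU.equiv : PreHU U ≃ₗ[ℂ] Cplx H := LinearEquiv.refl ℂ (Cplx H)

/-- The deformed inner product `⟨ξ, ζ⟩_U = ⟨2 (1 + A⁻¹)⁻¹ ξ, ζ⟩`. -/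
@[reducible] def PreHU.core : PreInnerProductSpace.Core ℂ (PreHU U) where
  inner x y := inner ℂ ((2 : ℂ) • U.resolvent (PreHU.equiv U x)) (PreHU.equiv U y)
  conj_inner_symm x y := by
    have h := U.resolvent_isPositive.1 (PreHU.equiv U x) (PreHU.equiv U y)
    simp only [ContinuousLinearMap.coe_coe] at h
    rw [inner_conj_symm, inner_smul_left, inner_smul_right, h, map_ofNat]
  re_inner_nonneg x := by
    have h := U.resolvent_isPositive.2 (PreHU.equiv U x)
    rw [ContinuousLinearMap.reApplyInnerSelf_apply] at h
    have h2 : (2 : ℂ) = ((2 : ℝ) : ℂ) := by simp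
    rw [inner_smul_left, map_ofNat, h2, RCLike.re_eq_complex_re, Complex.re_ofReal_mul]
    exact mul_nonneg zero_le_two h
  add_left x y z := by
    rw [map_add, map_add, smul_add, inner_add_left]
  smul_left x y r := by
    rw [map_smul, map_smul, smul_comm, inner_smul_left]

instance : SeminormedAddCommGroup (PreHU U) :=
  @InnerProductSpace.Core.toSeminormedAddCommGroup ℂ (PreHU U) _ _ _ (PreHU.core U)

instance : InnerProductSpace ℂ (PreHU U) := InnerProductSpace.ofCore (PreHU.core U)

/-- The Hilbert space `H_U`: the completion of the complexification of `H` for `⟨·, ·⟩_U`. -/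
abbrev HU : Type _ := UniformSpace.Completion (PreHU U)

/-- The canonical map from the complexification of `H` to `H_U`. -/
def toHU (x : Cplx H) : HU U := (((PreHU.equiv U).symm x : PreHU U) : HU U)

end OneParameter

/-! ### The `q`-Fock space -/

section Fock

/-- The number of inversions of a permutation. -/
def inversions {n : ℕ} (π : Equiv.Perm (Fin n)) : ℕ :=
  (Finset.univ.filter fun p : Fin n × Fin n => p.1 < p.2 ∧ π p.2 < π p.1).card

variable (q : Set.Ioo (-1 : ℝ) 1) (K : Type*) [NormedAddCommGroup K] [InnerProductSpace ℂ K]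

variable {K} in
/-- The `q`-deformed inner product of the elementary tensors `u₁ ⊗ ⋯ ⊗ uₙ` and `v₁ ⊗ ⋯ ⊗ vₘ`,
which are represented by lists: it is zero for `n ≠ m`, and
`∑_π q ^ |π| ∏ᵢ ⟨uᵢ, v_{π i}⟩` for `n = m`. (The default value of `getD` plays no role.) -/
def qInner (u v : List K) : ℂ :=
  if u.length = v.length then
    ∑ π : Equiv.Perm (Fin u.length),
      ((q : ℝ) : ℂ) ^ inversions π * ∏ i : Fin u.length, inner ℂ (u.getD i 0) (v.getD (π i) 0)
  else 0

/-- Formal linear combinations of elementary tensors, of all degrees. The multilinearity relations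
between elementary tensors are in the kernel of the `q`-deformed inner product, so that the
separated completion of this space is the `q`-Fock space. -/
def PreFock (_q : Set.Ioo (-1 : ℝ) 1) (K : Type*) : Type _ := List K →₀ ℂ

instance : AddCommGroup (PreFock q K) := inferInstanceAs (AddCommGroup (List K →₀ ℂ))
instance : Module ℂ (PreFock q K) := inferInstanceAs (Module ℂ (List K →₀ ℂ))

variable {K}

/-- The sesquilinear extension of `qInner`. -/
def PreFock.form (f g : List K →₀ ℂ) : ℂ :=
  f.sum fun u a => g.sum fun v b => (starRingEnd ℂ) a * b * qInner q u v

theorem inversions_symm {n : ℕ} (π : Equiv.Perm (Fin n)) : inversions π⁻¹ = inversions π := by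
  unfold inversions
  apply Finset.card_bij' (fun p _ => (π⁻¹ p.2, π⁻¹ p.1)) (fun p _ => (π p.2, π p.1))
  · rintro ⟨a, b⟩ h; simpa [and_comm] using h
  · rintro ⟨a, b⟩ h; simpa [and_comm] using h
  · rintro ⟨a, b⟩ h; simp
  · rintro ⟨a, b⟩ h; simp

theorem qInner_conj_symm (u v : List K) : (starRingEnd ℂ) (qInner q v u) = qInner q u v := by
  unfold qInner
  by_cases h : u.length = v.length
  · rw [if_pos h, if_pos h.symm]
    generalize hn : v.length = n at *
    have hu : u.length = n := h
    clear h
    have key : ∀ m, m = n → (∑ π : Equiv.Perm (Fin m), ((q : ℝ) : ℂ) ^ inversions π *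
        ∏ i : Fin m, inner ℂ (u.getD i 0) (v.getD (π i) 0)) = ∑ π : Equiv.Perm (Fin n),
        ((q : ℝ) : ℂ) ^ inversions π * ∏ i : Fin n, inner ℂ (u.getD i 0) (v.getD (π i) 0) := by
      rintro m rfl; rfl
    rw [key _ hu, map_sum, ← Equiv.sum_comp (Equiv.inv (Equiv.Perm (Fin n)))]
    refine Finset.sum_congr rfl fun π _ => ?_
    rw [map_mul, map_pow, Complex.conj_ofReal, map_prod, Equiv.inv_apply, inversions_symm]
    congr 1
    rw [← Equiv.prod_comp π]
    refine Finset.prod_congr rfl fun i _ => ?_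
    rw [inner_conj_symm]
    simp
  · rw [if_neg h, if_neg (Ne.symm h)]
    simp

/-- The number of inversions of `π σ⁻¹` counts the pairs on which `σ` and `π` disagree. -/
theorem pow_inversions_mul_inv {n : ℕ} (z : ℂ) (σ π : Equiv.Perm (Fin n)) :
    z ^ inversions (π * σ⁻¹) =
      ∏ p ∈ Finset.univ.filter (fun p : Fin n × Fin n => p.1 < p.2),
        (if (σ p.1 < σ p.2 ↔ π p.1 < π p.2) then 1 else z) := by
  rw [Finset.prod_ite, Finset.prod_const_one, one_mul, Finset.prod_const]
  congr 1
  unfold inversions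
  symm
  refine Finset.card_bij (fun p _ => if σ p.1 < σ p.2 then (σ p.1, σ p.2) else (σ p.2, σ p.1))
    ?_ ?_ ?_
  · rintro ⟨a, b⟩ h
    simp only [Finset.mem_filter, Finset.mem_univ, true_and] at h ⊢
    have hσ : σ a ≠ σ b := fun e => h.1.ne (σ.injective e)
    have hπ : π a ≠ π b := fun e => h.1.ne (π.injective e)
    split_ifs with h1
    · refine ⟨h1, ?_⟩
      simp only [Equiv.Perm.coe_mul, Function.comp_apply, Equiv.Perm.inv_def, Equiv.symm_apply_apply]
      grind
    · refine ⟨?_, ?_⟩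
      · simp only; grind
      · simp only [Equiv.Perm.coe_mul, Function.comp_apply, Equiv.Perm.inv_def, Equiv.symm_apply_apply]
        grind
  · rintro ⟨a, b⟩ h ⟨c, d⟩ h'
    simp only [Finset.mem_filter, Finset.mem_univ, true_and] at h h' ⊢
    have := σ.injective
    split_ifs <;> intro e <;> simp only [Prod.mk.injEq, EmbeddingLike.apply_eq_iff_eq] at e ⊢ <;>
      grind
  · rintro ⟨a, b⟩ h
    rw [Finset.mem_filter] at h
    replace h := h.2
    simp only [Equiv.Perm.coe_mul, Function.comp_apply, Equiv.Perm.inv_def] at h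
    have hne : σ.symm a ≠ σ.symm b := fun e => h.1.ne (σ.symm.injective e)
    rcases lt_or_gt_of_ne hne with hl | hl
    · refine ⟨(σ.symm a, σ.symm b), ?_, ?_⟩
      · simp only [Finset.mem_filter, Finset.mem_univ, true_and]
        grind
      · simp [h.1]
    · refine ⟨(σ.symm b, σ.symm a), ?_, ?_⟩
      · simp only [Finset.mem_filter, Finset.mem_univ, true_and]
        grind
      · simp [h.1.not_gt]

theorem posSemidef_prod {ι κ : Type*} [Finite ι] (s : Finset κ) (M : κ → Matrix ι ι ℂ)
    (hM : ∀ k ∈ s, (M k).PosSemidef) :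
    (Matrix.of fun x y => ∏ k ∈ s, M k x y).PosSemidef := by
  classical
  induction s using Finset.induction_on with
  | empty =>
    rw [show (Matrix.of fun x y => ∏ k ∈ (∅ : Finset κ), M k x y)
      = Matrix.gram ℂ (fun _ : ι => (1 : ℂ)) by ext x y; simp [Matrix.gram_apply]]
    exact Matrix.posSemidef_gram ℂ fun _ : ι => (1 : ℂ)
  | insert a s ha ih =>
    have h := (hM a (Finset.mem_insert_self a s)).hadamard
      (ih fun k hk => hM k (Finset.mem_insert_of_mem hk))
    rw [show (Matrix.of fun x y => ∏ k ∈ insert a s, M k x y)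
      = Matrix.hadamard (M a) (Matrix.of fun x y => ∏ k ∈ s, M k x y) by
        ext x y; simp [Finset.prod_insert ha]]
    exact h

theorem posSemidef_sign {ι : Type*} [Finite ι] (ε : ι → Prop) [DecidablePred ε] :
    (Matrix.of fun x y => if (ε x ↔ ε y) then (1 : ℂ) else ((q : ℝ) : ℂ)).PosSemidef := by
  have ha : (0 : ℝ) ≤ (1 + (q : ℝ)) / 2 := by have := q.2.1; linarith
  have hb : (0 : ℝ) ≤ (1 - (q : ℝ)) / 2 := by have := q.2.2; linarith
  obtain ⟨α, hα⟩ : ∃ α : ℝ, α * α = (1 + (q : ℝ)) / 2 := ⟨_, Real.mul_self_sqrt ha⟩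
  obtain ⟨β, hβ⟩ : ∃ β : ℝ, β * β = (1 - (q : ℝ)) / 2 := ⟨_, Real.mul_self_sqrt hb⟩
  let w : ι → EuclideanSpace ℂ (Fin 2) := fun x => !₂[(α : ℂ), if ε x then (β : ℂ) else -(β : ℂ)]
  suffices h : (Matrix.of fun x y => if (ε x ↔ ε y) then (1 : ℂ) else ((q : ℝ) : ℂ)) =
      Matrix.gram ℂ w by
    rw [h]
    exact Matrix.posSemidef_gram ℂ w
  ext x y
  have ea : (α : ℂ) * α = (1 + ((q : ℝ) : ℂ)) / 2 := by rw [← Complex.ofReal_mul, hα]; push_cast; ring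
  have eb : (β : ℂ) * β = (1 - ((q : ℝ) : ℂ)) / 2 := by rw [← Complex.ofReal_mul, hβ]; push_cast; ring
  rw [Matrix.gram_apply, PiLp.inner_apply, Fin.sum_univ_two]
  have e0 : ∀ z, w z 0 = (α : ℂ) := fun _ => rfl
  have e1 : ∀ z, w z 1 = if ε z then (β : ℂ) else -(β : ℂ) := fun _ => rfl
  by_cases hx : ε x <;> by_cases hy : ε y <;>
    simp only [Matrix.of_apply, e0, e1, RCLike.inner_apply, hx, hy, if_true, if_false, map_neg,
      Complex.conj_ofReal, iff_self, iff_false, iff_true, not_true, neg_mul, mul_neg, neg_neg, ea,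
      eb] <;> ring

/-- Positivity of the `q`-deformed inner product on tensors of a fixed degree. -/
theorem qInner_nonneg (n : ℕ) (s : Finset (List K)) (hs : ∀ u ∈ s, u.length = n)
    (a : List K → ℂ) :
    0 ≤ ∑ u ∈ s, ∑ v ∈ s, (starRingEnd ℂ) (a u) * a v * qInner q u v := by
  classical
  let M : Matrix (s × Equiv.Perm (Fin n)) (s × Equiv.Perm (Fin n)) ℂ := Matrix.of fun x y =>
    (∏ p ∈ Finset.univ.filter (fun p : Fin n × Fin n => p.1 < p.2),
      (if (x.2 p.1 < x.2 p.2 ↔ y.2 p.1 < y.2 p.2) then (1 : ℂ) else ((q : ℝ) : ℂ))) *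
    ∏ i : Fin n, inner ℂ ((x.1 : List K).getD (x.2 i) 0) ((y.1 : List K).getD (y.2 i) 0)
  have hM : M.PosSemidef := by
    have h1 := posSemidef_prod (ι := s × Equiv.Perm (Fin n))
      (Finset.univ.filter (fun p : Fin n × Fin n => p.1 < p.2))
      (fun p => Matrix.of fun x y =>
        if (x.2 p.1 < x.2 p.2 ↔ y.2 p.1 < y.2 p.2) then (1 : ℂ) else ((q : ℝ) : ℂ))
      (fun p _ => posSemidef_sign q fun x : s × Equiv.Perm (Fin n) => x.2 p.1 < x.2 p.2)
    have h2 := posSemidef_prod (ι := s × Equiv.Perm (Fin n)) (Finset.univ : Finset (Fin n))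
      (fun i => Matrix.gram ℂ fun x : s × Equiv.Perm (Fin n) => (x.1 : List K).getD (x.2 i) 0)
      (fun i _ => Matrix.posSemidef_gram ℂ
        fun x : s × Equiv.Perm (Fin n) => (x.1 : List K).getD (x.2 i) 0)
    exact h1.hadamard h2
  have h := hM.dotProduct_mulVec_nonneg fun x => a x.1
  have key : ∀ u v : s, ∑ σ : Equiv.Perm (Fin n), ∑ π : Equiv.Perm (Fin n), M (u, σ) (v, π)
      = (n.factorial : ℂ) * qInner q (u : List K) (v : List K) := by
    intro u v
    have hu := hs u u.2
    have hv := hs v v.2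
    have e1 : qInner q (u : List K) v = ∑ τ : Equiv.Perm (Fin n),
        ((q : ℝ) : ℂ) ^ inversions τ *
          ∏ i : Fin n, inner ℂ ((u : List K).getD i 0) ((v : List K).getD (τ i) 0) := by
      have key : ∀ m, m = n → (∑ π : Equiv.Perm (Fin m), ((q : ℝ) : ℂ) ^ inversions π *
          ∏ i : Fin m, inner ℂ ((u : List K).getD i 0) ((v : List K).getD (π i) 0)) =
          ∑ π : Equiv.Perm (Fin n), ((q : ℝ) : ℂ) ^ inversions π *
          ∏ i : Fin n, inner ℂ ((u : List K).getD i 0) ((v : List K).getD (π i) 0) := by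
        rintro m rfl; rfl
      unfold qInner
      rw [if_pos (hu.trans hv.symm), key _ hu]
    have e2 : ∀ σ : Equiv.Perm (Fin n), ∑ π : Equiv.Perm (Fin n), M (u, σ) (v, π)
        = qInner q (u : List K) v := by
      intro σ
      rw [e1]
      refine Eq.trans ?_ (Equiv.sum_comp (Equiv.mulRight σ⁻¹) _)
      refine Finset.sum_congr rfl fun π _ => ?_
      simp only [M, Matrix.of_apply, Equiv.coe_mulRight, pow_inversions_mul_inv]
      congr 1
      refine Eq.trans ?_ (Equiv.prod_comp σ _)
      refine (Finset.prod_congr rfl fun i _ => ?_)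
      simp
    rw [Finset.sum_congr rfl fun σ _ => e2 σ]
    simp [Fintype.card_perm]
  have h3 : star (fun x : s × Equiv.Perm (Fin n) => a x.1) ⬝ᵥ
      (M.mulVec fun x : s × Equiv.Perm (Fin n) => a x.1)
      = (n.factorial : ℂ) * ∑ u ∈ s, ∑ v ∈ s, (starRingEnd ℂ) (a u) * a v * qInner q u v := by
    calc _ = ∑ u : s, ∑ v : s, (starRingEnd ℂ) (a u) * a v *
          ∑ σ : Equiv.Perm (Fin n), ∑ π : Equiv.Perm (Fin n), M (u, σ) (v, π) := by
          simp only [dotProduct, Matrix.mulVec, Fintype.sum_prod_type, Finset.mul_sum,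
            Pi.star_apply, RCLike.star_def]
          refine Finset.sum_congr rfl fun u _ => ?_
          rw [Finset.sum_comm]
          refine Finset.sum_congr rfl fun v _ => Finset.sum_congr rfl fun σ _ =>
            Finset.sum_congr rfl fun π _ => by ring
      _ = (n.factorial : ℂ) * ∑ u : s, ∑ v : s,
            (starRingEnd ℂ) (a u) * a v * qInner q (u : List K) (v : List K) := by
          simp only [key, Finset.mul_sum]
          refine Finset.sum_congr rfl fun u _ => Finset.sum_congr rfl fun v _ => by ring
      _ = _ := by
          rw [← Finset.sum_coe_sort s]
          congr 1
          refine Finset.sum_congr rfl fun u _ => ?_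
          rw [← Finset.sum_coe_sort s]
  rw [h3] at h
  have hn : (n.factorial : ℂ) ≠ 0 := by exact_mod_cast n.factorial_ne_zero
  have hi : (0 : ℂ) ≤ (((n.factorial : ℝ)⁻¹ : ℝ) : ℂ) := by
    rw [Complex.zero_le_real]; positivity
  have h4 := mul_nonneg hi h
  rwa [← mul_assoc, Complex.ofReal_inv, Complex.ofReal_natCast, inv_mul_cancel₀ hn, one_mul] at h4

theorem PreFock.form_self_nonneg (f : List K →₀ ℂ) : 0 ≤ PreFock.form q f f := by
  classical
  unfold PreFock.form Finsupp.sum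
  rw [← Finset.sum_fiberwise_of_maps_to (s := f.support)
    (t := f.support.image List.length) (g := List.length)
    (fun u hu => Finset.mem_image_of_mem _ hu)]
  refine Finset.sum_nonneg fun n _ => ?_
  have h := qInner_nonneg q n (f.support.filter fun u => u.length = n)
    (fun u hu => (Finset.mem_filter.mp hu).2) f
  refine h.trans_eq (Finset.sum_congr rfl fun u hu => ?_)
  refine Finset.sum_subset (Finset.filter_subset _ _) fun v hv hv' => ?_
  have h1 := (Finset.mem_filter.mp hu).2
  have h2 : v.length ≠ n := fun e => hv' (Finset.mem_filter.mpr ⟨hv, e⟩)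
  unfold qInner
  rw [if_neg (by rw [h1]; exact h2.symm), mul_zero]

variable (K) in
/-- The identification of `PreFock q K` with the formal linear combinations of elementary tensors,
forgetting the inner product. -/
def PreFock.equiv : PreFock q K ≃ₗ[ℂ] (List K →₀ ℂ) := LinearEquiv.refl ℂ (List K →₀ ℂ)

variable (K) in
/-- The `q`-deformed inner product. -/
@[reducible] def PreFock.core : PreInnerProductSpace.Core ℂ (PreFock q K) where
  inner f g := PreFock.form q (PreFock.equiv q K f) (PreFock.equiv q K g)
  conj_inner_symm f g := by
    simp only [PreFock.form, Finsupp.sum, map_sum, map_mul, Complex.conj_conj, qInner_conj_symm]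
    rw [Finset.sum_comm]
    refine Finset.sum_congr rfl fun u _ => Finset.sum_congr rfl fun v _ => by ring
  re_inner_nonneg f := (Complex.nonneg_iff.mp (PreFock.form_self_nonneg q _)).1
  add_left f g h := by
    rw [map_add]
    refine Finsupp.sum_add_index' (fun u => ?_) fun u a b => ?_
    · simp [Finsupp.sum]
    · simp [Finsupp.sum, add_mul, Finset.sum_add_distrib]
  smul_left f g r := by
    rw [map_smul]
    refine (Finsupp.sum_smul_index fun u => ?_).trans ?_
    · simp [Finsupp.sum]
    · simp [PreFock.form, Finsupp.sum, Finset.mul_sum, mul_assoc]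

instance : SeminormedAddCommGroup (PreFock q K) :=
  @InnerProductSpace.Core.toSeminormedAddCommGroup ℂ (PreFock q K) _ _ _ (PreFock.core q K)

instance : InnerProductSpace ℂ (PreFock q K) := InnerProductSpace.ofCore (PreFock.core q K)

variable (K) in
/-- The `q`-Fock space over the Hilbert space `K`. -/
abbrev Fock : Type _ := UniformSpace.Completion (PreFock q K)

/-- The elementary tensor `w₁ ⊗ ⋯ ⊗ wₙ` in the `q`-Fock space. -/
def tensor (w : List K) : Fock q K := ((PreFock.equiv q K).symm (Finsupp.single w 1) : PreFock q K)

/-- The vacuum vector. -/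
def vacuum : Fock q K := tensor q ([] : List K)

open Classical in
/-- The left `q`-creation operator `c(ξ)`: the (unique) bounded operator with
`c(ξ) (w₁ ⊗ ⋯ ⊗ wₙ) = ξ ⊗ w₁ ⊗ ⋯ ⊗ wₙ` for all elementary tensors, including the vacuum. -/
def creation (ξ : K) : Fock q K →L[ℂ] Fock q K :=
  if h : ∃ T : Fock q K →L[ℂ] Fock q K, ∀ w : List K, T (tensor q w) = tensor q (ξ :: w)
  then h.choose else 0

/-- The left `q`-annihilation operator `c*(ξ)`, the adjoint of `c(ξ)`. -/
def annihilation (ξ : K) : Fock q K →L[ℂ] Fock q K :=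
  ContinuousLinearMap.adjoint (creation q ξ)

end Fock

/-! ### The `q`-Araki-Woods algebra and left Wick operators -/

section Algebra

/-- The von Neumann algebra generated by a set of operators: the bicommutant of the set together
with its adjoints. -/
def generatedVonNeumannAlgebra {F : Type*} [NormedAddCommGroup F] [InnerProductSpace ℂ F]
    [CompleteSpace F] (S : Set (F →L[ℂ] F)) : VonNeumannAlgebra F where
  toStarSubalgebra := StarSubalgebra.centralizer ℂ
    (StarSubalgebra.centralizer ℂ S : Set (F →L[ℂ] F))
  centralizer_centralizer' := by
    change Set.centralizer (Set.centralizer (SetLike.coe (StarSubalgebra.centralizer ℂ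
      (SetLike.coe (StarSubalgebra.centralizer ℂ S))))) = SetLike.coe (StarSubalgebra.centralizer ℂ
      (SetLike.coe (StarSubalgebra.centralizer ℂ S)))
    rw [StarSubalgebra.coe_centralizer_centralizer]
    simp

variable {H : Type*} [NormedAddCommGroup H] [InnerProductSpace ℝ H]

/-- The `q`-deformed Araki-Woods von Neumann algebra, generated by the operators
`c(ξ) + c*(ξ)`, `ξ ∈ H`. -/
def arakiWoods (q : Set.Ioo (-1 : ℝ) 1) (U : OrthogonalGroup H) :
    VonNeumannAlgebra (Fock q (HU U)) :=
  generatedVonNeumannAlgebra (Set.range fun ξ : H =>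
    creation q (toHU U (Cplx.ofReal ξ)) + annihilation q (toHU U (Cplx.ofReal ξ)))

open Classical in
/-- The left Wick operator `W(v)`: the (unique) operator `x` in the `q`-Araki-Woods algebra with
`x Ω = v`. -/
def wick (q : Set.Ioo (-1 : ℝ) 1) (U : OrthogonalGroup H) (v : Fock q (HU U)) :
    Fock q (HU U) →L[ℂ] Fock q (HU U) :=
  if h : ∃ x, x ∈ arakiWoods q U ∧ x (vacuum q) = v then h.choose else 0

end Algebra

/-! ### Constants and the sequences of operators -/

/-- `d_n = ∏_{j=1}^n (1 - q ^ j)`. -/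
def dFin (q : ℝ) (n : ℕ) : ℝ := ∏ j ∈ Finset.Icc 1 n, (1 - q ^ j)

/-- `d_∞ = ∏_{j ≥ 1} (1 - q ^ j)`. -/
def dInf (q : ℝ) : ℝ := ∏' j : ℕ, (1 - q ^ (j + 1))

/-- `C_q = ∏_{j ≥ 1} 1 / (1 - |q| ^ j)`. -/
def constC (q : ℝ) : ℝ := ∏' j : ℕ, 1 / (1 - |q| ^ (j + 1))

section Block

variable {H : Type*} [NormedAddCommGroup H] [InnerProductSpace ℝ H]

/-- `f₁, f₂` is an orthonormal basis of a two-dimensional subspace, invariant under `U`, on which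
`U t` is the rotation by the angle `t log lam`. For `0 < lam < 1` these are precisely the
two-dimensional invariant subspaces on which `U` is ergodic. -/
structure IsRotationBlock (U : OrthogonalGroup H) (lam : ℝ) (f₁ f₂ : H) : Prop where
  orthonormal : Orthonormal ℝ ![f₁, f₂]
  apply_fst : ∀ t : ℝ, U t f₁ = Real.cos (t * Real.log lam) • f₁ + Real.sin (t * Real.log lam) • f₂
  apply_snd : ∀ t : ℝ,
    U t f₂ = -Real.sin (t * Real.log lam) • f₁ + Real.cos (t * Real.log lam) • f₂

/-- The vector `e = (lam + 1)^{1/2} / (2 lam^{1/4}) (f₁ + i f₂)`. -/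
def blockVector (lam : ℝ) (f₁ f₂ : H) : Cplx H :=
  (((lam + 1) ^ (1 / 2 : ℝ) / (2 * lam ^ (1 / 4 : ℝ)) : ℝ) : ℂ) • Cplx.mk f₁ f₂

variable (q : Set.Ioo (-1 : ℝ) 1) (U : OrthogonalGroup H)

/-- `S_n = (1/n) ∑_{m=1}^n (1-q)^{2m} W(ē^m e^m) c(ē)^m c(e)^m`, where `e` and `ē` are given as
vectors of the complexification. -/
def cesaroS (e : Cplx H) (n : ℕ) : Fock q (HU U) →L[ℂ] Fock q (HU U) :=
  (1 / (n : ℂ)) • ∑ m ∈ Finset.Icc 1 n,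
    (((1 - (q : ℝ)) ^ (2 * m) : ℝ) : ℂ) •
      (wick q U (tensor q (List.replicate m (toHU U e.conj) ++ List.replicate m (toHU U e))) *
        creation q (toHU U e.conj) ^ m * creation q (toHU U e) ^ m)

/-- `T_n = (1-q)^n lam^{n/2} c*(e)^n c(e)^n`. -/
def seqT (lam : ℝ) (e : Cplx H) (n : ℕ) : Fock q (HU U) →L[ℂ] Fock q (HU U) :=
  (((1 - (q : ℝ)) ^ n * lam ^ ((n : ℝ) / 2) : ℝ) : ℂ) •
    (annihilation q (toHU U e) ^ n * creation q (toHU U e) ^ n)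

end Block

end QArakiWoods

end

noncomputable section

set_option linter.unusedSectionVars false

namespace QArakiWoods

/-! Put r = √λ, a = α c(e) and b = β c(ē) with α² = (1-q) r and β² = (1-q)/r. Since ‖e‖² = 1/r, ‖ē‖²
= r and e ⊥ ē in `HU`, both are normalised q-oscillators, a*a = (1-q) + q aa*, and a*b = q ba*. With
X = 1 - aa* one has a*a = 1 - qX and Xa = q aX, hence a*ⁿaⁿ = ∏_{j≤n} (1 - q^j X). As ‖X‖ ≤ 1, these
products converge in norm to T. Their inverses stay bounded by C_q, so T is invertible. The same
product formula gives ‖aⁿ‖² ≤ C_q for all n.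

The Wick formula expands W(ē^m e^m) into normally ordered monomials. After rescaling, the m-th
summand of n S_n is a sum over i + k = m and j + l = m of q-binomials times q^{kj} r^{i-j} bⁱ aʲ a*ᵏ
b*ˡ b^m a^m. Three groups behave differently. For j = 0, b*^m b^m a^m is close to d_m a^m and
a*^{m-i} a^m tends to T aⁱ, so dominated convergence produces the series S (`tendsto_mainPart`). For
j, k ≥ 1 the weight q^{kj} r^{i-j} decays faster than the number of terms grows (`mixed_weight_le`,
`tendsto_mixedPart`). For k = 0 and j ≥ 1 the weight is r^l and need not decay. However, for fixed l
the summands of different degrees have almost orthogonal ranges, so a sum of N of them is O(√N) and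
its Cesàro mean vanishes (`norm_sum_mul_sq_le`, `tendsto_cesaro_creationPart`). Finally S is d_∞ T
plus a tail of norm at most d_∞ C_q³ r/(1-r), and a Neumann series gives the invertibility
criterion.

The analytic objects are defined by choice with default value 0, so their existence and uniqueness
carry content. The operator (1+A⁻¹)⁻¹ is built without the spectral theorem: 1 + A has closed range
by a three-lines estimate, and dense range by Gaussian regularisation and Liouville
(`flowRange_eq_top`). Creation operators are bounded by induction on the degree
(`PreFock.norm_create_le`). Wick operators are identified because the vacuum is separating: enough
right field operators commute with the algebra (`eq_of_apply_vacuum_eq`). -/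

/-! ### Uniqueness of analytic continuation from the edge of a strip -/

/-- The closed horizontal strip `-a ≤ Im z ≤ 0`. -/
def closedStrip (a : ℝ) : Set ℂ := {z | -a ≤ z.im ∧ z.im ≤ 0}

/-- The open horizontal strip `-a < Im z < 0`. -/
def openStrip (a : ℝ) : Set ℂ := {z | -a < z.im ∧ z.im < 0}

theorem openStrip_eq (a : ℝ) : openStrip a = Complex.im ⁻¹' Set.Ioo (-a) 0 := rfl

theorem isOpen_openStrip (a : ℝ) : IsOpen (openStrip a) :=
  isOpen_Ioo.preimage Complex.continuous_im

theorem openStrip_subset (a : ℝ) : openStrip a ⊆ closedStrip a := fun _ h => ⟨h.1.le, h.2.le⟩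

theorem closure_openStrip {a : ℝ} (ha : 0 < a) : closure (openStrip a) = closedStrip a := by
  rw [openStrip_eq, ← Complex.isOpenMap_im.preimage_closure_eq_closure_preimage
    Complex.continuous_im, closure_Ioo (by linarith)]
  rfl

theorem convex_openStrip (a : ℝ) : Convex ℝ (openStrip a) :=
  (convex_Ioo (-a) 0).linear_preimage Complex.imLm

/-- A function which vanishes on the upper boundary of a strip vanishes near that boundary: its
product with its rotations by multiples of a right angle vanishes on the boundary of a square. -/
theorem eq_zero_of_boundary_aux {a : ℝ} {g : ℂ → ℂ} (hc : ContinuousOn g (closedStrip a))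
    (hd : DifferentiableOn ℂ g (openStrip a)) (h0 : ∀ t : ℝ, g t = 0) {p : ℂ}
    (hp : -(a / 2) ≤ p.im) (hp' : p.im < 0) : g p = 0 := by
  -- The square of half-side δ centred at p touches the real axis with its top side, and stays in
  -- the strip because 2δ ≤ a. The product of the four rotated copies of g equals g(p)⁴ at the
  -- centre, and on each side one factor has a real argument.
  set δ : ℝ := -p.im with hδ
  have hδ0 : 0 < δ := by rw [hδ]; linarith
  let Q : Set ℂ := Set.Ioo (-δ) δ ×ℂ Set.Ioo (-δ) δ
  have hcl : closure Q = Set.Icc (-δ) δ ×ℂ Set.Icc (-δ) δ := by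
    rw [Complex.closure_reProdIm, closure_Ioo (by linarith)]
  have hreal : ∀ z : ℂ, z.im = 0 → g z = 0 := fun z hz => by
    rw [← h0 z.re]; congr 1; apply Complex.ext <;> simp [hz]
  have key : ∀ u : ℂ, (u = 1 ∨ u = Complex.I ∨ u = -1 ∨ u = -Complex.I) →
      DiffContOnCl ℂ (fun w => g (p + u * w)) Q := by
    intro u hu
    constructor
    · refine hd.comp (by fun_prop) ?_
      intro w hw
      obtain ⟨⟨h1, h2⟩, h3, h4⟩ := hw
      rcases hu with rfl | rfl | rfl | rfl <;> constructor <;> simp <;> linarith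
    · rw [hcl]
      refine hc.comp (by fun_prop) ?_
      intro w hw
      obtain ⟨⟨h1, h2⟩, h3, h4⟩ := hw
      rcases hu with rfl | rfl | rfl | rfl <;> constructor <;> simp <;> linarith
  have hD : DiffContOnCl ℂ (fun w => (g (p + 1 * w) * g (p + Complex.I * w)) *
      (g (p + (-1) * w) * g (p + (-Complex.I) * w))) Q := by
    refine ⟨?_, ?_⟩
    · exact (((key 1 (by simp)).1.mul (key _ (by simp)).1)).mul
        ((key _ (by simp)).1.mul (key _ (by simp)).1)
    · exact (((key 1 (by simp)).2.mul (key _ (by simp)).2)).mul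
        ((key _ (by simp)).2.mul (key _ (by simp)).2)
  have hb : Bornology.IsBounded Q :=
    (Metric.isBounded_Ioo _ _).reProdIm (Metric.isBounded_Ioo _ _)
  have h := Complex.norm_le_of_forall_mem_frontier_norm_le hb hD (C := 0) ?_ (z := 0)
    (by rw [hcl]; constructor <;> simp [hδ0.le])
  · by_contra hne
    have hpos := norm_pos_iff.mpr hne
    simp only [mul_zero, add_zero, norm_mul] at h
    exact absurd h (not_le.mpr (by positivity))
  · intro w hw
    rw [Complex.frontier_reProdIm, closure_Ioo (by linarith), frontier_Ioo (by linarith)] at hw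
    have hw' : w.re = -δ ∨ w.re = δ ∨ w.im = -δ ∨ w.im = δ := by
      rcases hw with ⟨_, hw⟩ | ⟨hw, _⟩
      · rcases hw with hw | hw <;> simp_all
      · rcases hw with hw | hw <;> simp_all
    rw [norm_le_zero_iff]
    rcases hw' with hw' | hw' | hw' | hw'
    · rw [hreal (p + -Complex.I * w) (by simp [hw', hδ]), mul_zero, mul_zero]
    · rw [hreal (p + Complex.I * w) (by simp [hw', hδ]), mul_zero, zero_mul]
    · rw [hreal (p + -1 * w) (by simp [hw', hδ]), zero_mul, mul_zero]
    · rw [hreal (p + 1 * w) (by simp [hw', hδ]), zero_mul, zero_mul]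

theorem eq_zero_of_boundary {a : ℝ} (ha : 0 < a) {g : ℂ → ℂ}
    (hc : ContinuousOn g (closedStrip a)) (hd : DifferentiableOn ℂ g (openStrip a))
    (h0 : ∀ t : ℝ, g t = 0) {z : ℂ} (hz : z ∈ closedStrip a) : g z = 0 := by
  have h1 : Set.EqOn g 0 (openStrip a) := by
    refine (hd.analyticOnNhd (isOpen_openStrip a)).eqOn_zero_of_preconnected_of_eventuallyEq_zero
      (convex_openStrip a).isPreconnected (z₀ := ((-(a / 4) : ℝ) : ℂ) * Complex.I) ?_ ?_
    · constructor <;> simp <;> linarith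
    · have : {z : ℂ | -(a / 2) < z.im ∧ z.im < 0} ∈ 𝓝 (((-(a / 4) : ℝ) : ℂ) * Complex.I) := by
        have := isOpen_openStrip (a / 2)
        refine this.mem_nhds ?_
        constructor <;> simp <;> linarith
      filter_upwards [this] with w hw
      exact eq_zero_of_boundary_aux hc hd h0 hw.1.le hw.2
  have h2 : Set.EqOn g 0 (closedStrip a) :=
    h1.of_subset_closure hc continuousOn_const (openStrip_subset a) (closure_openStrip ha).ge
  exact h2 hz

theorem eq_of_boundary {a : ℝ} (ha : 0 < a) {E : Type*} [NormedAddCommGroup E]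
    [InnerProductSpace ℂ E] {F G : ℂ → E}
    (hFc : ContinuousOn F (closedStrip a)) (hFd : DifferentiableOn ℂ F (openStrip a))
    (hGc : ContinuousOn G (closedStrip a)) (hGd : DifferentiableOn ℂ G (openStrip a))
    (h0 : ∀ t : ℝ, F t = G t) {z : ℂ} (hz : z ∈ closedStrip a) : F z = G z := by
  rw [← sub_eq_zero]
  refine ext_inner_left ℂ fun v => ?_
  rw [inner_zero_right]
  refine eq_zero_of_boundary ha (g := fun z => inner ℂ v (F z - G z)) ?_ ?_ (fun t => ?_) hz
  · exact ((innerSL ℂ v).continuous.comp_continuousOn (hFc.sub hGc))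
  · exact (innerSL ℂ v).differentiable.comp_differentiableOn (hFd.sub hGd)
  · simp [h0]

/-! ### Unitary groups on a Hilbert space -/

section Flow

variable {E : Type*} [NormedAddCommGroup E] [InnerProductSpace ℂ E]

/-- A strongly continuous one-parameter group of isometries. -/
structure IsUnitaryGroup (V : ℝ → E →ₗᵢ[ℂ] E) : Prop where
  add : ∀ s t x, V (s + t) x = V s (V t x)
  zero : ∀ x, V 0 x = x
  cont : ∀ x, Continuous fun t => V t x

/-- `F` is an analytic continuation to the strip `-1 ≤ Im z ≤ 0` of the orbit of `F 0`. -/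
structure IsFlow (V : ℝ → E →ₗᵢ[ℂ] E) (F : ℂ → E) : Prop where
  cont : ContinuousOn F (closedStrip 1)
  diff : DifferentiableOn ℂ F (openStrip 1)
  real : ∀ t : ℝ, F t = V t (F 0)

variable {V : ℝ → E →ₗᵢ[ℂ] E} (hV : IsUnitaryGroup V)

include hV in
theorem IsUnitaryGroup.inner_left (s : ℝ) (x y : E) : inner ℂ (V s x) y = inner ℂ x (V (-s) y) := by
  conv_lhs => rw [← hV.zero y, ← add_neg_cancel s, hV.add]
  exact LinearIsometry.inner_map_map _ _ _

theorem zero_mem_closedStrip : (0 : ℂ) ∈ closedStrip 1 := by constructor <;> simp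
theorem neg_I_mem_closedStrip : (-Complex.I) ∈ closedStrip 1 := by constructor <;> simp

theorem add_real_mem_closedStrip {a : ℝ} {z : ℂ} (hz : z ∈ closedStrip a) (s : ℝ) :
    z + s ∈ closedStrip a := by simpa [closedStrip] using hz

theorem add_real_mem_openStrip {a : ℝ} {z : ℂ} (hz : z ∈ openStrip a) (s : ℝ) :
    z + s ∈ openStrip a := by simpa [openStrip] using hz

namespace IsFlow

variable {F G : ℂ → E}

theorem add (hF : IsFlow V F) (hG : IsFlow V G) : IsFlow V (fun z => F z + G z) :=
  ⟨hF.cont.add hG.cont, hF.diff.add hG.diff, fun t => by rw [hF.real, hG.real, map_add]⟩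

theorem smul (hF : IsFlow V F) (c : ℂ) : IsFlow V (fun z => c • F z) :=
  ⟨hF.cont.const_smul c, hF.diff.const_smul c, fun t => by rw [hF.real, map_smul]⟩

theorem sub (hF : IsFlow V F) (hG : IsFlow V G) : IsFlow V (fun z => F z - G z) :=
  ⟨hF.cont.sub hG.cont, hF.diff.sub hG.diff, fun t => by rw [hF.real, hG.real, map_sub]⟩

include hV in
-- Both sides continue the same orbit from the real axis. In particular ‖F z‖ depends only on Im z.
theorem translate (hF : IsFlow V F) (s : ℝ) {z : ℂ} (hz : z ∈ closedStrip 1) :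
    F (z + s) = V s (F z) := by
  refine eq_of_boundary one_pos (F := fun z => F (z + s)) (G := fun z => V s (F z)) ?_ ?_ ?_ ?_ ?_ hz
  · exact hF.cont.comp (by fun_prop) fun z hz => add_real_mem_closedStrip hz s
  · exact hF.diff.comp (by fun_prop) fun z hz => add_real_mem_openStrip hz s
  · exact (V s).continuous.comp_continuousOn hF.cont
  · exact ((V s).toContinuousLinearMap.differentiable).comp_differentiableOn hF.diff
  · intro t
    rw [← Complex.ofReal_add, hF.real, hF.real t, add_comm t s, hV.add]

include hV in
-- For ξ = F 0 this reads ⟨Aξ, ξ⟩ = ‖A^{1/2} ξ‖². Putting z ↦ F(-i/2 - z̄) in the conjugate-linear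
-- slot gives a holomorphic function on the half strip. It agrees on the real line with z ↦
-- ⟨F(-i/2), F z⟩ because V is unitary, and the two are compared at z = -i/2.
theorem inner_neg_I (hF : IsFlow V F) :
    inner ℂ (F (-Complex.I)) (F 0) = inner ℂ (F (-(Complex.I / 2))) (F (-(Complex.I / 2))) := by
  have hsub : closedStrip (1 / 2) ⊆ closedStrip 1 := fun z hz => ⟨by linarith [hz.1], hz.2⟩
  have hsub' : openStrip (1 / 2) ⊆ openStrip 1 := fun z hz => ⟨by linarith [hz.1], hz.2⟩
  have hmid : -(Complex.I / 2) ∈ closedStrip 1 := by constructor <;> norm_num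
  have h := eq_of_boundary (a := 1 / 2) (by norm_num)
    (F := fun z => inner ℂ (F (-(Complex.I / 2))) (F z))
    (G := fun z => inner ℂ (F (-(Complex.I / 2) - (starRingEnd ℂ) z)) (F 0))
    (z := -(Complex.I / 2)) ?_ ?_ ?_ ?_ ?_ ?_
  · rw [h]
    congr 2
    rw [map_neg, map_div₀, Complex.conj_I, map_ofNat]
    ring
  · exact (innerSL ℂ _).continuous.comp_continuousOn (hF.cont.mono hsub)
  · exact (innerSL ℂ _).differentiable.comp_differentiableOn (hF.diff.mono hsub')
  · refine ContinuousOn.inner (𝕜 := ℂ) (hF.cont.comp (by fun_prop) ?_) continuousOn_const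
    intro z hz
    constructor <;> simp <;> linarith [hz.1, hz.2]
  · have h2 : ∀ z ∈ openStrip (1 / 2), DifferentiableAt ℂ
        (fun w => inner ℂ (F 0) (F (-(Complex.I / 2) - w))) ((starRingEnd ℂ) z) := by
      intro z hz
      have h3 : -(Complex.I / 2) - (starRingEnd ℂ) z ∈ openStrip 1 := by
        constructor <;> simp <;> linarith [hz.1, hz.2]
      have h4 := hF.diff.differentiableAt ((isOpen_openStrip 1).mem_nhds h3)
      refine (innerSL ℂ (F 0)).differentiableAt.comp _ ?_
      exact DifferentiableAt.comp _ h4 (by fun_prop)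
    intro z hz
    have h5 := differentiableAt_conj_conj_iff.mpr (h2 z hz)
    refine (h5.congr_of_eventuallyEq (Eventually.of_forall fun w => ?_)).differentiableWithinAt
    simp [Function.comp_def]
  · intro t
    simp only [Complex.conj_ofReal]
    rw [hF.real, sub_eq_add_neg, ← Complex.ofReal_neg, hF.translate hV _ hmid, hV.inner_left, neg_neg]
  · constructor <;> norm_num

include hV in
theorem inner_nonneg (hF : IsFlow V F) : 0 ≤ inner ℂ (F (-Complex.I)) (F 0) := by
  rw [hF.inner_neg_I hV]
  rw [inner_self_eq_norm_sq_to_K]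
  change (0 : ℂ) ≤ ((_ : ℝ) : ℂ) ^ 2
  rw [← Complex.ofReal_pow]
  exact Complex.zero_le_real.mpr (sq_nonneg _)

include hV in
-- The cross term of ‖ξ + Aξ‖² is nonnegative since A is positive.
theorem norm_le_left (hF : IsFlow V F) : ‖F 0‖ ≤ ‖F 0 + F (-Complex.I)‖ := by
  have h := hF.inner_nonneg hV
  have h1 := norm_add_sq (𝕜 := ℂ) (F (-Complex.I)) (F 0)
  have h2 : 0 ≤ RCLike.re (inner ℂ (F (-Complex.I)) (F 0)) := (Complex.nonneg_iff.mp h).1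
  rw [add_comm (F 0)]
  nlinarith [norm_nonneg (F 0), norm_nonneg (F (-Complex.I)), norm_nonneg (F (-Complex.I) + F 0)]

include hV in
theorem norm_le_right (hF : IsFlow V F) : ‖F (-Complex.I)‖ ≤ ‖F 0 + F (-Complex.I)‖ := by
  have h := hF.inner_nonneg hV
  have h1 := norm_add_sq (𝕜 := ℂ) (F (-Complex.I)) (F 0)
  have h2 : 0 ≤ RCLike.re (inner ℂ (F (-Complex.I)) (F 0)) := (Complex.nonneg_iff.mp h).1
  rw [add_comm (F 0)]
  nlinarith [norm_nonneg (F 0), norm_nonneg (F (-Complex.I)), norm_nonneg (F (-Complex.I) + F 0)]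

theorem eq_im_add_re (z : ℂ) : z = (z.im : ℂ) * Complex.I + (z.re : ℝ) := by
  apply Complex.ext <;> simp

include hV in
-- Real translations are isometric, so F is bounded on the strip by compactness of a vertical
-- segment, and Phragmén–Lindelöf reduces to the two edges. The whole flow is thus controlled by (1
-- + A)ξ.
theorem norm_le (hF : IsFlow V F) {z : ℂ} (hz : z ∈ closedStrip 1) :
    ‖F z‖ ≤ ‖F 0 + F (-Complex.I)‖ := by
  have hn : ∀ z ∈ closedStrip 1, ‖F z‖ = ‖F ((z.im : ℂ) * Complex.I)‖ := by
    intro z hz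
    conv_lhs => rw [eq_im_add_re z]
    rw [hF.translate hV, LinearIsometry.norm_map]
    simpa [closedStrip] using hz
  have hb : ∃ M : ℝ, ∀ z ∈ closedStrip 1, ‖F z‖ ≤ M := by
    have hK : ContinuousOn (fun y : ℝ => F ((y : ℂ) * Complex.I)) (Set.Icc (-1) 0) :=
      hF.cont.comp (by fun_prop) fun y hy => by simpa [closedStrip] using hy
    obtain ⟨M, hM⟩ := isCompact_Icc.exists_bound_of_continuousOn hK
    exact ⟨M, fun z hz => by rw [hn z hz]; exact hM _ hz⟩
  obtain ⟨M, hM⟩ := hb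
  refine PhragmenLindelof.horizontal_strip (a := -1) (b := 0) ⟨hF.diff, ?_⟩ ?_ ?_ ?_ hz.1 hz.2
  · change ContinuousOn F (closure (openStrip 1))
    rw [closure_openStrip one_pos]
    exact hF.cont
  · refine ⟨0, by positivity, 0, ?_⟩
    refine Asymptotics.IsBigO.of_bound M ?_
    refine Filter.eventually_inf_principal.mpr (Eventually.of_forall fun w hw => ?_)
    simpa using hM w ⟨hw.1.le, hw.2.le⟩
  · intro w hw
    have : w ∈ closedStrip 1 := by constructor <;> norm_num [hw]
    rw [hn w this, hw]
    simpa using hF.norm_le_right hV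
  · intro w hw
    have : w ∈ closedStrip 1 := by constructor <;> norm_num [hw]
    rw [hn w this, hw]
    simpa using hF.norm_le_left hV

end IsFlow

end Flow

/-! ### Surjectivity of 1 + A -/

section Existence

open MeasureTheory

variable {E : Type*} [NormedAddCommGroup E] [InnerProductSpace ℂ E] [CompleteSpace E]
variable {V : ℝ → E →ₗᵢ[ℂ] E} (hV : IsUnitaryGroup V)

/-- The Gaussian regularisation of the orbit of `ζ`. -/
def gaussianOrbit (V : ℝ → E →ₗᵢ[ℂ] E) (n : ℝ) (ζ : E) (z : ℂ) : E :=
  Complex.exp (-(n * z ^ 2)) • ∫ s : ℝ, Complex.exp (2 * n * s * z) •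
    ((Real.exp (-n * s ^ 2) : ℂ) • V s ζ)

theorem abs_mul_exp_bound {n : ℝ} (hn : 0 < n) {R : ℝ} (s : ℝ) :
    Real.exp (R * |s|) * Real.exp (-n * s ^ 2) ≤
      Real.exp (R ^ 2 / (2 * n)) * Real.exp (-(n / 2) * s ^ 2) := by
  rw [← Real.exp_add, ← Real.exp_add, Real.exp_le_exp]
  have h : 0 ≤ (n * |s| - R) ^ 2 / (2 * n) := by positivity
  have h2 : (n * |s| - R) ^ 2 / (2 * n) = n / 2 * s ^ 2 - R * |s| + R ^ 2 / (2 * n) := by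
    rw [← sq_abs s]; field_simp; ring
  rw [h2] at h
  linarith

omit [CompleteSpace E] in
include hV in
theorem gaussianOrbit_differentiable {n : ℝ} (hn : 0 < n) (ζ : E) :
    Differentiable ℂ (gaussianOrbit V n ζ) := by
  have hVc := hV.cont ζ
  have hint : ∀ C R : ℝ, Integrable fun s : ℝ =>
      C * (Real.exp (R ^ 2 / (2 * n)) * Real.exp (-(n / 2) * s ^ 2)) := fun C R =>
    ((integrable_exp_neg_mul_sq (by linarith : 0 < n / 2)).const_mul _).const_mul _
  have hexp : ∀ (s : ℝ) (z : ℂ), ‖Complex.exp (2 * n * s * z)‖ ≤ Real.exp (2 * n * ‖z‖ * |s|) := by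
    intro s z
    rw [Complex.norm_exp, Real.exp_le_exp]
    refine (Complex.re_le_norm _).trans (le_of_eq ?_)
    simp only [norm_mul, Complex.norm_real, Real.norm_eq_abs, abs_of_pos hn, Complex.norm_ofNat]
    ring
  intro z₀
  refine DifferentiableAt.smul (by fun_prop) ?_
  refine (hasDerivAt_integral_of_dominated_loc_of_deriv_le (μ := volume)
    (F := fun (z : ℂ) (s : ℝ) => Complex.exp (2 * n * s * z) •
      ((Real.exp (-n * s ^ 2) : ℂ) • V s ζ))
    (F' := fun (z : ℂ) (s : ℝ) => (Complex.exp (2 * n * s * z) * (2 * n * s)) •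
      ((Real.exp (-n * s ^ 2) : ℂ) • V s ζ))
    -- On the unit ball around z₀ the exponential grows at rate at most 2n(‖z₀‖ + 1) in |s|. The
    -- additional 1 absorbs the factor |s| ≤ e^{|s|} coming from the derivative.
    (bound := fun s => (2 * n * ‖ζ‖) * (Real.exp ((2 * n * (‖z₀‖ + 1) + 1) ^ 2 / (2 * n)) *
      Real.exp (-(n / 2) * s ^ 2)))
    (Metric.ball_mem_nhds z₀ one_pos) ?_ ?_ ?_ ?_ (hint _ _) ?_).2.differentiableAt
  · exact Eventually.of_forall fun z => (by fun_prop : Continuous _).aestronglyMeasurable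
  · refine (hint ‖ζ‖ (2 * n * ‖z₀‖)).mono' (by fun_prop : Continuous _).aestronglyMeasurable ?_
    refine Eventually.of_forall fun s => ?_
    rw [norm_smul, norm_smul, LinearIsometry.norm_map, Complex.norm_real, Real.norm_eq_abs,
      Real.abs_exp, ← mul_assoc, mul_comm]
    refine mul_le_mul_of_nonneg_left ?_ (norm_nonneg _)
    refine le_trans ?_ (abs_mul_exp_bound hn s)
    exact mul_le_mul_of_nonneg_right (hexp s z₀) (Real.exp_nonneg _)
  · exact (by fun_prop : Continuous _).aestronglyMeasurable
  · refine Eventually.of_forall fun s z hz => ?_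
    rw [norm_smul, norm_smul, LinearIsometry.norm_map, Complex.norm_real, Real.norm_eq_abs,
      Real.abs_exp, norm_mul]
    have h1 : ‖(2 * n * s : ℂ)‖ = 2 * n * |s| := by
      simp [abs_of_pos hn]
    have h2 : |s| ≤ Real.exp |s| := by linarith [Real.add_one_le_exp |s|]
    have h3 : ‖z‖ ≤ ‖z₀‖ + 1 := by
      have := norm_sub_norm_le z z₀
      rw [mem_ball_iff_norm] at hz
      linarith
    have h4 : ‖Complex.exp (2 * n * s * z)‖ ≤ Real.exp (2 * n * (‖z₀‖ + 1) * |s|) :=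
      (hexp s z).trans (Real.exp_le_exp.mpr (by gcongr))
    rw [h1]
    calc ‖Complex.exp (2 * n * s * z)‖ * (2 * n * |s|) * (Real.exp (-n * s ^ 2) * ‖ζ‖)
        ≤ Real.exp (2 * n * (‖z₀‖ + 1) * |s|) * (2 * n * Real.exp |s|) *
          (Real.exp (-n * s ^ 2) * ‖ζ‖) := by gcongr
      _ = (2 * n * ‖ζ‖) * (Real.exp ((2 * n * (‖z₀‖ + 1) + 1) * |s|) * Real.exp (-n * s ^ 2)) := by
          rw [add_mul, one_mul, Real.exp_add]; ring
      _ ≤ _ := by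
          refine mul_le_mul_of_nonneg_left ?_ (by positivity)
          exact abs_mul_exp_bound hn s
  · refine Eventually.of_forall fun s z _ => ?_
    refine HasDerivAt.smul_const ?_ _
    have h := (hasDerivAt_id z).const_mul (2 * (n : ℂ) * s)
    simpa using h.cexp

omit [CompleteSpace E] in
theorem gaussianOrbit_ofReal (n : ℝ) (ζ : E) (t : ℝ) :
    gaussianOrbit V n ζ t = ∫ s : ℝ, (Real.exp (-n * (s - t) ^ 2) : ℂ) • V s ζ := by
  unfold gaussianOrbit
  rw [← integral_smul]
  refine integral_congr_ae (Eventually.of_forall fun s => ?_)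
  simp only [smul_smul, Complex.ofReal_exp]
  rw [← Complex.exp_add, ← Complex.exp_add]
  congr 2
  push_cast
  ring

include hV in
theorem gaussianOrbit_real {n : ℝ} (hn : 0 < n) (ζ : E) (t : ℝ) :
    gaussianOrbit V n ζ t = V t (gaussianOrbit V n ζ 0) := by
  have h0 := gaussianOrbit_ofReal (V := V) n ζ 0
  rw [Complex.ofReal_zero] at h0
  rw [gaussianOrbit_ofReal, h0, ← integral_add_right_eq_self _ t]
  have hc := (V t).toContinuousLinearMap.integral_comp_comm (μ := (volume : Measure ℝ))
    (φ := fun s : ℝ => (Real.exp (-n * (s - 0) ^ 2) : ℂ) • V s ζ)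
  have hVc := hV.cont ζ
  have hi : Integrable fun s : ℝ => (Real.exp (-n * (s - 0) ^ 2) : ℂ) • V s ζ := by
    refine ((integrable_exp_neg_mul_sq hn).mul_const ‖ζ‖).mono'
      (by fun_prop : Continuous _).aestronglyMeasurable (Eventually.of_forall fun s => ?_)
    rw [norm_smul, LinearIsometry.norm_map, Complex.norm_real, Real.norm_eq_abs, Real.abs_exp,
      sub_zero]
  rw [LinearIsometry.coe_toContinuousLinearMap] at hc
  rw [← hc hi]
  refine integral_congr_ae (Eventually.of_forall fun s => ?_)
  simp only [map_smul]
  rw [add_comm s t, hV.add]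
  simp

include hV in
theorem gaussianOrbit_isFlow {n : ℝ} (hn : 0 < n) (ζ : E) : IsFlow V (gaussianOrbit V n ζ) :=
  ⟨(gaussianOrbit_differentiable hV hn ζ).continuous.continuousOn,
    (gaussianOrbit_differentiable hV hn ζ).differentiableOn, gaussianOrbit_real hV hn ζ⟩

variable (V) in
/-- The set of values `(1 + A) ξ` of the analytic generator `A` of `V`. -/
def flowRange : Submodule ℂ E where
  carrier := {ξ | ∃ F, IsFlow V F ∧ F 0 + F (-Complex.I) = ξ}
  add_mem' := by
    rintro _ _ ⟨F, hF, rfl⟩ ⟨G, hG, rfl⟩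
    exact ⟨_, hF.add hG, by abel⟩
  zero_mem' := ⟨fun _ => 0, ⟨continuousOn_const, differentiableOn_const 0, fun t => by simp⟩, by simp⟩
  smul_mem' := by
    rintro c _ ⟨F, hF, rfl⟩
    exact ⟨_, hF.smul c, by simp⟩

include hV in
-- If the vectors (1 + A)ξₙ converge, `IsFlow.norm_le` makes the flows uniformly Cauchy on the
-- closed strip, and a uniform limit of flows is a flow.
theorem isClosed_flowRange : IsClosed (flowRange V : Set E) := by
  refine IsSeqClosed.isClosed fun x ξ hx hlim => ?_
  choose F hF hFx using hx
  have hcauchy : UniformCauchySeqOn F atTop (closedStrip 1) := by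
    rw [Metric.uniformCauchySeqOn_iff]
    intro ε hε
    obtain ⟨N, hN⟩ := Metric.cauchySeq_iff.mp hlim.cauchySeq ε hε
    refine ⟨N, fun m hm n hn z hz => ?_⟩
    have h := ((hF m).sub (hF n)).norm_le hV hz
    rw [dist_eq_norm]
    refine h.trans_lt ?_
    have h2 := hN m hm n hn
    rw [dist_eq_norm, ← hFx, ← hFx] at h2
    refine lt_of_eq_of_lt ?_ h2
    congr 1
    abel
  have hex : ∀ z, ∃ y, z ∈ closedStrip 1 → Tendsto (fun n => F n z) atTop (𝓝 y) := by
    intro z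
    by_cases hz : z ∈ closedStrip 1
    · obtain ⟨y, hy⟩ := cauchySeq_tendsto_of_complete (hcauchy.cauchySeq hz)
      exact ⟨y, fun _ => hy⟩
    · exact ⟨0, fun h => absurd h hz⟩
  choose G hG using hex
  have hunif := hcauchy.tendstoUniformlyOn_of_tendsto fun z hz => hG z hz
  have hreal : ∀ t : ℝ, (t : ℂ) ∈ closedStrip 1 := fun t => by constructor <;> simp
  refine ⟨G, ⟨?_, ?_, fun t => ?_⟩, ?_⟩
  · exact hunif.continuousOn (Frequently.of_forall fun n => (hF n).cont)
  · exact (hunif.tendstoLocallyUniformlyOn.mono (openStrip_subset 1)).differentiableOn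
      (Eventually.of_forall fun n => (hF n).diff) (isOpen_openStrip 1)
  · refine tendsto_nhds_unique (hG t (hreal t)) ?_
    refine (((V t).continuous.tendsto _).comp (hG 0 zero_mem_closedStrip)).congr fun n => ?_
    exact ((hF n).real t).symm
  · refine tendsto_nhds_unique ?_ hlim
    exact ((hG 0 zero_mem_closedStrip).add (hG _ neg_I_mem_closedStrip)).congr fun n => hFx n

include hV in
-- Let φ(z) be the inner product of η with the regularised orbit, an entire function. Translates of
-- the orbit are flows, so orthogonality gives φ(z) + φ(z - i) = 0 for real z, hence everywhere.
-- Then |φ| has period i and is bounded on one strip, so φ is constant by Liouville, and 2φ = 0.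
theorem inner_gaussianOrbit_eq_zero {η : E} (hη : ∀ ξ ∈ flowRange V, inner ℂ η ξ = 0) {n : ℝ}
    (hn : 0 < n) (ζ : E) : inner ℂ η (gaussianOrbit V n ζ 0) = 0 := by
  have hF := gaussianOrbit_isFlow hV hn ζ
  have hd : Differentiable ℂ (fun z => inner ℂ η (gaussianOrbit V n ζ z)) :=
    (innerSL ℂ η).differentiable.comp (gaussianOrbit_differentiable hV hn ζ)
  set φ : ℂ → ℂ := fun z => inner ℂ η (gaussianOrbit V n ζ z) with hφ
  have hreal : ∀ t : ℝ, φ t + φ (t - Complex.I) = 0 := by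
    intro t
    rw [hφ]
    simp only
    rw [← inner_add_right]
    refine hη _ ⟨fun z => gaussianOrbit V n ζ (z + t), ⟨?_, ?_, fun s => ?_⟩, ?_⟩
    · exact hF.cont.comp (by fun_prop) fun z hz => add_real_mem_closedStrip hz t
    · exact hF.diff.comp (by fun_prop) fun z hz => add_real_mem_openStrip hz t
    · rw [zero_add, ← Complex.ofReal_add, hF.real, hF.real t, hV.add]
    · simp only
      rw [zero_add, neg_add_eq_sub]
  have hanti : ∀ z, φ z + φ (z - Complex.I) = 0 := by
    have hd2 : Differentiable ℂ (fun z => φ z + φ (z - Complex.I)) :=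
      hd.add (hd.comp (by fun_prop))
    have ha : AnalyticOnNhd ℂ (fun z => φ z + φ (z - Complex.I)) Set.univ :=
      hd2.differentiableOn.analyticOnNhd isOpen_univ
    intro z
    refine ha.eqOn_zero_of_preconnected_of_eventuallyEq_zero isPreconnected_univ
      (z₀ := -(Complex.I / 2)) (Set.mem_univ _) ?_ (Set.mem_univ z)
    have hmem : openStrip 1 ∈ 𝓝 (-(Complex.I / 2)) :=
      (isOpen_openStrip 1).mem_nhds (by constructor <;> norm_num)
    filter_upwards [hmem] with w hw
    exact eq_zero_of_boundary one_pos hd2.continuous.continuousOn hd2.differentiableOn hreal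
      (openStrip_subset 1 hw)
  have hper : Function.Periodic (fun z => ‖φ z‖) Complex.I := by
    intro z
    have h := hanti (z + Complex.I)
    rw [add_sub_cancel_right] at h
    simp only
    rw [eq_neg_of_add_eq_zero_left h, norm_neg]
  have hbdd : Bornology.IsBounded (Set.range φ) := by
    rw [isBounded_iff_forall_norm_le]
    refine ⟨‖η‖ * ‖gaussianOrbit V n ζ 0 + gaussianOrbit V n ζ (-Complex.I)‖, ?_⟩
    rintro _ ⟨z, rfl⟩
    have h1 := hper.sub_zsmul_eq ⌈z.im⌉ (x := z)
    rw [← h1]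
    refine (norm_inner_le_norm _ _).trans (mul_le_mul_of_nonneg_left ?_ (norm_nonneg _))
    refine hF.norm_le hV ?_
    have h2 := Int.le_ceil z.im
    have h3 := Int.ceil_lt_add_one z.im
    constructor <;> simp <;> linarith
  have hconst := hd.apply_eq_apply_of_bounded hbdd (0 - Complex.I) 0
  have h0 := hanti 0
  rw [hconst, ← two_mul] at h0
  simpa using h0

include hV in
-- The range is closed, so let η be orthogonal to it. Then η is orthogonal to its own Gaussian
-- averages of width 1/(k+1). After rescaling the integral to a fixed Gaussian and letting k → ∞,
-- these inner products tend to a positive multiple of ‖η‖².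
theorem flowRange_eq_top : flowRange V = ⊤ := by
  have : (flowRange V).HasOrthogonalProjection :=
    haveI := (isClosed_flowRange hV).completeSpace_coe
    inferInstance
  rw [← Submodule.orthogonal_eq_bot_iff, Submodule.eq_bot_iff]
  intro η hη
  have hη' : ∀ ξ ∈ flowRange V, inner ℂ η ξ = 0 := fun ξ hξ =>
    Submodule.inner_left_of_mem_orthogonal hξ hη
  have hVc := hV.cont η
  have hz : ∀ k : ℕ, ∫ t : ℝ, Real.exp (-t ^ 2) *
      (inner ℂ η (V (1 / ((k : ℝ) + 1) * t) η)).re = 0 := by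
    intro k
    have hk : (0 : ℝ) < 1 / ((k : ℝ) + 1) := by positivity
    have h := inner_gaussianOrbit_eq_zero hV hη' (n := ((k : ℝ) + 1) ^ 2) (by positivity) η
    have h0 := gaussianOrbit_ofReal (V := V) (((k : ℝ) + 1) ^ 2) η 0
    rw [Complex.ofReal_zero] at h0
    rw [h0] at h
    have hi : Integrable fun s : ℝ =>
        (Real.exp (-((k : ℝ) + 1) ^ 2 * (s - 0) ^ 2) : ℂ) • V s η := by
      refine ((integrable_exp_neg_mul_sq (b := ((k : ℝ) + 1) ^ 2) (by positivity)).mul_const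
        ‖η‖).mono' (by fun_prop : Continuous _).aestronglyMeasurable
        (Eventually.of_forall fun s => ?_)
      rw [norm_smul, LinearIsometry.norm_map, Complex.norm_real, Real.norm_eq_abs, Real.abs_exp,
        sub_zero]
    rw [← integral_inner hi] at h
    have hi2 := hi.const_inner (𝕜 := ℂ) η
    have h2 := congrArg Complex.re h
    rw [Complex.zero_re] at h2
    have h3 := integral_re hi2
    have h4 : ∫ s : ℝ, Real.exp (-((k : ℝ) + 1) ^ 2 * s ^ 2) * (inner ℂ η (V s η)).re = 0 := by
      rw [← h2]
      refine Eq.trans ?_ h3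
      refine integral_congr_ae (Eventually.of_forall fun s => ?_)
      simp only [sub_zero]
      rw [inner_smul_right]
      exact (Complex.re_ofReal_mul _ _).symm
    have h5 := Measure.integral_comp_mul_left
      (fun s : ℝ => Real.exp (-((k : ℝ) + 1) ^ 2 * s ^ 2) * (inner ℂ η (V s η)).re)
      (1 / ((k : ℝ) + 1))
    rw [h4, smul_zero] at h5
    rw [← h5]
    refine integral_congr_ae (Eventually.of_forall fun s => ?_)
    simp only
    congr 2
    field_simp
  have hlim : Tendsto (fun k : ℕ => ∫ t : ℝ, Real.exp (-t ^ 2) *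
      (inner ℂ η (V (1 / ((k : ℝ) + 1) * t) η)).re) atTop
      (𝓝 (∫ t : ℝ, Real.exp (-t ^ 2) * ‖η‖ ^ 2)) := by
    refine tendsto_integral_of_dominated_convergence (fun t => Real.exp (-1 * t ^ 2) * (‖η‖ * ‖η‖))
      (fun k => ?_) ((integrable_exp_neg_mul_sq one_pos).mul_const _) (fun k => ?_) ?_
    · exact (by fun_prop : Continuous _).aestronglyMeasurable
    · refine Eventually.of_forall fun t => ?_
      rw [norm_mul, Real.norm_eq_abs, Real.abs_exp, neg_one_mul]
      refine mul_le_mul_of_nonneg_left ?_ (Real.exp_nonneg _)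
      refine (Complex.abs_re_le_norm _).trans ((norm_inner_le_norm _ _).trans ?_)
      rw [LinearIsometry.norm_map]
    · refine Eventually.of_forall fun t => ?_
      refine Tendsto.const_mul _ ?_
      have h1 : Tendsto (fun k : ℕ => 1 / ((k : ℝ) + 1) * t) atTop (𝓝 0) := by
        simpa using tendsto_one_div_add_atTop_nhds_zero_nat.mul_const t
      have h2 : Continuous fun s : ℝ => (inner ℂ η (V s η)).re := by fun_prop
      have h3 := (h2.tendsto 0).comp h1
      rw [hV.zero, inner_self_eq_norm_sq_to_K] at h3
      have h4 : (((‖η‖ : ℝ) : ℂ) ^ 2).re = ‖η‖ ^ 2 := by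
        rw [← Complex.ofReal_pow, Complex.ofReal_re]
      exact Eq.subst (motive := fun c => Tendsto _ atTop (𝓝 c)) h4 h3
  have h := tendsto_nhds_unique hlim (tendsto_const_nhds.congr fun k => (hz k).symm)
  rw [integral_mul_const] at h
  have hpos : 0 < ∫ t : ℝ, Real.exp (-t ^ 2) := by
    have := integral_gaussian 1
    simp only [neg_mul, one_mul, div_one] at this
    rw [this]
    positivity
  simpa [hpos.ne'] using h

include hV in
theorem exists_flow (ξ : E) : ∃ F, IsFlow V F ∧ F 0 + F (-Complex.I) = ξ := by
  have : ξ ∈ flowRange V := by rw [flowRange_eq_top hV]; trivial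
  exact this

end Existence

/-! ### Norm, completeness and conjugation on the complexification -/

section Complexification

variable {H : Type*} [NormedAddCommGroup H] [InnerProductSpace ℝ H]

namespace Cplx

theorem inner_def (x y : Cplx H) : inner ℂ x y =
    ⟨inner ℝ x.re y.re + inner ℝ x.im y.im, inner ℝ x.re y.im - inner ℝ x.im y.re⟩ := rfl

theorem norm_sq (x : Cplx H) : ‖x‖ ^ 2 = ‖x.re‖ ^ 2 + ‖x.im‖ ^ 2 := by
  rw [← inner_self_eq_norm_sq (𝕜 := ℂ) x, inner_def]
  simp

omit [InnerProductSpace ℝ H] in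
@[simp] theorem re_sub (x y : Cplx H) : (x - y).re = x.re - y.re := rfl

omit [InnerProductSpace ℝ H] in
@[simp] theorem im_sub (x y : Cplx H) : (x - y).im = x.im - y.im := rfl

@[simp] theorem conj_conj (x : Cplx H) : x.conj.conj = x := by ext <;> simp [conj]

theorem conj_add (x y : Cplx H) : (x + y).conj = x.conj + y.conj := by
  ext <;> simp [conj, add_comm]

theorem conj_sub (x y : Cplx H) : (x - y).conj = x.conj - y.conj := by
  ext
  · simp [conj]
  · simp only [conj, im_mk, im_sub]; abel

theorem conj_smul (c : ℂ) (x : Cplx H) : (c • x).conj = (starRingEnd ℂ) c • x.conj := by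
  ext <;> simp [conj, add_comm]

theorem inner_conj_conj (x y : Cplx H) :
    inner ℂ x.conj y.conj = (starRingEnd ℂ) (inner ℂ x y) := by
  rw [inner_def, inner_def]
  apply Complex.ext <;> simp [conj]
  abel

@[simp] theorem norm_conj (x : Cplx H) : ‖x.conj‖ = ‖x‖ := by
  rw [← sq_eq_sq₀ (norm_nonneg _) (norm_nonneg _), norm_sq, norm_sq]
  simp [conj]

theorem continuous_conj : Continuous (conj : Cplx H → Cplx H) := by
  refine LipschitzWith.continuous (K := 1) (LipschitzWith.of_dist_le_mul fun x y => ?_)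
  rw [dist_eq_norm, dist_eq_norm, ← conj_sub, norm_conj]
  simp

@[simp] theorem conj_ofReal (h : H) : (ofReal h).conj = ofReal h := by ext <;> simp [conj, ofReal]

theorem eq_ofReal_add (x : Cplx H) : x = ofReal x.re + Complex.I • ofReal x.im := by
  ext <;> simp [ofReal]

theorem conj_eq (x : Cplx H) : x.conj = ofReal x.re - Complex.I • ofReal x.im := by
  ext <;> simp [ofReal, conj]

theorem norm_re_le (x : Cplx H) : ‖x.re‖ ≤ ‖x‖ := by
  have := norm_sq x
  exact (sq_le_sq₀ (norm_nonneg _) (norm_nonneg _)).mp (by nlinarith [sq_nonneg ‖x.im‖])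

theorem norm_im_le (x : Cplx H) : ‖x.im‖ ≤ ‖x‖ := by
  have := norm_sq x
  exact (sq_le_sq₀ (norm_nonneg _) (norm_nonneg _)).mp (by nlinarith [sq_nonneg ‖x.re‖])

theorem norm_le_add (x : Cplx H) : ‖x‖ ≤ ‖x.re‖ + ‖x.im‖ := by
  have := norm_sq x
  exact (sq_le_sq₀ (norm_nonneg _) (by positivity)).mp
    (by nlinarith [norm_nonneg x.re, norm_nonneg x.im])

theorem continuous_mk {α : Type*} [TopologicalSpace α] {f g : α → H} (hf : Continuous f)
    (hg : Continuous g) : Continuous fun a => mk (f a) (g a) := by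
  rw [continuous_iff_continuousAt]
  intro a
  rw [ContinuousAt, tendsto_iff_norm_sub_tendsto_zero]
  refine squeeze_zero (fun _ => norm_nonneg _) (fun b => norm_le_add _) ?_
  have h1 := tendsto_iff_norm_sub_tendsto_zero.mp (hf.tendsto a)
  have h2 := tendsto_iff_norm_sub_tendsto_zero.mp (hg.tendsto a)
  simpa using h1.add h2

instance [CompleteSpace H] : CompleteSpace (Cplx H) := by
  refine Metric.complete_of_cauchySeq_tendsto fun u hu => ?_
  have h1 : CauchySeq fun n => (u n).re := by
    rw [Metric.cauchySeq_iff] at hu ⊢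
    intro ε hε
    obtain ⟨N, hN⟩ := hu ε hε
    refine ⟨N, fun m hm n hn => lt_of_le_of_lt ?_ (hN m hm n hn)⟩
    rw [dist_eq_norm, dist_eq_norm]
    exact norm_re_le (u m - u n)
  have h2 : CauchySeq fun n => (u n).im := by
    rw [Metric.cauchySeq_iff] at hu ⊢
    intro ε hε
    obtain ⟨N, hN⟩ := hu ε hε
    refine ⟨N, fun m hm n hn => lt_of_le_of_lt ?_ (hN m hm n hn)⟩
    rw [dist_eq_norm, dist_eq_norm]
    exact norm_im_le (u m - u n)
  obtain ⟨a, ha⟩ := cauchySeq_tendsto_of_complete h1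
  obtain ⟨b, hb⟩ := cauchySeq_tendsto_of_complete h2
  refine ⟨mk a b, ?_⟩
  rw [tendsto_iff_norm_sub_tendsto_zero]
  refine squeeze_zero (fun _ => norm_nonneg _) (fun b => norm_le_add _) ?_
  have h1 := tendsto_iff_norm_sub_tendsto_zero.mp ha
  have h2 := tendsto_iff_norm_sub_tendsto_zero.mp hb
  simpa using h1.add h2

theorem hasDerivAt_conj_conj {f : ℂ → Cplx H} {f' : Cplx H} {z : ℂ}
    (hf : HasDerivAt f f' ((starRingEnd ℂ) z)) :
    HasDerivAt (fun w => (f ((starRingEnd ℂ) w)).conj) f'.conj z := by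
  rw [hasDerivAt_iff_tendsto_slope] at hf ⊢
  have h1 : Tendsto (starRingEnd ℂ) (𝓝[≠] z) (𝓝[≠] ((starRingEnd ℂ) z)) := by
    refine tendsto_nhdsWithin_iff.mpr ⟨(Complex.continuous_conj.tendsto z).mono_left
      nhdsWithin_le_nhds, ?_⟩
    filter_upwards [self_mem_nhdsWithin] with w hw
    exact fun h => hw ((starRingEnd ℂ).injective h)
  refine ((continuous_conj.tendsto f').comp (hf.comp h1)).congr fun w => ?_
  simp only [Function.comp, slope_def_module, conj_smul, conj_sub]
  simp

end Cplx

end Complexification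

/-! ### The resolvent of the analytic generator -/

section Generator

variable {H : Type*} [NormedAddCommGroup H] [InnerProductSpace ℝ H] (U : OrthogonalGroup H)

/-- The extension of `U t` to the complexification, as a linear isometry. -/
def OrthogonalGroup.iso (t : ℝ) : Cplx H →ₗᵢ[ℂ] Cplx H where
  toFun := U.cplx t
  map_add' x y := by ext <;> simp [OrthogonalGroup.cplx]
  map_smul' c x := by ext <;> simp [OrthogonalGroup.cplx]
  norm_map' x := by
    change ‖U.cplx t x‖ = ‖x‖
    rw [← sq_eq_sq₀ (norm_nonneg _) (norm_nonneg _), Cplx.norm_sq, Cplx.norm_sq]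
    simp [OrthogonalGroup.cplx]

theorem OrthogonalGroup.iso_apply (t : ℝ) (x : Cplx H) : U.iso t x = U.cplx t x := rfl

theorem OrthogonalGroup.apply_zero (x : H) : U 0 x = x := by
  have h := U.map_add' 0 0 x
  rw [add_zero] at h
  exact ((U 0).injective h).symm

theorem OrthogonalGroup.isUnitaryGroup : IsUnitaryGroup U.iso where
  add s t x := by
    ext
    · exact U.map_add' s t x.re
    · exact U.map_add' s t x.im
  zero x := by
    ext
    · exact U.apply_zero x.re
    · exact U.apply_zero x.im
  cont x := Cplx.continuous_mk (U.strongly_continuous' x.re) (U.strongly_continuous' x.im)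

theorem OrthogonalGroup.isGenerator_iff (ξ η : Cplx H) :
    U.IsGenerator ξ η ↔ ∃ F, IsFlow U.iso F ∧ F 0 = ξ ∧ F (-Complex.I) = η := by
  constructor
  · rintro ⟨F, h1, h2, h3, h4⟩
    have h0 : F 0 = ξ := by
      have h := h3 0
      rw [Complex.ofReal_zero] at h
      rw [h]
      exact U.isUnitaryGroup.zero ξ
    exact ⟨F, ⟨h1, h2, fun t => by rw [h0]; exact h3 t⟩, h0, h4⟩
  · rintro ⟨F, hF, rfl, rfl⟩
    exact ⟨F, hF.cont, hF.diff, hF.real, rfl⟩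

theorem IsFlow.eq_of_sum_eq {F G : ℂ → Cplx H} (hF : IsFlow U.iso F) (hG : IsFlow U.iso G)
    (h : F 0 + F (-Complex.I) = G 0 + G (-Complex.I)) : F (-Complex.I) = G (-Complex.I) := by
  have h1 := (hF.sub hG).norm_le_right U.isUnitaryGroup
  have h2 : F 0 - G 0 + (F (-Complex.I) - G (-Complex.I)) = 0 := by
    rw [← sub_eq_zero.mpr h]; abel
  rw [h2, norm_zero, norm_le_zero_iff] at h1
  exact sub_eq_zero.mp h1

/-- R maps (1 + A)x to Ax. It is well defined and linear because 1 + A is injective, a contraction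
by `norm_le_right`, and positive since ⟨Ax, x + Ax⟩ = ⟨Ax, x⟩ + ‖Ax‖². -/
theorem OrthogonalGroup.exists_isResolvent [CompleteSpace H] : ∃ R, U.IsResolvent R := by
  choose F hF hFs using fun ξ => exists_flow U.isUnitaryGroup ξ
  let L : Cplx H →ₗ[ℂ] Cplx H :=
    { toFun := fun ξ => F ξ (-Complex.I)
      map_add' := fun x y => IsFlow.eq_of_sum_eq U (hF _) ((hF x).add (hF y)) (by
        rw [hFs, ← hFs x, ← hFs y, hFs, hFs]; nth_rw 1 [← hFs x, ← hFs y]; abel)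
      map_smul' := fun c x => IsFlow.eq_of_sum_eq U (hF _) ((hF x).smul c) (by
        rw [hFs, ← smul_add, hFs]) }
  let R : Cplx H →L[ℂ] Cplx H := L.mkContinuous 1 fun x => by
    rw [one_mul]
    have h := (hF x).norm_le_right U.isUnitaryGroup
    rwa [hFs] at h
  have hR : ∀ ξ, R ξ = F ξ (-Complex.I) := fun _ => rfl
  refine ⟨R, ?_, fun ξ => ?_⟩
  · rw [ContinuousLinearMap.isPositive_iff_complex]
    intro ξ
    have h1 : 0 ≤ inner ℂ (R ξ) ξ := by
      have h0 : inner ℂ (R ξ) ξ = inner ℂ (F ξ (-Complex.I)) (F ξ 0) +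
          inner ℂ (F ξ (-Complex.I)) (F ξ (-Complex.I)) := by
        rw [← inner_add_right, hFs, hR]
      rw [h0]
      refine add_nonneg ((hF ξ).inner_nonneg U.isUnitaryGroup) ?_
      rw [inner_self_eq_norm_sq_to_K]
      change (0 : ℂ) ≤ ((_ : ℝ) : ℂ) ^ 2
      rw [← Complex.ofReal_pow]
      exact Complex.zero_le_real.mpr (sq_nonneg _)
    rw [Complex.nonneg_iff] at h1
    exact ⟨Complex.ext rfl (by simpa using h1.2), h1.1⟩
  · rw [U.isGenerator_iff]
    exact ⟨F ξ, hF ξ, by rw [hR, eq_sub_iff_add_eq, hFs], rfl⟩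

theorem OrthogonalGroup.resolvent_spec [CompleteSpace H] : U.IsResolvent U.resolvent := by
  unfold OrthogonalGroup.resolvent
  rw [dif_pos U.exists_isResolvent]
  exact U.exists_isResolvent.choose_spec

variable [CompleteSpace H]

theorem OrthogonalGroup.exists_flow_resolvent (ξ : Cplx H) : ∃ F, IsFlow U.iso F ∧
    F 0 = ξ - U.resolvent ξ ∧ F (-Complex.I) = U.resolvent ξ :=
  (U.isGenerator_iff _ _).mp (U.resolvent_spec.2 ξ)

/-- Injectivity of 1 + A frees the resolvent from the choice in its definition: any explicit flow
computes it. -/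
theorem OrthogonalGroup.resolvent_flow {F : ℂ → Cplx H} (hF : IsFlow U.iso F) :
    U.resolvent (F 0 + F (-Complex.I)) = F (-Complex.I) := by
  obtain ⟨G, hG, h0, h1⟩ := U.exists_flow_resolvent (F 0 + F (-Complex.I))
  rw [← h1]
  refine IsFlow.eq_of_sum_eq U hG hF ?_
  rw [h0, h1, sub_add_cancel]

/-- Conjugation J commutes with every U_t, so the reflection z ↦ z̄ - i of the strip turns a flow F
into the flow J F(z̄ - i), whose two ends are exchanged. Thus JAJ = A⁻¹, that is JRJ = 1 - R. -/
theorem OrthogonalGroup.resolvent_conj (ξ : Cplx H) :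
    U.resolvent ξ.conj = ξ.conj - (U.resolvent ξ).conj := by
  obtain ⟨F, hF, h0, h1⟩ := U.exists_flow_resolvent ξ
  have hmem : ∀ z ∈ closedStrip 1, (starRingEnd ℂ) z - Complex.I ∈ closedStrip 1 := by
    intro z hz
    constructor <;> simp <;> linarith [hz.1, hz.2]
  have hG : IsFlow U.iso fun z => (F ((starRingEnd ℂ) z - Complex.I)).conj := by
    refine ⟨?_, ?_, fun t => ?_⟩
    · exact Cplx.continuous_conj.comp_continuousOn
        (hF.cont.comp (by fun_prop) fun z hz => hmem z hz)
    · intro z hz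
      have h2 : (starRingEnd ℂ) z - Complex.I ∈ openStrip 1 := by
        constructor <;> simp <;> linarith [hz.1, hz.2]
      have h3 := (hF.diff.differentiableAt ((isOpen_openStrip 1).mem_nhds h2)).hasDerivAt
      have h4 : HasDerivAt (fun w => F (w - Complex.I)) _ ((starRingEnd ℂ) z) :=
        h3.comp_sub_const _ _
      exact (Cplx.hasDerivAt_conj_conj h4).differentiableAt.differentiableWithinAt
    · simp only [Complex.conj_ofReal, map_zero, zero_sub]
      rw [sub_eq_neg_add, hF.translate U.isUnitaryGroup t neg_I_mem_closedStrip]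
      ext <;> simp [OrthogonalGroup.iso_apply, OrthogonalGroup.cplx, Cplx.conj]
  have h := U.resolvent_flow hG
  simp only [map_zero, zero_sub, map_neg, Complex.conj_I, neg_neg, sub_self] at h
  rw [h0, h1, ← Cplx.conj_add, add_sub_cancel] at h
  rw [h, Cplx.conj_sub]

/-- The flow of such a ξ starts at 0, so it vanishes on the whole strip. Hence 1 - R is injective.
-/
theorem OrthogonalGroup.eq_zero_of_resolvent_eq_self {ξ : Cplx H} (h : U.resolvent ξ = ξ) :
    ξ = 0 := by
  obtain ⟨F, hF, h0, h1⟩ := U.exists_flow_resolvent ξ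
  rw [h, sub_self] at h0
  have h2 := eq_of_boundary one_pos hF.cont hF.diff (G := fun _ => 0) continuousOn_const
    (differentiableOn_const 0) (fun t => by rw [hF.real, h0, map_zero]) neg_I_mem_closedStrip
  rw [← h, ← h1, h2]

/-- Conjugation exchanges R and 1 - R, hence commutes with R(1 - R). -/
theorem OrthogonalGroup.resolvent_real (h : H) :
    (U.resolvent (Cplx.ofReal h - U.resolvent (Cplx.ofReal h))).conj =
      U.resolvent (Cplx.ofReal h - U.resolvent (Cplx.ofReal h)) := by
  have h1 := U.resolvent_conj (Cplx.ofReal h)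
  rw [Cplx.conj_ofReal] at h1
  have h2 : Cplx.ofReal h - U.resolvent (Cplx.ofReal h) = (U.resolvent (Cplx.ofReal h)).conj := by
    rw [sub_eq_iff_eq_add, add_comm]
    exact (eq_sub_iff_add_eq.mp h1).symm
  conv_lhs => rw [h2, U.resolvent_conj, Cplx.conj_sub, Cplx.conj_conj, Cplx.conj_conj]
  exact (map_sub _ _ _).symm

theorem OrthogonalGroup.resolvent_eigenvector {θ : ℝ} {ξ : Cplx H}
    (h : ∀ t : ℝ, U.cplx t ξ = Complex.exp (-(t * θ * Complex.I)) • ξ) :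
    U.resolvent ξ = ((1 / (1 + Real.exp θ) : ℝ) : ℂ) • ξ := by
  -- Here A acts on ξ as e^{-θ}, and c normalises the explicit flow F(z) = c e^{-izθ} ξ so that F(0)
  -- + F(-i) = ξ.
  set c : ℂ := ((Real.exp θ / (1 + Real.exp θ) : ℝ) : ℂ) with hc
  have hpos := Real.exp_pos θ
  have hF : IsFlow U.iso fun z => (Complex.exp (-(z * θ * Complex.I)) * c) • ξ := by
    have hd : Differentiable ℂ fun z : ℂ => (Complex.exp (-(z * θ * Complex.I)) * c) • ξ := by
      fun_prop
    refine ⟨hd.continuous.continuousOn, hd.differentiableOn, fun t => ?_⟩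
    rw [map_smul, U.iso_apply, h, smul_smul]
    simp [mul_comm]
  have h1 : Complex.exp (-(-Complex.I * θ * Complex.I)) * c = ((1 / (1 + Real.exp θ) : ℝ) : ℂ) := by
    have h2 : -(-Complex.I * θ * Complex.I) = ((-θ : ℝ) : ℂ) := by
      have := Complex.I_mul_I
      push_cast
      linear_combination (θ : ℂ) * this
    rw [h2, ← Complex.ofReal_exp, hc, ← Complex.ofReal_mul, Real.exp_neg]
    congr 1
    field_simp
  have h2 := U.resolvent_flow hF
  simp only [h1] at h2
  rw [← add_smul] at h2
  have h3 : Complex.exp (-(0 * θ * Complex.I)) * c + ((1 / (1 + Real.exp θ) : ℝ) : ℂ) = 1 := by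
    rw [zero_mul, zero_mul, neg_zero, Complex.exp_zero, one_mul, hc, ← Complex.ofReal_add,
      ← Complex.ofReal_one]
    congr 1
    field_simp
    ring
  rwa [h3, one_smul] at h2

/-- A self-adjoint injective operator has dense range. -/
theorem OrthogonalGroup.dense_range_one_sub_resolvent :
    Dense (Set.range fun ξ => ξ - U.resolvent ξ) := by
  set T : Cplx H →L[ℂ] Cplx H := 1 - U.resolvent with hT
  have h1 : (T.range : Set (Cplx H)) = Set.range fun ξ => ξ - U.resolvent ξ := by
    ext x; simp [hT]
  have h2 : T.rangeᗮ = ⊥ := by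
    rw [Submodule.eq_bot_iff]
    intro x hx
    refine U.eq_zero_of_resolvent_eq_self ?_
    have h3 : inner ℂ (T (x - U.resolvent x)) x = 0 :=
      Submodule.inner_right_of_mem_orthogonal (LinearMap.mem_range_self _ _) hx
    have h4 : inner ℂ (T (x - U.resolvent x)) x = inner ℂ (x - U.resolvent x) (T x) := by
      have := U.resolvent_isPositive.1 (x - U.resolvent x) x
      simp only [ContinuousLinearMap.coe_coe] at this
      simp only [hT, sub_apply, one_apply_eq_self, inner_sub_left,
        inner_sub_right, map_sub] at this ⊢
      linear_combination -this
    rw [h4] at h3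
    simp only [hT, sub_apply, one_apply_eq_self] at h3
    exact (sub_eq_zero.mp (inner_self_eq_zero.mp h3)).symm
  rw [← h1]
  exact (Submodule.dense_iff_topologicalClosure_eq_top).mpr
    ((Submodule.topologicalClosure_eq_top_iff).mpr h2)

end Generator

/-! ### The deformed one-particle space -/

section HUSpace

variable {H : Type*} [NormedAddCommGroup H] [InnerProductSpace ℝ H] (U : OrthogonalGroup H)

theorem inner_toHU (x y : Cplx H) :
    inner ℂ (toHU U x) (toHU U y) = inner ℂ ((2 : ℂ) • U.resolvent x) y :=
  UniformSpace.Completion.inner_coe _ _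

theorem toHU_add (x y : Cplx H) : toHU U (x + y) = toHU U x + toHU U y := by
  unfold toHU
  rw [map_add, UniformSpace.Completion.coe_add]

theorem toHU_smul (c : ℂ) (x : Cplx H) : toHU U (c • x) = c • toHU U x := by
  unfold toHU
  rw [map_smul, UniformSpace.Completion.coe_smul]

theorem continuous_toHU : Continuous (toHU U) := by
  let L : Cplx H →ₗ[ℂ] HU U :=
    { toFun := toHU U, map_add' := toHU_add U, map_smul' := toHU_smul U }
  refine (L.mkContinuous (1 + 2 * ‖U.resolvent‖) fun x => ?_).continuous
  have h1 : ‖toHU U x‖ ^ 2 ≤ 2 * ‖U.resolvent‖ * ‖x‖ ^ 2 := by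
    rw [← inner_self_eq_norm_sq (𝕜 := ℂ), inner_toHU]
    refine (RCLike.re_le_norm _).trans ((norm_inner_le_norm _ _).trans ?_)
    rw [norm_smul, Complex.norm_ofNat]
    have := U.resolvent.le_opNorm x
    calc 2 * ‖U.resolvent x‖ * ‖x‖ ≤ 2 * (‖U.resolvent‖ * ‖x‖) * ‖x‖ := by gcongr
      _ = _ := by ring
  change ‖toHU U x‖ ≤ _
  have h2 := norm_nonneg U.resolvent
  refine abs_le_of_sq_le_sq' (h1.trans ?_) (by positivity) |>.2
  rw [mul_pow]
  exact mul_le_mul_of_nonneg_right (by nlinarith) (sq_nonneg _)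

theorem denseRange_toHU : DenseRange (toHU U) := by
  have h := UniformSpace.Completion.denseRange_coe (α := PreHU U)
  unfold DenseRange at h ⊢
  rwa [← (PreHU.equiv U).symm.surjective.range_comp] at h

variable [CompleteSpace H]

/-- Vectors of `H_U` whose inner products with the vectors of `H` are real. -/
theorem exists_dense_symplectic_complement :
    ∃ η : H → HU U, (∀ h h', (starRingEnd ℂ) (inner ℂ (η h) (toHU U (Cplx.ofReal h'))) =
      inner ℂ (η h) (toHU U (Cplx.ofReal h'))) ∧
      Dense (Submodule.span ℂ (Set.range η) : Set (HU U)) := by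
  -- The choice η(h) = (1 - R)h gives ⟨η(h), h'⟩_U = 2⟨R(1 - R)h, h'⟩, real because R(1 - R)h is a
  -- real vector. The span is dense because 1 - R has dense range.
  refine ⟨fun h => toHU U (Cplx.ofReal h - U.resolvent (Cplx.ofReal h)), fun h h' => ?_, ?_⟩
  · rw [inner_toHU, inner_smul_left, map_mul, map_ofNat, map_ofNat, ← Cplx.inner_conj_conj,
      U.resolvent_real, Cplx.conj_ofReal]
  · refine ((denseRange_toHU U).dense_image (continuous_toHU U)
      U.dense_range_one_sub_resolvent).mono ?_
    rintro _ ⟨_, ⟨ξ, rfl⟩, rfl⟩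
    have h : ξ - U.resolvent ξ = (Cplx.ofReal ξ.re - U.resolvent (Cplx.ofReal ξ.re)) +
        Complex.I • (Cplx.ofReal ξ.im - U.resolvent (Cplx.ofReal ξ.im)) := by
      conv_lhs => rw [Cplx.eq_ofReal_add ξ, map_add, map_smul]
      rw [smul_sub]
      abel
    simp only
    rw [h, toHU_add, toHU_smul]
    exact Submodule.add_mem _ (Submodule.subset_span ⟨_, rfl⟩)
      (Submodule.smul_mem _ _ (Submodule.subset_span ⟨_, rfl⟩))

/-! ### The vectors `e` and `ē` -/

variable {U} {lam : ℝ} {f₁ f₂ : H}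

/-- The rotation acts on f₁ + i f₂ by the phase e^{-it log λ}, so Ae = λ⁻¹e. -/
theorem resolvent_blockVector (hlam : 0 < lam) (hf : IsRotationBlock U lam f₁ f₂) :
    U.resolvent (blockVector lam f₁ f₂) = ((1 / (1 + lam) : ℝ) : ℂ) • blockVector lam f₁ f₂ := by
  have h := U.resolvent_eigenvector (θ := Real.log lam) (ξ := blockVector lam f₁ f₂) fun t => ?_
  · rwa [Real.exp_log hlam] at h
  · have h1 : U.cplx t (blockVector lam f₁ f₂) = U.iso t (blockVector lam f₁ f₂) := rfl
    rw [h1, blockVector, map_smul, smul_comm]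
    congr 1
    have h2 : Complex.exp (-(t * (Real.log lam : ℝ) * Complex.I)) =
        ⟨Real.cos (t * Real.log lam), -Real.sin (t * Real.log lam)⟩ := by
      rw [← neg_mul, ← Complex.ofReal_mul, ← Complex.ofReal_neg, Complex.exp_mul_I,
        ← Complex.ofReal_cos, ← Complex.ofReal_sin, Real.cos_neg, Real.sin_neg]
      generalize Real.cos (t * Real.log lam) = c
      generalize Real.sin (t * Real.log lam) = s
      apply Complex.ext <;> simp
    rw [h2]
    ext
    · simp [U.iso_apply, OrthogonalGroup.cplx, hf.apply_fst]
    · simp [U.iso_apply, OrthogonalGroup.cplx, hf.apply_snd, add_comm]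

omit [CompleteSpace H] in
theorem inner_blockVector_self (hlam : 0 < lam) (hf : IsRotationBlock U lam f₁ f₂) :
    inner ℂ (blockVector lam f₁ f₂) (blockVector lam f₁ f₂) =
      (((lam + 1) / (2 * Real.sqrt lam) : ℝ) : ℂ) := by
  have h1 : ‖f₁‖ = 1 := hf.orthonormal.1 0
  have h2 : ‖f₂‖ = 1 := hf.orthonormal.1 1
  have h4 : (lam ^ (1 / 4 : ℝ)) ^ 2 = Real.sqrt lam := by
    rw [← Real.rpow_natCast, ← Real.rpow_mul hlam.le, Real.sqrt_eq_rpow]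
    norm_num
  have h5 : ((lam + 1) ^ (1 / 2 : ℝ)) ^ 2 = lam + 1 := by
    rw [← Real.sqrt_eq_rpow, Real.sq_sqrt (by linarith)]
  have h6 : inner ℂ (Cplx.mk f₁ f₂) (Cplx.mk f₁ f₂) = 2 := by
    rw [Cplx.inner_def]
    apply Complex.ext
    · simp [h1, h2]; norm_num
    · simp [real_inner_comm]
  rw [blockVector, inner_smul_left, inner_smul_right, h6, Complex.conj_ofReal, ← mul_assoc,
    ← Complex.ofReal_mul, ← Complex.ofReal_ofNat, ← Complex.ofReal_mul]
  congr 1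
  rw [← sq, div_pow, mul_pow, h4, h5]
  field_simp

omit [CompleteSpace H] in
theorem inner_blockVector_conj (hf : IsRotationBlock U lam f₁ f₂) :
    inner ℂ (blockVector lam f₁ f₂) (blockVector lam f₁ f₂).conj = 0 := by
  have h1 : ‖f₁‖ = 1 := hf.orthonormal.1 0
  have h2 : ‖f₂‖ = 1 := hf.orthonormal.1 1
  have h3 : inner ℝ f₁ f₂ = (0 : ℝ) := hf.orthonormal.2 (i := 0) (j := 1) (by decide)
  have h6 : inner ℂ (Cplx.mk f₁ f₂) (Cplx.mk f₁ f₂).conj = 0 := by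
    rw [Cplx.inner_def]
    apply Complex.ext
    · simp [h1, h2, Cplx.conj]
    · simp [h3, real_inner_comm, Cplx.conj]
  rw [blockVector, Cplx.conj_smul, inner_smul_left, inner_smul_right, h6, mul_zero, mul_zero]

theorem inner_toHU_blockVector (hlam : 0 < lam) (hf : IsRotationBlock U lam f₁ f₂) :
    inner ℂ (toHU U (blockVector lam f₁ f₂)) (toHU U (blockVector lam f₁ f₂)) =
      (((Real.sqrt lam)⁻¹ : ℝ) : ℂ) := by
  rw [inner_toHU, resolvent_blockVector hlam hf, inner_smul_left, inner_smul_left,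
    inner_blockVector_self hlam hf, Complex.conj_ofReal, map_ofNat, ← Complex.ofReal_ofNat,
    ← Complex.ofReal_mul, ← Complex.ofReal_mul]
  congr 1
  field_simp
  ring

theorem inner_toHU_blockVector_conj (hlam : 0 < lam) (hf : IsRotationBlock U lam f₁ f₂) :
    inner ℂ (toHU U (blockVector lam f₁ f₂)) (toHU U (blockVector lam f₁ f₂).conj) = 0 := by
  rw [inner_toHU, resolvent_blockVector hlam hf, inner_smul_left, inner_smul_left,
    inner_blockVector_conj hf, mul_zero, mul_zero]

theorem inner_toHU_conj_blockVector (hlam : 0 < lam) (hf : IsRotationBlock U lam f₁ f₂) :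
    inner ℂ (toHU U (blockVector lam f₁ f₂).conj) (toHU U (blockVector lam f₁ f₂).conj) =
      ((Real.sqrt lam : ℝ) : ℂ) := by
  have h1 : U.resolvent (blockVector lam f₁ f₂).conj =
      ((lam / (1 + lam) : ℝ) : ℂ) • (blockVector lam f₁ f₂).conj := by
    rw [U.resolvent_conj, resolvent_blockVector hlam hf, Cplx.conj_smul, Complex.conj_ofReal]
    nth_rw 1 [← one_smul ℂ (blockVector lam f₁ f₂).conj]
    rw [← sub_smul, ← Complex.ofReal_one, ← Complex.ofReal_sub]
    congr 2
    field_simp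
    ring
  rw [inner_toHU, h1, inner_smul_left, inner_smul_left, Cplx.inner_conj_conj,
    inner_blockVector_self hlam hf, Complex.conj_ofReal, Complex.conj_ofReal, map_ofNat,
    ← Complex.ofReal_ofNat, ← Complex.ofReal_mul, ← Complex.ofReal_mul]
  congr 1
  have := Real.mul_self_sqrt hlam.le
  have h3 := Real.sqrt_pos.mpr hlam
  field_simp
  nlinarith

end HUSpace

/-! ### Inversions of permutations -/

section Permutations

/-- The permutation sending `0` to `k` and inducing `σ` on the remaining points. -/
def consPerm {n : ℕ} (x : Fin (n + 1) × Equiv.Perm (Fin n)) : Equiv.Perm (Fin (n + 1)) :=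
  (finSuccEquiv' 0).trans ((Equiv.optionCongr x.2).trans (finSuccEquiv' x.1).symm)

@[simp] theorem consPerm_zero {n : ℕ} (x : Fin (n + 1) × Equiv.Perm (Fin n)) :
    consPerm x 0 = x.1 := by simp [consPerm]

@[simp] theorem consPerm_succ {n : ℕ} (x : Fin (n + 1) × Equiv.Perm (Fin n)) (i : Fin n) :
    consPerm x i.succ = x.1.succAbove (x.2 i) := by
  have h : finSuccEquiv' (0 : Fin (n + 1)) i.succ = some i := by
    rw [← Fin.zero_succAbove i, finSuccEquiv'_succAbove]
  simp [consPerm, h]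

theorem consPerm_bijective (n : ℕ) : Function.Bijective (consPerm (n := n)) := by
  rw [Fintype.bijective_iff_injective_and_card]
  constructor
  · rintro ⟨k, σ⟩ ⟨l, τ⟩ h
    have h0 : k = l := by simpa using congrArg (fun π => π 0) h
    subst h0
    have h1 : σ = τ := by
      ext i
      have := congrArg (fun π => π i.succ) h
      simp only [consPerm_succ] at this
      rw [Fin.succAbove_right_injective this]
    rw [h1]
  · simp [Fintype.card_perm, Nat.factorial_succ]

theorem inversions_eq_sum {n : ℕ} (π : Equiv.Perm (Fin n)) :
    inversions π = ∑ i : Fin n, ∑ j : Fin n, if i < j ∧ π j < π i then 1 else 0 := by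
  unfold inversions
  rw [Finset.card_filter, ← Finset.univ_product_univ, Finset.sum_product]

/-- Position 0 forms an inversion with exactly the x.1 positions of smaller value. The remaining
pairs are unaffected since `succAbove` is increasing. -/
theorem inversions_consPerm {n : ℕ} (x : Fin (n + 1) × Equiv.Perm (Fin n)) :
    inversions (consPerm x) = x.1 + inversions x.2 := by
  rw [inversions_eq_sum, inversions_eq_sum, Fin.sum_univ_succ]
  congr 1
  · rw [Fin.sum_univ_succ]
    simp only [lt_self_iff_false, false_and, if_false, zero_add, Fin.succ_pos, true_and,
      consPerm_zero, consPerm_succ]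
    rw [Equiv.sum_comp x.2 fun j => if x.1.succAbove j < x.1 then 1 else 0]
    simp only [Fin.succAbove_lt_iff_castSucc_lt]
    simp only [Fin.lt_def, Fin.val_castSucc]
    rw [Fin.sum_univ_eq_sum_range (fun j => if j < (x.1 : ℕ) then 1 else 0) n, ← Finset.card_filter]
    have : (Finset.range n).filter (· < (x.1 : ℕ)) = Finset.range x.1 := by
      ext j
      simp only [Finset.mem_filter, Finset.mem_range]
      have := x.1.is_le
      omega
    rw [this, Finset.card_range]
  · refine Finset.sum_congr rfl fun i _ => ?_
    rw [Fin.sum_univ_succ]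
    simp [Fin.succAbove_lt_succAbove_iff]

theorem inversions_rev {n : ℕ} (π : Equiv.Perm (Fin n)) :
    inversions (Fin.revPerm.trans (π.trans Fin.revPerm)) = inversions π := by
  rw [inversions_eq_sum, inversions_eq_sum, Finset.sum_comm,
    ← Equiv.sum_comp (Fin.revPerm : Equiv.Perm (Fin n))]
  refine Finset.sum_congr rfl fun i _ => ?_
  rw [← Equiv.sum_comp (Fin.revPerm : Equiv.Perm (Fin n))]
  refine Finset.sum_congr rfl fun j _ => ?_
  simp

end Permutations

/-! ### Expansion of the q-inner product along the first factor -/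

section Annihilation

variable (q : Set.Ioo (-1 : ℝ) 1) {K : Type*} [NormedAddCommGroup K] [InnerProductSpace ℂ K]

theorem qInner_eq_sum {u v : List K} {n : ℕ} (hu : u.length = n) (hv : v.length = n) :
    qInner q u v = ∑ π : Equiv.Perm (Fin n),
      ((q : ℝ) : ℂ) ^ inversions π * ∏ i : Fin n, inner ℂ (u.getD i 0) (v.getD (π i) 0) := by
  subst hu
  rw [qInner, if_pos hv.symm]

theorem qInner_of_ne {u v : List K} (h : u.length ≠ v.length) : qInner q u v = 0 := if_neg h

theorem qInner_reverse (u v : List K) : qInner q u.reverse v.reverse = qInner q u v := by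
  by_cases h : u.length = v.length
  · rw [qInner_eq_sum q (n := v.length) (by simpa using h) (by simp), qInner_eq_sum q h rfl]
    let e : Equiv.Perm (Fin v.length) ≃ Equiv.Perm (Fin v.length) :=
      ⟨fun π => Fin.revPerm.trans (π.trans Fin.revPerm),
        fun π => Fin.revPerm.trans (π.trans Fin.revPerm), fun π => by ext; simp,
        fun π => by ext; simp⟩
    rw [← Equiv.sum_comp e]
    refine Finset.sum_congr rfl fun π _ => ?_
    have he : e π = Fin.revPerm.trans (π.trans Fin.revPerm) := rfl
    rw [he, inversions_rev, ← Equiv.prod_comp (Fin.revPerm : Equiv.Perm (Fin v.length))]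
    congr 1
    refine Finset.prod_congr rfl fun i _ => ?_
    have hrev : ∀ (l : List K) (hl : l.length = v.length) (j : Fin v.length),
        l.reverse.getD (Fin.rev j) 0 = l.getD j 0 := by
      intro l hl j
      have := j.2
      rw [List.getD_eq_getElem?_getD, List.getD_eq_getElem?_getD,
        List.getElem?_reverse (by rw [hl]; exact (Fin.rev j).2)]
      congr 2
      rw [Fin.val_rev]
      omega
    simp only [Equiv.trans_apply, Fin.revPerm_apply, Fin.rev_rev]
    rw [hrev u h, hrev v rfl]
  · rw [qInner_of_ne q h, qInner_of_ne q (by simpa using h)]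

/-- Sorting permutations by the image of the first position, as in a Laplace expansion. The
right-hand side dictates the formula for the adjoint of the creation operator. -/
theorem qInner_cons (ξ : K) (u v : List K) : qInner q (ξ :: u) v =
    ∑ k : Fin v.length, ((q : ℝ) : ℂ) ^ (k : ℕ) * inner ℂ ξ (v.getD k 0) *
      qInner q u (v.eraseIdx k) := by
  by_cases h : (ξ :: u).length = v.length
  · rw [qInner_eq_sum q h rfl]
    have h' : v.length = u.length + 1 := by rw [← h]; rfl
    have key : ∀ m, m = u.length + 1 → (∑ π : Equiv.Perm (Fin m), ((q : ℝ) : ℂ) ^ inversions π *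
          ∏ i : Fin m, inner ℂ ((ξ :: u).getD i 0) (v.getD (π i) 0)) =
        ∑ k : Fin m, ((q : ℝ) : ℂ) ^ (k : ℕ) * inner ℂ ξ (v.getD k 0) *
          qInner q u (v.eraseIdx k) := by
      rintro _ rfl
      rw [← Equiv.sum_comp (Equiv.ofBijective _ (consPerm_bijective u.length)),
        Fintype.sum_prod_type]
      refine Finset.sum_congr rfl fun k _ => ?_
      have hk := k.2
      rw [qInner_eq_sum q rfl (by rw [List.length_eraseIdx_of_lt (by omega)]; omega),
        Finset.mul_sum]
      refine Finset.sum_congr rfl fun σ _ => ?_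
      rw [Equiv.ofBijective_apply, inversions_consPerm, Fin.prod_univ_succ, consPerm_zero, pow_add]
      have hp : ∏ i : Fin u.length, inner ℂ ((ξ :: u).getD (i.succ : Fin _) 0)
          (v.getD (consPerm (k, σ) i.succ) 0) =
          ∏ i : Fin u.length, inner ℂ (u.getD i 0) ((v.eraseIdx k).getD (σ i) 0) := by
        refine Finset.prod_congr rfl fun i _ => ?_
        rw [consPerm_succ]
        congr 1
        rw [List.getD_eq_getElem?_getD, List.getD_eq_getElem?_getD, List.getElem?_eraseIdx]
        congr 1
        simp only [Fin.succAbove, Fin.lt_def, Fin.val_castSucc]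
        split_ifs <;> rfl
      rw [hp]
      simp only [Fin.val_zero, List.getD_cons_zero]
      ring
    exact key _ h'
  · rw [qInner_of_ne q h]
    refine (Finset.sum_eq_zero fun k _ => ?_).symm
    rw [qInner_of_ne, mul_zero]
    rw [List.length_eraseIdx_of_lt k.2]
    have := k.2
    simp only [List.length_cons] at h
    omega

/-- The action of the annihilation operator on an elementary tensor. -/
def annList (ξ : K) : List K → List K →₀ ℂ
  | [] => 0
  | v :: w => inner ℂ ξ v • Finsupp.single w 1 +
      ((q : ℝ) : ℂ) • Finsupp.lmapDomain ℂ ℂ (List.cons v) (annList ξ w)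

theorem annList_eq_sum (ξ : K) (v : List K) : annList q ξ v = ∑ k : Fin v.length,
    (((q : ℝ) : ℂ) ^ (k : ℕ) * inner ℂ ξ (v.getD k 0)) • Finsupp.single (v.eraseIdx k) 1 := by
  induction v with
  | nil => simp [annList]
  | cons v w ih =>
    rw [annList, ih]
    change _ = ∑ k : Fin (w.length + 1), _
    rw [Fin.sum_univ_succ, map_sum, Finset.smul_sum]
    congr 1
    · simp
    · refine Finset.sum_congr rfl fun k _ => ?_
      rw [map_smul, smul_smul, Finsupp.lmapDomain_apply, Finsupp.mapDomain_single]
      simp only [Fin.val_succ, List.getD_cons_succ, List.eraseIdx_cons_succ, pow_succ]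
      congr 1
      ring

theorem qInner_cons_eq_linearCombination (ξ : K) (u v : List K) : qInner q (ξ :: u) v =
    Finsupp.linearCombination ℂ (qInner q u) (annList q ξ v) := by
  rw [qInner_cons, annList_eq_sum, map_sum]
  refine Finset.sum_congr rfl fun k _ => ?_
  rw [map_smul, Finsupp.linearCombination_single, one_smul, smul_eq_mul]

end Annihilation

/-! ### Creation and annihilation operators -/

section

variable (q : Set.Ioo (-1 : ℝ) 1) {K : Type*} [NormedAddCommGroup K] [InnerProductSpace ℂ K]

namespace PreFock

/-- The elementary tensor in the space of formal linear combinations. -/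
def tens (w : List K) : PreFock q K := (PreFock.equiv q K).symm (Finsupp.single w 1)

theorem inner_tens (u v : List K) : inner ℂ (tens q u) (tens q v) = qInner q u v := by
  change PreFock.form q (Finsupp.single u 1) (Finsupp.single v 1) = _
  simp [PreFock.form]

variable {q} in
theorem induction {p : PreFock q K → Prop} (f : PreFock q K) (h0 : p 0)
    (hadd : ∀ f g, p f → p g → p (f + g)) (hs : ∀ (c : ℂ) w, p (c • tens q w)) : p f := by
  refine Finsupp.induction_linear (motive := fun f => p ((PreFock.equiv q K).symm f))
    (PreFock.equiv q K f) ?_ ?_ ?_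
  · simpa using h0
  · intro f g hf hg
    rw [map_add]
    exact hadd _ _ hf hg
  · intro w c
    have : (PreFock.equiv q K).symm (Finsupp.single w c) = c • tens q w := by
      rw [tens, ← map_smul, Finsupp.smul_single, smul_eq_mul, mul_one]
    rw [this]
    exact hs c w

/-- The algebraic creation operator. -/
def create (ξ : K) : PreFock q K →ₗ[ℂ] PreFock q K :=
  (PreFock.equiv q K).symm.toLinearMap ∘ₗ
    Finsupp.lmapDomain ℂ ℂ (List.cons ξ) ∘ₗ (PreFock.equiv q K).toLinearMap

theorem create_tens (ξ : K) (w : List K) : create q ξ (tens q w) = tens q (ξ :: w) := by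
  simp [create, tens]

/-- The algebraic annihilation operator. -/
def annihilate (ξ : K) : PreFock q K →ₗ[ℂ] PreFock q K :=
  (PreFock.equiv q K).symm.toLinearMap ∘ₗ
    Finsupp.linearCombination ℂ (annList q ξ) ∘ₗ (PreFock.equiv q K).toLinearMap

theorem annihilate_tens (ξ : K) (w : List K) :
    annihilate q ξ (tens q w) = (PreFock.equiv q K).symm (annList q ξ w) := by
  simp [annihilate, tens]

theorem annihilate_tens_nil (ξ : K) : annihilate q ξ (tens q []) = 0 := by
  rw [annihilate_tens, annList, map_zero]

theorem annihilate_tens_cons (ξ v : K) (w : List K) : annihilate q ξ (tens q (v :: w)) =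
    inner ℂ ξ v • tens q w + ((q : ℝ) : ℂ) • create q v (annihilate q ξ (tens q w)) := by
  rw [annihilate_tens, annihilate_tens, annList, map_add, map_smul, map_smul]
  simp [create, tens]

theorem inner_create_tens (ξ : K) (f : PreFock q K) (u : List K) :
    inner ℂ (create q ξ (tens q u)) f = inner ℂ (tens q u) (annihilate q ξ f) := by
  have h : ∀ (u : List K) (g : List K →₀ ℂ), inner ℂ (tens q u) ((PreFock.equiv q K).symm g) =
      Finsupp.linearCombination ℂ (qInner q u) g := by
    intro u g
    induction g using Finsupp.induction_linear with
    | zero => simp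
    | add f g hf hg => rw [map_add, map_add, inner_add_right, hf, hg]
    | single w c =>
      have : (PreFock.equiv q K).symm (Finsupp.single w c) = c • tens q w := by
        rw [tens, ← map_smul, Finsupp.smul_single, smul_eq_mul, mul_one]
      rw [this, inner_smul_right, inner_tens, Finsupp.linearCombination_single, smul_eq_mul]
  induction f using PreFock.induction with
  | h0 => simp
  | hadd f g hf hg => rw [inner_add_right, map_add, inner_add_right, hf, hg]
  | hs c w =>
    rw [inner_smul_right, map_smul, inner_smul_right, create_tens, inner_tens, annihilate_tens, h,
      qInner_cons_eq_linearCombination]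

theorem inner_create (ξ : K) (f g : PreFock q K) :
    inner ℂ (create q ξ f) g = inner ℂ f (annihilate q ξ g) := by
  induction f using PreFock.induction with
  | h0 => simp
  | hadd f f' hf hg => rw [map_add, inner_add_left, inner_add_left, hf, hg]
  | hs c w => rw [map_smul, inner_smul_left, inner_smul_left, inner_create_tens]

theorem annihilate_create (ξ η : K) (f : PreFock q K) : annihilate q ξ (create q η f) =
    inner ℂ ξ η • f + ((q : ℝ) : ℂ) • create q η (annihilate q ξ f) := by
  induction f using PreFock.induction with
  | h0 => simp
  | hadd f g hf hg => simp only [map_add, hf, hg, smul_add]; abel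
  | hs c w =>
    simp only [map_smul, create_tens, annihilate_tens_cons, smul_add]
    rw [smul_comm c, smul_comm c]

variable (K) in
/-- The span of the elementary tensors of degree less than `n`. -/
def degLT (n : ℕ) : Submodule ℂ (PreFock q K) :=
  Submodule.span ℂ {f | ∃ w : List K, w.length < n ∧ tens q w = f}

theorem tens_mem_degLT {n : ℕ} {w : List K} (h : w.length < n) : tens q w ∈ degLT q K n :=
  Submodule.subset_span ⟨w, h, rfl⟩

theorem annihilate_mem_degLT (ξ : K) {n : ℕ} {f : PreFock q K} (hf : f ∈ degLT q K (n + 1)) :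
    annihilate q ξ f ∈ degLT q K n := by
  have h : degLT q K (n + 1) ≤ (degLT q K n).comap (annihilate q ξ) := by
    refine Submodule.span_le.mpr ?_
    rintro _ ⟨w, hw, rfl⟩
    change annihilate q ξ (tens q w) ∈ degLT q K n
    rw [annihilate_tens, annList_eq_sum, map_sum]
    refine Submodule.sum_mem _ fun k _ => ?_
    rw [map_smul]
    refine Submodule.smul_mem _ _ (tens_mem_degLT q ?_)
    rw [List.length_eraseIdx_of_lt k.2]
    have := k.2
    omega
  exact h hf

theorem exists_mem_degLT (f : PreFock q K) : ∃ n, f ∈ degLT q K n := by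
  have mono : Monotone (degLT q K) := fun m n hmn =>
    Submodule.span_mono fun f ⟨w, hw, h⟩ => ⟨w, hw.trans_le hmn, h⟩
  induction f using PreFock.induction with
  | h0 => exact ⟨0, Submodule.zero_mem _⟩
  | hadd f g hf hg =>
    obtain ⟨m, hm⟩ := hf
    obtain ⟨n, hn⟩ := hg
    exact ⟨max m n, Submodule.add_mem _ (mono (le_max_left _ _) hm) (mono (le_max_right _ _) hn)⟩
  | hs c w => exact ⟨w.length + 1, Submodule.smul_mem _ _ (tens_mem_degLT q (Nat.lt_succ_self _))⟩

theorem norm_create_sq (ξ : K) (f : PreFock q K) :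
    ‖create q ξ f‖ ^ 2 = ‖ξ‖ ^ 2 * ‖f‖ ^ 2 + (q : ℝ) * ‖annihilate q ξ f‖ ^ 2 := by
  have h1 : inner ℂ (create q ξ f) (create q ξ f) = inner ℂ ξ ξ * inner ℂ f f +
      ((q : ℝ) : ℂ) * inner ℂ (annihilate q ξ f) (annihilate q ξ f) := by
    rw [inner_create, annihilate_create, inner_add_right, inner_smul_right, inner_smul_right,
      ← inner_conj_symm f (create q ξ _), inner_create, inner_conj_symm]
  simp only [inner_self_eq_norm_sq_to_K] at h1
  have h2 : ((‖create q ξ f‖ ^ 2 : ℝ) : ℂ) =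
      ((‖ξ‖ ^ 2 * ‖f‖ ^ 2 + (q : ℝ) * ‖annihilate q ξ f‖ ^ 2 : ℝ) : ℂ) := by
    push_cast
    exact h1
  exact Complex.ofReal_injective h2

/-- Induction on the degree. A bound B for creation in degrees below n bounds annihilation a in
degrees below n + 1, through ‖af‖² = ⟨c(af), f⟩ ≤ B‖af‖‖f‖. The relation ‖cf‖² = ‖ξ‖²‖f‖² + q‖af‖²
then returns the same bound for creation, because B² = ‖ξ‖² + |q|B² is the equation defining B. -/
theorem norm_create_le (ξ : K) (f : PreFock q K) :
    ‖create q ξ f‖ ≤ Real.sqrt (1 / (1 - |(q : ℝ)|)) * ‖ξ‖ * ‖f‖ := by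
  have hq : |(q : ℝ)| < 1 := abs_lt.mpr q.2
  have hq' : 0 < 1 - |(q : ℝ)| := by linarith
  set B : ℝ := Real.sqrt (1 / (1 - |(q : ℝ)|)) * ‖ξ‖ with hB
  have hB0 : 0 ≤ B := by positivity
  have hB2 : ‖ξ‖ ^ 2 + |(q : ℝ)| * B ^ 2 = B ^ 2 := by
    rw [hB, mul_pow, Real.sq_sqrt (by positivity)]
    field_simp
    ring
  have key : ∀ n, ∀ f ∈ degLT q K n, ‖create q ξ f‖ ≤ B * ‖f‖ := by
    intro n
    induction n with
    | zero =>
      intro f hf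
      have : f = 0 := by
        have h : degLT q K 0 = ⊥ := by
          rw [degLT, Submodule.span_eq_bot]
          rintro _ ⟨w, hw, _⟩
          exact absurd hw (Nat.not_lt_zero _)
        rwa [h, Submodule.mem_bot] at hf
      simp [this]
    | succ n ih =>
      intro f hf
      have h1 := ih _ (annihilate_mem_degLT q ξ hf)
      have h2 : ‖annihilate q ξ f‖ ^ 2 ≤ ‖create q ξ (annihilate q ξ f)‖ * ‖f‖ := by
        rw [← inner_self_eq_norm_sq (𝕜 := ℂ), ← inner_create]
        exact (RCLike.re_le_norm _).trans (norm_inner_le_norm _ _)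
      have h3 : ‖annihilate q ξ f‖ ≤ B * ‖f‖ := by
        by_contra! hlt
        have h0 : 0 < ‖annihilate q ξ f‖ := lt_of_le_of_lt (by positivity) hlt
        nlinarith [norm_nonneg f]
      have h4 := norm_create_sq q ξ f
      have h5 : (q : ℝ) * ‖annihilate q ξ f‖ ^ 2 ≤ |(q : ℝ)| * (B * ‖f‖) ^ 2 := by
        refine (mul_le_mul_of_nonneg_right (le_abs_self _) (sq_nonneg _)).trans ?_
        gcongr
      refine abs_le_of_sq_le_sq' ?_ (by positivity) |>.2
      rw [h4]
      calc _ ≤ ‖ξ‖ ^ 2 * ‖f‖ ^ 2 + |(q : ℝ)| * (B * ‖f‖) ^ 2 := by linarith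
        _ = (‖ξ‖ ^ 2 + |(q : ℝ)| * B ^ 2) * ‖f‖ ^ 2 := by ring
        _ = _ := by rw [hB2]; ring
  obtain ⟨n, hn⟩ := exists_mem_degLT q f
  exact key n f hn

end PreFock

/-! ### The operators on the Fock space -/

theorem tensor_eq (w : List K) : tensor q w = ((PreFock.tens q w : PreFock q K) : Fock q K) := rfl

theorem inner_tensor (u v : List K) : inner ℂ (tensor q u) (tensor q v) = qInner q u v := by
  rw [tensor_eq, tensor_eq, UniformSpace.Completion.inner_coe, PreFock.inner_tens]

theorem dense_span_tensor :
    Dense (Submodule.span ℂ (Set.range (tensor q (K := K))) : Set (Fock q K)) := by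
  refine (UniformSpace.Completion.denseRange_coe (α := PreFock q K)).mono ?_
  rintro _ ⟨f, rfl⟩
  induction f using PreFock.induction with
  | h0 => rw [UniformSpace.Completion.coe_zero]; exact Submodule.zero_mem _
  | hadd f g hf hg => rw [UniformSpace.Completion.coe_add]; exact Submodule.add_mem _ hf hg
  | hs c w =>
    rw [UniformSpace.Completion.coe_smul]
    exact Submodule.smul_mem _ _ (Submodule.subset_span ⟨w, rfl⟩)

variable {q} in
/-- A bounded operator on the Fock space is determined by its action on elementary tensors. -/
theorem Fock.clm_ext {E : Type*} [NormedAddCommGroup E] [NormedSpace ℂ E]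
    {S T : Fock q K →L[ℂ] E} (h : ∀ w, S (tensor q w) = T (tensor q w)) : S = T :=
  ContinuousLinearMap.ext_on (dense_span_tensor q) (by rintro _ ⟨w, rfl⟩; exact h w)

variable {q} in
theorem Fock.eq_of_inner_tensor {x y : Fock q K}
    (h : ∀ w, inner ℂ (tensor q w) x = inner ℂ (tensor q w) y) : x = y := by
  rw [← sub_eq_zero]
  refine (dense_span_tensor q).eq_zero_of_inner_right ℂ fun v hv => ?_
  induction hv using Submodule.span_induction with
  | mem v hv => obtain ⟨w, rfl⟩ := hv; rw [inner_sub_right, h, sub_self]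
  | zero => simp
  | add x y _ _ hx hy => rw [inner_add_left, hx, hy, add_zero]
  | smul c x _ hx => rw [inner_smul_left, hx, mul_zero]

theorem exists_clm_of_bound (L : PreFock q K →ₗ[ℂ] PreFock q K) (C : ℝ)
    (hC : ∀ f, ‖L f‖ ≤ C * ‖f‖) : ∃ T : Fock q K →L[ℂ] Fock q K, ‖T‖ ≤ max C 0 ∧
      ∀ f : PreFock q K, T (f : Fock q K) = ((L f : PreFock q K) : Fock q K) := by
  let e : PreFock q K →L[ℂ] Fock q K := UniformSpace.Completion.toComplL
  have he : DenseRange e := UniformSpace.Completion.denseRange_coe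
  have hb : ∀ f, ‖(e.toLinearMap ∘ₗ L) f‖ ≤ max C 0 * ‖e f‖ := by
    intro f
    change ‖((L f : PreFock q K) : Fock q K)‖ ≤ max C 0 * ‖(f : Fock q K)‖
    rw [UniformSpace.Completion.norm_coe, UniformSpace.Completion.norm_coe]
    exact (hC f).trans (mul_le_mul_of_nonneg_right (le_max_left _ _) (norm_nonneg _))
  refine ⟨(e.toLinearMap ∘ₗ L).extendOfNorm e, ?_, fun f => ?_⟩
  · exact ContinuousLinearMap.opNorm_le_bound _ (le_max_right _ _)
      (LinearMap.norm_extendOfNorm_apply_le he _ hb)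
  · exact LinearMap.extendOfNorm_eq he ⟨_, hb⟩ f

theorem exists_creation (ξ : K) : ∃ T : Fock q K →L[ℂ] Fock q K,
    ‖T‖ ≤ Real.sqrt (1 / (1 - |(q : ℝ)|)) * ‖ξ‖ ∧ ∀ w : List K, T (tensor q w) = tensor q (ξ :: w) := by
  obtain ⟨T, hT, h⟩ := exists_clm_of_bound q (PreFock.create q ξ) _ (PreFock.norm_create_le q ξ)
  refine ⟨T, ?_, fun w => ?_⟩
  · rwa [max_eq_left (by positivity)] at hT
  · rw [tensor_eq, h, PreFock.create_tens]; rfl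

@[simp] theorem creation_tensor (ξ : K) (w : List K) :
    creation q ξ (tensor q w) = tensor q (ξ :: w) := by
  have h : ∃ T : Fock q K →L[ℂ] Fock q K, ∀ w : List K, T (tensor q w) = tensor q (ξ :: w) :=
    (exists_creation q ξ).imp fun _ h => h.2
  unfold creation
  rw [dif_pos h]
  exact h.choose_spec w

theorem norm_creation_le (ξ : K) :
    ‖creation q ξ‖ ≤ Real.sqrt (1 / (1 - |(q : ℝ)|)) * ‖ξ‖ := by
  obtain ⟨T, hT, h⟩ := exists_creation q ξ
  have : creation q ξ = T := Fock.clm_ext fun w => by rw [creation_tensor, h]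
  rwa [this]

theorem annihilation_tensor (ξ : K) (w : List K) : annihilation q ξ (tensor q w) =
    ((PreFock.annihilate q ξ (PreFock.tens q w) : PreFock q K) : Fock q K) := by
  refine Fock.eq_of_inner_tensor fun u => ?_
  rw [annihilation, ContinuousLinearMap.adjoint_inner_right, creation_tensor, tensor_eq, tensor_eq,
    tensor_eq, UniformSpace.Completion.inner_coe, UniformSpace.Completion.inner_coe,
    ← PreFock.create_tens, PreFock.inner_create]

@[simp] theorem annihilation_tensor_nil (ξ : K) : annihilation q ξ (tensor q []) = 0 := by
  rw [annihilation_tensor, PreFock.annihilate_tens_nil, UniformSpace.Completion.coe_zero]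

theorem creation_coe (ξ : K) (f : PreFock q K) :
    creation q ξ (f : Fock q K) = ((PreFock.create q ξ f : PreFock q K) : Fock q K) := by
  induction f using PreFock.induction with
  | h0 => rw [UniformSpace.Completion.coe_zero, map_zero, map_zero, UniformSpace.Completion.coe_zero]
  | hadd f g hf hg =>
    rw [UniformSpace.Completion.coe_add, map_add, hf, hg, map_add, UniformSpace.Completion.coe_add]
  | hs c w =>
    rw [UniformSpace.Completion.coe_smul, map_smul, map_smul, UniformSpace.Completion.coe_smul,
      ← tensor_eq, creation_tensor, PreFock.create_tens]
    rfl

theorem annihilation_tensor_cons (ξ v : K) (w : List K) : annihilation q ξ (tensor q (v :: w)) =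
    inner ℂ ξ v • tensor q w + ((q : ℝ) : ℂ) • creation q v (annihilation q ξ (tensor q w)) := by
  rw [annihilation_tensor, PreFock.annihilate_tens_cons, UniformSpace.Completion.coe_add,
    UniformSpace.Completion.coe_smul, UniformSpace.Completion.coe_smul, annihilation_tensor,
    creation_coe]
  rfl

theorem annihilation_mul_creation (ξ η : K) : annihilation q ξ * creation q η =
    inner ℂ ξ η • 1 + ((q : ℝ) : ℂ) • (creation q η * annihilation q ξ) :=
  Fock.clm_ext fun w => by
    simp [annihilation_tensor_cons]

theorem annihilation_add (ξ η : K) :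
    annihilation q (ξ + η) = annihilation q ξ + annihilation q η :=
  Fock.clm_ext fun w => by
    induction w with
    | nil => simp
    | cons v w ih =>
      simp only [annihilation_tensor_cons, ih, add_apply, inner_add_left, map_add,
        smul_add, add_smul]
      abel

theorem annihilation_smul (c : ℂ) (ξ : K) :
    annihilation q (c • ξ) = (starRingEnd ℂ) c • annihilation q ξ :=
  Fock.clm_ext fun w => by
    induction w with
    | nil => simp
    | cons v w ih =>
      simp only [annihilation_tensor_cons, ih, smul_apply, inner_smul_left, map_smul,
        smul_add, smul_smul]
      rw [mul_comm ((q : ℝ) : ℂ)]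

theorem adjoint_annihilation (ξ : K) :
    ContinuousLinearMap.adjoint (annihilation q ξ) = creation q ξ := by
  rw [annihilation, ContinuousLinearMap.adjoint_adjoint]

theorem creation_add (ξ η : K) : creation q (ξ + η) = creation q ξ + creation q η := by
  rw [← adjoint_annihilation, annihilation_add, map_add, adjoint_annihilation, adjoint_annihilation]

theorem creation_smul (c : ℂ) (ξ : K) : creation q (c • ξ) = c • creation q ξ := by
  rw [← adjoint_annihilation, annihilation_smul, map_smulₛₗ, adjoint_annihilation]
  simp

end

/-! ### Right field operators and the separating vacuum -/

section Right

variable (q : Set.Ioo (-1 : ℝ) 1) {K : Type*} [NormedAddCommGroup K] [InnerProductSpace ℂ K]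

theorem exists_flip : ∃ T : Fock q K →L[ℂ] Fock q K,
    ∀ w : List K, T (tensor q w) = tensor q w.reverse := by
  let L : PreFock q K →ₗ[ℂ] PreFock q K := (PreFock.equiv q K).symm.toLinearMap ∘ₗ
    Finsupp.lmapDomain ℂ ℂ List.reverse ∘ₗ (PreFock.equiv q K).toLinearMap
  have hL : ∀ w, L (PreFock.tens q w) = PreFock.tens q w.reverse := by
    intro w; simp [L, PreFock.tens]
  have h1 : ∀ w f, inner ℂ (L (PreFock.tens q w)) (L f) = inner ℂ (PreFock.tens q w) f := by
    intro w f
    induction f using PreFock.induction with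
    | h0 => simp
    | hadd f g hf hg => rw [map_add, inner_add_right, inner_add_right, hf, hg]
    | hs c u =>
      rw [map_smul, inner_smul_right, inner_smul_right, hL, hL, PreFock.inner_tens,
        PreFock.inner_tens, qInner_reverse]
  have h2 : ∀ f g, inner ℂ (L f) (L g) = inner ℂ f g := by
    intro f g
    induction f using PreFock.induction with
    | h0 => simp
    | hadd f f' hf hf' => rw [map_add, inner_add_left, inner_add_left, hf, hf']
    | hs c u => rw [map_smul, inner_smul_left, inner_smul_left, h1]
  have h3 : ∀ f, ‖L f‖ ≤ 1 * ‖f‖ := by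
    intro f
    rw [one_mul, ← sq_le_sq₀ (norm_nonneg _) (norm_nonneg _), ← inner_self_eq_norm_sq (𝕜 := ℂ),
      ← inner_self_eq_norm_sq (𝕜 := ℂ), h2]
  obtain ⟨T, -, hT⟩ := exists_clm_of_bound q L 1 h3
  exact ⟨T, fun w => by rw [tensor_eq, hT, hL]; rfl⟩

variable (K) in
/-- The unitary reversing the order of the factors of elementary tensors. -/
def flip : Fock q K →L[ℂ] Fock q K := (exists_flip q (K := K)).choose

@[simp] theorem flip_tensor (w : List K) : flip q K (tensor q w) = tensor q w.reverse :=
  (exists_flip q).choose_spec w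

theorem star_flip : star (flip q K) = flip q K :=
  Fock.clm_ext fun w => Fock.eq_of_inner_tensor fun u => by
    rw [ContinuousLinearMap.star_eq_adjoint, ContinuousLinearMap.adjoint_inner_right, flip_tensor,
      flip_tensor, inner_tensor, inner_tensor, ← qInner_reverse, List.reverse_reverse]

/-- The right creation operator. -/
def rightCreation (η : K) : Fock q K →L[ℂ] Fock q K := flip q K * creation q η * flip q K

@[simp] theorem rightCreation_tensor (η : K) (w : List K) :
    rightCreation q η (tensor q w) = tensor q (w ++ [η]) := by
  simp [rightCreation]

theorem star_creation (ξ : K) : star (creation q ξ) = annihilation q ξ := rfl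

theorem star_annihilation (ξ : K) : star (annihilation q ξ) = creation q ξ :=
  adjoint_annihilation q ξ

/-- The right field operator. -/
def rightField (η : K) : Fock q K →L[ℂ] Fock q K := rightCreation q η + star (rightCreation q η)

/-- The left field operator. -/
def leftField (ξ : K) : Fock q K →L[ℂ] Fock q K := creation q ξ + annihilation q ξ

theorem creation_mul_rightCreation (ξ η : K) :
    creation q ξ * rightCreation q η = rightCreation q η * creation q ξ :=
  Fock.clm_ext fun w => by simp

/-- To contract with the last factor η, annihilation passes every letter of w and collects one
factor q for each. -/
theorem annihilation_rightCreation_tensor (ξ η : K) (w : List K) :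
    annihilation q ξ (rightCreation q η (tensor q w)) =
      rightCreation q η (annihilation q ξ (tensor q w)) +
        (((q : ℝ) : ℂ) ^ w.length * inner ℂ ξ η) • tensor q w := by
  induction w with
  | nil => simp [annihilation_tensor_cons]
  | cons v w ih =>
    have h : ∀ x, creation q v (rightCreation q η x) = rightCreation q η (creation q v x) :=
      fun x => congrArg (fun T => T x) (creation_mul_rightCreation q v η)
    rw [rightCreation_tensor] at ih ⊢
    rw [List.cons_append, annihilation_tensor_cons, ih, annihilation_tensor_cons]
    simp only [map_add, map_smul, rightCreation_tensor, smul_add, smul_smul, creation_tensor, h,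
      List.length_cons, pow_succ]
    rw [← add_assoc]
    congr 2
    ring

/-- The left and right creation operators commute, and so do their adjoints. The two mixed
commutators combine to D - D*, where D = [c*(ξ), c_r(η)] is multiplication by qⁿ⟨ξ, η⟩ in degree n,
and this is self-adjoint exactly because ⟨ξ, η⟩ is real. -/
theorem leftField_commute_rightField {ξ η : K} (h : (starRingEnd ℂ) (inner ℂ ξ η) = inner ℂ ξ η) :
    leftField q ξ * rightField q η = rightField q η * leftField q ξ := by
  set D := annihilation q ξ * rightCreation q η - rightCreation q η * annihilation q ξ with hD
  have hDt : ∀ w, D (tensor q w) = (((q : ℝ) : ℂ) ^ w.length * inner ℂ ξ η) • tensor q w := by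
    intro w
    rw [hD, sub_apply, mul_apply_eq_comp, mul_apply_eq_comp,
      annihilation_rightCreation_tensor, add_sub_cancel_left]
  have hDs : star D = D := by
    refine Fock.clm_ext fun w => Fock.eq_of_inner_tensor fun u => ?_
    rw [ContinuousLinearMap.star_eq_adjoint, ContinuousLinearMap.adjoint_inner_right, hDt, hDt,
      inner_smul_left, inner_smul_right, inner_tensor, map_mul, h, map_pow, Complex.conj_ofReal]
    by_cases hl : u.length = w.length
    · rw [hl]
    · rw [qInner_of_ne q hl, mul_zero, mul_zero]
  have h1 := creation_mul_rightCreation q ξ η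
  have h2 := congrArg star h1
  have h3 := hDs
  rw [star_mul, star_mul, star_creation] at h2
  rw [hD, star_sub, star_mul, star_mul, star_annihilation] at h3
  unfold leftField rightField
  rw [← sub_eq_zero]
  calc _ = (creation q ξ * rightCreation q η - rightCreation q η * creation q ξ) +
      ((annihilation q ξ * rightCreation q η - rightCreation q η * annihilation q ξ) -
        (star (rightCreation q η) * creation q ξ - creation q ξ * star (rightCreation q η))) -
      (star (rightCreation q η) * annihilation q ξ -
        annihilation q ξ * star (rightCreation q η)) := by noncomm_ring
    _ = 0 := by rw [h3, h2, h1]; simp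

theorem annihilation_tensor_eq_sum (ξ : K) (v : List K) : annihilation q ξ (tensor q v) =
    ∑ k : Fin v.length, (((q : ℝ) : ℂ) ^ (k : ℕ) * inner ℂ ξ (v.getD k 0)) •
      tensor q (v.eraseIdx k) := by
  have hcoe : ∀ f : PreFock q K, (f : Fock q K) = UniformSpace.Completion.toComplL (𝕜 := ℂ) f :=
    fun _ => rfl
  rw [annihilation_tensor, PreFock.annihilate_tens, annList_eq_sum, map_sum, hcoe, map_sum]
  refine Finset.sum_congr rfl fun k _ => ?_
  rw [map_smul, map_smul]
  rfl

theorem star_rightCreation (η : K) :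
    star (rightCreation q η) = flip q K * annihilation q η * flip q K := by
  rw [rightCreation, star_mul, star_mul, star_flip, star_creation, mul_assoc]

/-- The map `η ↦ c_r(η) x`, for a fixed vector `x`. -/
def rightCreationL (x : Fock q K) : K →L[ℂ] Fock q K :=
  LinearMap.mkContinuous
    { toFun := fun η => rightCreation q η x
      map_add' := fun η η' => by simp [rightCreation, creation_add]
      map_smul' := fun c η => by simp [rightCreation, creation_smul] }
    (‖flip q K‖ * (Real.sqrt (1 / (1 - |(q : ℝ)|)) * (‖flip q K‖ * ‖x‖))) fun η => by
      change ‖flip q K (creation q η (flip q K x))‖ ≤ _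
      have h1 := norm_creation_le q η
      calc _ ≤ ‖flip q K‖ * (‖creation q η‖ * (‖flip q K‖ * ‖x‖)) := by
            refine (ContinuousLinearMap.le_opNorm _ _).trans ?_
            gcongr
            refine (ContinuousLinearMap.le_opNorm _ _).trans ?_
            gcongr
            exact ContinuousLinearMap.le_opNorm _ _
        _ ≤ ‖flip q K‖ * ((Real.sqrt (1 / (1 - |(q : ℝ)|)) * ‖η‖) * (‖flip q K‖ * ‖x‖)) := by
            gcongr
        _ = _ := by ring

theorem rightCreationL_apply (x : Fock q K) (η : K) :
    rightCreationL q x η = rightCreation q η x := rfl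

/-- The vacuum is separating for the commutant of sufficiently many right field operators. -/
theorem eq_zero_of_commute_rightField {ι : Type*} {η : ι → K}
    (hη : Dense (Submodule.span ℂ (Set.range η) : Set K)) {z : Fock q K →L[ℂ] Fock q K}
    (hz : ∀ i, z * rightField q (η i) = rightField q (η i) * z) (h0 : z (vacuum q) = 0) :
    z = 0 := by
  refine Fock.clm_ext fun w => ?_
  rw [zero_apply]
  induction hn : w.length using Nat.strong_induction_on generalizing w with
  | _ n ih =>
    rcases List.eq_nil_or_concat w with rfl | ⟨w, v, rfl⟩
    · exact h0
    · have hw : w.length < n := by rw [← hn]; simp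
      -- For fixed w, the vector z(w ⊗ v) is linear and continuous in v, so v = ηᵢ suffices. There
      -- the right field operator applied to w is w ⊗ ηᵢ plus a vector of lower degree, which the
      -- induction hypothesis covers.
      suffices h : z ∘L rightCreationL q (tensor q w) = 0 by
        have := congrArg (fun T => T v) h
        simpa [rightCreationL_apply] using this
      refine ContinuousLinearMap.ext_on hη ?_
      rintro _ ⟨i, rfl⟩
      have h1 : z (star (rightCreation q (η i)) (tensor q w)) = 0 := by
        rw [star_rightCreation]
        simp only [mul_apply_eq_comp, flip_tensor, annihilation_tensor_eq_sum, map_sum,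
          map_smul]
        refine Finset.sum_eq_zero fun k _ => ?_
        have hk : (w.reverse.eraseIdx k).length < n := by
          rw [List.length_eraseIdx_of_lt k.2, List.length_reverse]
          omega
        rw [ih _ hk _ (by simp), smul_zero]
      have h2 := congrArg (fun T => T (tensor q w)) (hz i)
      simp only [mul_apply_eq_comp, rightField, add_apply, map_add, h1,
        ih _ hw w rfl, map_zero, add_zero] at h2
      exact h2

end Right

/-! ### Gaussian binomial coefficients -/

section QBinomial

/-- The Gaussian binomial coefficients. -/
def qBinom (q : ℝ) : ℕ → ℕ → ℝ
  | _, 0 => 1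
  | 0, _ + 1 => 0
  | n + 1, k + 1 => qBinom q n k + q ^ (k + 1) * qBinom q n (k + 1)

/-- The `q`-integers. -/
def qNum (q : ℝ) (n : ℕ) : ℝ := ∑ j ∈ Finset.range n, q ^ j

variable (q : ℝ)

@[simp] theorem qBinom_zero_right (n : ℕ) : qBinom q n 0 = 1 := by cases n <;> rfl

theorem qBinom_succ_succ (n k : ℕ) :
    qBinom q (n + 1) (k + 1) = qBinom q n k + q ^ (k + 1) * qBinom q n (k + 1) := rfl

theorem qBinom_eq_zero {n k : ℕ} (h : n < k) : qBinom q n k = 0 := by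
  induction n generalizing k with
  | zero => obtain ⟨k, rfl⟩ : ∃ l, k = l + 1 := ⟨k - 1, by omega⟩; rfl
  | succ n ih =>
    obtain ⟨k, rfl⟩ : ∃ l, k = l + 1 := ⟨k - 1, by omega⟩
    rw [qBinom_succ_succ, ih (by omega), ih (by omega)]
    simp

@[simp] theorem qBinom_self (n : ℕ) : qBinom q n n = 1 := by
  induction n with
  | zero => rfl
  | succ n ih => rw [qBinom_succ_succ, ih, qBinom_eq_zero q (Nat.lt_succ_self n)]; simp

@[simp] theorem dFin_zero : dFin q 0 = 1 := by simp [dFin]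

theorem dFin_succ (n : ℕ) : dFin q (n + 1) = dFin q n * (1 - q ^ (n + 1)) := by
  rw [dFin, Finset.prod_Icc_succ_top (by omega), dFin]

theorem qBinom_mul_dFin (i j : ℕ) : qBinom q (i + j) i * (dFin q i * dFin q j) = dFin q (i + j) := by
  induction h : i + j generalizing i j with
  | zero =>
    obtain ⟨rfl, rfl⟩ : i = 0 ∧ j = 0 := by omega
    simp
  | succ n ih =>
    rcases i with _ | i
    · obtain rfl : j = n + 1 := by omega
      simp
    · rcases j with _ | j
      · obtain rfl : i = n := by omega
        simp
      · have h1 := ih i (j + 1) (by omega)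
        have h2 := ih (i + 1) j (by omega)
        obtain rfl : n = i + j + 1 := by omega
        rw [qBinom_succ_succ, dFin_succ q (i + j + 1)]
        rw [dFin_succ q i] at h2 ⊢
        rw [dFin_succ q j] at h1 ⊢
        linear_combination (1 - q ^ (i + 1)) * h1 + q ^ (i + 1) * (1 - q ^ (j + 1)) * h2

theorem one_sub_mul_qNum (n : ℕ) : (1 - q) * qNum q n = 1 - q ^ n := by
  rw [qNum, mul_comm, geom_sum_mul_neg]

variable {q} in
theorem dFin_pos (hq : |q| < 1) (n : ℕ) : 0 < dFin q n := by
  refine Finset.prod_pos fun j hj => ?_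
  have hj' : j ≠ 0 := by have := (Finset.mem_Icc.mp hj).1; omega
  have := (abs_lt.mp (by rw [abs_pow]; exact pow_lt_one₀ (abs_nonneg q) hq hj' : |q ^ j| < 1)).2
  linarith

variable {q} in
theorem qBinom_succ_mul_qNum (hq : |q| < 1) (n k : ℕ) :
    qBinom q (n + 1) (k + 1) * qNum q (k + 1) = qNum q (n + 1) * qBinom q n k := by
  rcases lt_or_ge n k with h | h
  · rw [qBinom_eq_zero q h, qBinom_eq_zero q (by omega)]; simp
  · obtain ⟨j, rfl⟩ := Nat.exists_eq_add_of_le h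
    have h1 := qBinom_mul_dFin q (k + 1) j
    have h2 := qBinom_mul_dFin q k j
    rw [show k + 1 + j = k + j + 1 by ring, dFin_succ, dFin_succ, ← one_sub_mul_qNum,
      ← one_sub_mul_qNum] at h1
    have hpos : (1 - q) * (dFin q k * dFin q j) ≠ 0 := by
      have h3 : 0 < 1 - q := by have := (abs_lt.mp hq).2; linarith
      have h4 := dFin_pos hq k
      have h5 := dFin_pos hq j
      positivity
    refine mul_right_cancel₀ hpos ?_
    linear_combination h1 - (1 - q) * qNum q (k + j + 1) * h2

/-- Pascal's rule, applied to a sum. -/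
theorem sum_qBinom_succ {E : Type*} [AddCommGroup E] [Module ℂ E] (k : ℕ) (f : ℕ → ℕ → E) :
    ∑ p ∈ Finset.HasAntidiagonal.antidiagonal (k + 1), ((qBinom q (k + 1) p.1 : ℝ) : ℂ) • f p.1 p.2 =
      ∑ p ∈ Finset.HasAntidiagonal.antidiagonal k, ((qBinom q k p.1 : ℝ) : ℂ) •
        (f (p.1 + 1) p.2 + ((q : ℂ) ^ p.1) • f p.1 (p.2 + 1)) := by
  -- The same sum is split off at its first and at its last index. The term at index k + 1 vanishes,
  -- since the binomial of k over k + 1 is 0.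
  have h1 := Finset.Nat.sum_antidiagonal_succ
    (f := fun p : ℕ × ℕ => ((qBinom q k p.1 : ℝ) : ℂ) • ((q : ℂ) ^ p.1) • f p.1 p.2) (n := k)
  have h2 := Finset.Nat.sum_antidiagonal_succ'
    (f := fun p : ℕ × ℕ => ((qBinom q k p.1 : ℝ) : ℂ) • ((q : ℂ) ^ p.1) • f p.1 p.2) (n := k)
  rw [h1] at h2
  simp only [qBinom_eq_zero q (Nat.lt_succ_self k), Complex.ofReal_zero, zero_smul, zero_add,
    qBinom_zero_right, Complex.ofReal_one, one_smul, pow_zero] at h2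
  simp only [smul_add, Finset.sum_add_distrib]
  rw [← h2, Finset.Nat.sum_antidiagonal_succ]
  simp only [qBinom_succ_succ, Complex.ofReal_add, add_smul, Finset.sum_add_distrib,
    qBinom_zero_right, Complex.ofReal_one, one_smul, Complex.ofReal_mul, Complex.ofReal_pow,
    mul_smul]
  rw [add_left_comm]
  congr 2
  refine Finset.sum_congr rfl fun p _ => ?_
  rw [smul_comm]

end QBinomial

/-! ### Algebraic Wick expansion -/

section WickFormula

variable {B : Type*} [Ring B] [Algebra ℂ B]

/-- The normally ordered expression for the Wick operator of `b^k a^m Ω`. -/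
def wickSum (q : ℝ) (a b a' b' : B) (k m : ℕ) : B :=
  ∑ p ∈ Finset.HasAntidiagonal.antidiagonal k, ((qBinom q k p.1 : ℝ) : ℂ) •
    ∑ s ∈ Finset.HasAntidiagonal.antidiagonal m, ((qBinom q m s.1 : ℝ) : ℂ) •
      ((q : ℂ) ^ (p.2 * s.1)) • (b ^ p.1 * a ^ s.1 * a' ^ p.2 * b' ^ s.2)

variable {q : ℝ} {a b a' b' : B}

theorem mul_pow_of_qcomm {x y : B} (h : x * y = (q : ℂ) • (y * x)) (n : ℕ) :
    x * y ^ n = ((q : ℂ) ^ n) • (y ^ n * x) := by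
  induction n with
  | zero => simp
  | succ n ih =>
    rw [pow_succ, ← mul_assoc, ih, smul_mul_assoc, mul_assoc, h, mul_smul_comm, smul_smul,
      ← pow_succ, mul_assoc]

/-- Each of the n factors y is contracted once, the later ones with growing powers of q. For n = 0
the truncated exponent is harmless because `qNum q 0 = 0`. -/
theorem mul_pow_of_qccr {x y : B} {μ : ℂ} (h : x * y = μ • 1 + (q : ℂ) • (y * x)) (n : ℕ) :
    x * y ^ n = ((q : ℂ) ^ n) • (y ^ n * x) + (μ * (qNum q n : ℝ)) • y ^ (n - 1) := by
  induction n with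
  | zero => simp [qNum]
  | succ n ih =>
    have h1 : qNum q (n + 1) = qNum q n + q ^ n := Finset.sum_range_succ _ _
    have h2 : (μ * (qNum q n : ℝ)) • (y ^ (n - 1) * y) = (μ * (qNum q n : ℝ)) • y ^ n := by
      rcases n with _ | n
      · simp [qNum]
      · rw [← pow_succ]; rfl
    rw [pow_succ, ← mul_assoc, ih, add_mul, smul_mul_assoc, smul_mul_assoc, h2, mul_assoc, h,
      mul_add, mul_smul_comm, mul_smul_comm, mul_one, smul_add, smul_smul, smul_smul,
      ← mul_assoc, ← pow_succ, ← pow_succ, h1, Nat.add_sub_cancel]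
    push_cast
    module

theorem wickSum_zero_left (m : ℕ) : wickSum q a b a' b' 0 m =
    ∑ s ∈ Finset.HasAntidiagonal.antidiagonal m, ((qBinom q m s.1 : ℝ) : ℂ) • (a ^ s.1 * b' ^ s.2) := by
  simp [wickSum]

theorem wickSum_zero_succ (h : b' * a = (q : ℂ) • (a * b')) (m : ℕ) :
    wickSum q a b a' b' 0 (m + 1) = (a + b') * wickSum q a b a' b' 0 m := by
  rw [wickSum_zero_left, wickSum_zero_left,
    sum_qBinom_succ q m fun i j => a ^ i * b' ^ j, Finset.mul_sum]
  refine Finset.sum_congr rfl fun s _ => ?_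
  rw [mul_smul_comm, add_mul, ← mul_assoc, ← mul_assoc, ← pow_succ', mul_pow_of_qcomm h,
    smul_mul_assoc, mul_assoc (a ^ s.1), ← pow_succ']

/-- Multiplying by b raises the power of b. Moving a' to its place gives the factor q^{i+j} and a
contraction with one of the j letters a. Pascal's rule assembles the uncontracted terms into degree
(k+1, m), and the contractions form a Wick sum of degree (k, m-1). -/
theorem wickSum_succ (hq : |q| < 1) {μ : ℂ} (haa : a' * a = μ • 1 + (q : ℂ) • (a * a'))
    (hab : a' * b = (q : ℂ) • (b * a')) (k m : ℕ) :
    (b + a') * wickSum q a b a' b' k m = wickSum q a b a' b' (k + 1) m +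
      (μ * (q : ℂ) ^ k * (qNum q m : ℝ)) • wickSum q a b a' b' k (m - 1) := by
  have hterm : ∀ i j l s : ℕ, (b + a') * (b ^ i * a ^ j * a' ^ l * b' ^ s) =
      (b ^ (i + 1) * a ^ j * a' ^ l * b' ^ s +
        ((q : ℂ) ^ i * (q : ℂ) ^ j) • (b ^ i * a ^ j * a' ^ (l + 1) * b' ^ s)) +
      (μ * (q : ℂ) ^ i * (qNum q j : ℝ)) • (b ^ i * a ^ (j - 1) * a' ^ l * b' ^ s) := by
    intro i j l s
    have h1 : a' * (b ^ i * a ^ j * a' ^ l * b' ^ s) =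
        (a' * b ^ i) * (a ^ j * (a' ^ l * b' ^ s)) := by simp only [mul_assoc]
    have h2 : b ^ i * a' * (a ^ j * (a' ^ l * b' ^ s)) =
        b ^ i * (a' * a ^ j) * (a' ^ l * b' ^ s) := by simp only [mul_assoc]
    rw [add_mul, h1, mul_pow_of_qcomm hab, smul_mul_assoc, h2, mul_pow_of_qccr haa,
      mul_add, add_mul, mul_smul_comm, mul_smul_comm, smul_mul_assoc, smul_mul_assoc, smul_add,
      smul_smul, smul_smul, pow_succ' b, pow_succ' a' l]
    simp only [mul_assoc]
    rw [add_assoc]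
    congr 3
    ring
  -- Absorption turns the binomial of m over j times [j] into [m] times the binomial of m-1 over
  -- j-1. Lowering j by one extracts q^l, which joins q^i to give q^k.
  have hthird : ∀ i l : ℕ, i + l = k → ∑ s ∈ Finset.HasAntidiagonal.antidiagonal m, ((qBinom q m s.1 : ℝ) : ℂ) •
      ((q : ℂ) ^ (l * s.1)) • ((μ * (q : ℂ) ^ i * (qNum q s.1 : ℝ)) •
        (b ^ i * a ^ (s.1 - 1) * a' ^ l * b' ^ s.2)) = (μ * (q : ℂ) ^ k * (qNum q m : ℝ)) •
      ∑ s ∈ Finset.HasAntidiagonal.antidiagonal (m - 1), ((qBinom q (m - 1) s.1 : ℝ) : ℂ) •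
      ((q : ℂ) ^ (l * s.1)) • (b ^ i * a ^ s.1 * a' ^ l * b' ^ s.2) := by
    rintro i l rfl
    rcases m with _ | m
    · simp [qNum]
    · rw [Finset.Nat.sum_antidiagonal_succ, Finset.smul_sum]
      have h0 : qNum q 0 = 0 := by simp [qNum]
      simp only [h0, Complex.ofReal_zero, mul_zero, zero_smul, smul_zero, zero_add,
        Nat.add_sub_cancel, smul_smul]
      refine Finset.sum_congr rfl fun s _ => ?_
      congr 1
      have h := qBinom_succ_mul_qNum hq m s.1
      have h' : ((qBinom q (m + 1) (s.1 + 1) : ℝ) : ℂ) * (qNum q (s.1 + 1) : ℝ) =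
          (qNum q (m + 1) : ℝ) * (qBinom q m s.1 : ℝ) := by exact_mod_cast h
      rw [mul_add l, mul_one, pow_add, pow_add]
      linear_combination (μ * (q : ℂ) ^ (l * s.1) * (q : ℂ) ^ l * (q : ℂ) ^ i) * h'
  have hf := sum_qBinom_succ q k fun i l => ∑ s ∈ Finset.HasAntidiagonal.antidiagonal m,
    ((qBinom q m s.1 : ℝ) : ℂ) • ((q : ℂ) ^ (l * s.1)) • (b ^ i * a ^ s.1 * a' ^ l * b' ^ s.2)
  rw [wickSum, wickSum, hf, wickSum, Finset.mul_sum, Finset.smul_sum, ← Finset.sum_add_distrib]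
  refine Finset.sum_congr rfl fun p hp => ?_
  rw [smul_comm _ ((qBinom q k p.1 : ℝ) : ℂ), ← smul_add, mul_smul_comm,
    ← hthird p.1 p.2 (Finset.HasAntidiagonal.mem_antidiagonal.mp hp)]
  congr 1
  rw [Finset.mul_sum, Finset.smul_sum, ← Finset.sum_add_distrib, ← Finset.sum_add_distrib]
  refine Finset.sum_congr rfl fun s _ => ?_
  rw [mul_smul_comm, mul_smul_comm, hterm]
  simp only [smul_add]
  congr 2
  simp only [smul_smul]
  congr 1
  ring

/-- Wick operators from their recursion: a subspace stable under left multiplication by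
`a + b'` and `b + a'` contains all normally ordered expressions. -/
theorem wickSum_mem (hq : |q| < 1) (A : Subalgebra ℂ B) (h1 : a + b' ∈ A) (h2 : b + a' ∈ A) {μ : ℂ}
    (hba : b' * a = (q : ℂ) • (a * b')) (haa : a' * a = μ • 1 + (q : ℂ) • (a * a'))
    (hab : a' * b = (q : ℂ) • (b * a')) (k m : ℕ) : wickSum q a b a' b' k m ∈ A := by
  induction k generalizing m with
  | zero =>
    induction m with
    | zero => simp [wickSum, A.one_mem]
    | succ m ih => rw [wickSum_zero_succ hba]; exact A.mul_mem h1 ih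
  | succ k ih =>
    rw [← sub_eq_of_eq_add (wickSum_succ hq haa hab k m)]
    exact A.sub_mem (A.mul_mem h2 (ih m)) (A.smul_mem (ih _) _)

end WickFormula

/-! ### Wick operators of the q-Araki-Woods algebra -/

section WickAlgebra

variable {H : Type*} [NormedAddCommGroup H] [InnerProductSpace ℝ H]
variable (q : Set.Ioo (-1 : ℝ) 1) (U : OrthogonalGroup H)

theorem star_leftField {K : Type*} [NormedAddCommGroup K] [InnerProductSpace ℂ K] (ξ : K) :
    star (leftField q ξ) = leftField q ξ := by
  rw [leftField, star_add, star_creation, star_annihilation, add_comm]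

theorem leftField_mem_arakiWoods (h : H) :
    leftField q (toHU U (Cplx.ofReal h)) ∈ arakiWoods q U := by
  change _ ∈ StarSubalgebra.centralizer ℂ _
  rw [StarSubalgebra.mem_centralizer_iff]
  intro g hg
  rw [SetLike.mem_coe, StarSubalgebra.mem_centralizer_iff] at hg
  have h1 := hg _ ⟨h, rfl⟩
  have h2 : leftField q (toHU U (Cplx.ofReal h)) * g = g * leftField q (toHU U (Cplx.ofReal h)) :=
    h1.1
  refine ⟨h2.symm, ?_⟩
  have h3 := congrArg star h1.2
  rw [star_mul, star_mul, star_star] at h3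
  exact h3

/-- The generators are self-adjoint, so commuting with them already places y in the commutant. -/
theorem commute_of_mem_arakiWoods {x y : Fock q (HU U) →L[ℂ] Fock q (HU U)}
    (hx : x ∈ arakiWoods q U) (hy : ∀ h, leftField q (toHU U (Cplx.ofReal h)) * y =
      y * leftField q (toHU U (Cplx.ofReal h))) : x * y = y * x := by
  change _ ∈ StarSubalgebra.centralizer ℂ _ at hx
  rw [StarSubalgebra.mem_centralizer_iff] at hx
  refine ((hx y ?_).1).symm
  rw [SetLike.mem_coe, StarSubalgebra.mem_centralizer_iff]
  rintro _ ⟨h, rfl⟩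
  have h1 := hy h
  refine ⟨h1, ?_⟩
  have h2 : star (creation q (toHU U (Cplx.ofReal h)) + annihilation q (toHU U (Cplx.ofReal h))) =
    leftField q (toHU U (Cplx.ofReal h)) := star_leftField q _
  rw [h2]
  exact h1

/-- The vacuum vector is separating for the `q`-Araki-Woods algebra. -/
theorem eq_of_apply_vacuum_eq [CompleteSpace H] {x y : Fock q (HU U) →L[ℂ] Fock q (HU U)}
    (hx : x ∈ arakiWoods q U) (hy : y ∈ arakiWoods q U) (h : x (vacuum q) = y (vacuum q)) :
    x = y := by
  obtain ⟨η, hη, hd⟩ := exists_dense_symplectic_complement U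
  rw [← sub_eq_zero]
  refine eq_zero_of_commute_rightField q hd (fun i => ?_) (by rw [sub_apply, h, sub_self])
  have hc : ∀ h', leftField q (toHU U (Cplx.ofReal h')) * rightField q (η i) =
      rightField q (η i) * leftField q (toHU U (Cplx.ofReal h')) := fun h' =>
    leftField_commute_rightField q (by
      rw [inner_conj_symm, ← hη i h', inner_conj_symm])
  rw [sub_mul, mul_sub, commute_of_mem_arakiWoods q U hx hc, commute_of_mem_arakiWoods q U hy hc]

theorem wick_eq_of_mem [CompleteSpace H] {x : Fock q (HU U) →L[ℂ] Fock q (HU U)}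
    (hx : x ∈ arakiWoods q U) : wick q U (x (vacuum q)) = x := by
  have h : ∃ y, y ∈ arakiWoods q U ∧ y (vacuum q) = x (vacuum q) := ⟨x, hx, rfl⟩
  unfold wick
  rw [dif_pos h]
  exact eq_of_apply_vacuum_eq q U h.choose_spec.1 hx h.choose_spec.2

/-- The antilinearity of c* is compensated by the conjugation, so this expression is complex linear
in x and extends the field operators of real vectors. -/
theorem creation_add_annihilation_conj_mem (x : Cplx H) :
    creation q (toHU U x) + annihilation q (toHU U x.conj) ∈ arakiWoods q U := by
  have h : creation q (toHU U x) + annihilation q (toHU U x.conj) =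
      leftField q (toHU U (Cplx.ofReal x.re)) +
        Complex.I • leftField q (toHU U (Cplx.ofReal x.im)) := by
    rw [Cplx.conj_eq, sub_eq_add_neg, ← neg_smul]
    conv_lhs => rw [Cplx.eq_ofReal_add x]
    simp only [toHU_add, toHU_smul, creation_add, creation_smul, annihilation_add,
      annihilation_smul, leftField, smul_add, map_neg, Complex.conj_I, neg_neg]
    simp [Cplx.ofReal]
    abel
  rw [h]
  change _ ∈ (arakiWoods q U).toStarSubalgebra
  exact add_mem (leftField_mem_arakiWoods q U _)
    (SMulMemClass.smul_mem _ (leftField_mem_arakiWoods q U _))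

section

variable {K : Type*} [NormedAddCommGroup K] [InnerProductSpace ℂ K]

theorem creation_pow_tensor (ξ : K) (n : ℕ) (w : List K) :
    (creation q ξ ^ n) (tensor q w) = tensor q (List.replicate n ξ ++ w) := by
  induction n with
  | zero => simp
  | succ n ih => rw [pow_succ', mul_apply_eq_comp, ih, creation_tensor]; rfl

theorem annihilation_pow_vacuum (ξ : K) {n : ℕ} (hn : n ≠ 0) :
    (annihilation q ξ ^ n) (vacuum q) = 0 := by
  obtain ⟨n, rfl⟩ := Nat.exists_eq_succ_of_ne_zero hn
  rw [pow_succ, mul_apply_eq_comp, vacuum, annihilation_tensor_nil, map_zero]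

/-- Only the monomial free of annihilation operators survives on the vacuum, and its coefficient is
1. -/
theorem wickSum_vacuum (ξ η : K) (k m : ℕ) :
    wickSum (q : ℝ) (creation q ξ) (creation q η) (annihilation q ξ) (annihilation q η) k m
      (vacuum q) = tensor q (List.replicate k η ++ List.replicate m ξ) := by
  have hs : ∀ (p s : ℕ × ℕ), (p.2 ≠ 0 ∨ s.2 ≠ 0) → (creation q η ^ p.1 * creation q ξ ^ s.1 *
      annihilation q ξ ^ p.2 * annihilation q η ^ s.2) (vacuum q) = 0 := by
    intro p s h
    simp only [mul_apply_eq_comp]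
    by_cases h2 : s.2 = 0
    · rw [h2, pow_zero, one_apply_eq_self, annihilation_pow_vacuum q ξ (by tauto), map_zero, map_zero]
    · rw [annihilation_pow_vacuum q η h2, map_zero, map_zero, map_zero]
  rw [wickSum, sum_apply, Finset.sum_eq_single (k, 0)]
  · rw [smul_apply, sum_apply, Finset.sum_eq_single (m, 0)]
    · have := creation_pow_tensor q ξ m []
      rw [List.append_nil] at this
      simp only [pow_zero, mul_one, zero_mul, qBinom_self, Complex.ofReal_one, one_smul,
        mul_apply_eq_comp, vacuum]
      rw [this, creation_pow_tensor]
    · intro s hs' hne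
      have hs2 : s.2 ≠ 0 := by
        intro h0
        have := Finset.HasAntidiagonal.mem_antidiagonal.mp hs'
        exact hne (Prod.ext (by simp; omega) h0)
      rw [smul_apply, smul_apply, hs _ _ (Or.inr hs2), smul_zero, smul_zero]
    · intro h
      exact absurd (Finset.HasAntidiagonal.mem_antidiagonal.mpr (by simp)) h
  · intro p hp hne
    have hp2 : p.2 ≠ 0 := by
      intro h0
      have := Finset.HasAntidiagonal.mem_antidiagonal.mp hp
      exact hne (Prod.ext (by simp; omega) h0)
    rw [smul_apply, sum_apply, Finset.sum_eq_zero, smul_zero]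
    intro s _
    rw [smul_apply, smul_apply, hs _ _ (Or.inl hp2), smul_zero, smul_zero]
  · intro h
    exact absurd (Finset.HasAntidiagonal.mem_antidiagonal.mpr (by simp)) h

end

/-- The Wick formula for `ē^k e^m`, where `e` and `ē` are orthogonal. -/
theorem wick_replicate [CompleteSpace H] {e : Cplx H}
    (he : inner ℂ (toHU U e) (toHU U e.conj) = 0) (k m : ℕ) :
    wick q U (tensor q (List.replicate k (toHU U e.conj) ++ List.replicate m (toHU U e))) =
      wickSum (q : ℝ) (creation q (toHU U e)) (creation q (toHU U e.conj))
        (annihilation q (toHU U e)) (annihilation q (toHU U e.conj)) k m := by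
  rw [← wickSum_vacuum, wick_eq_of_mem]
  have h2 := creation_add_annihilation_conj_mem q U e.conj
  rw [Cplx.conj_conj] at h2
  -- The pairing is crossed: c(e) comes with c*(ē), and c(ē) with c*(e). Orthogonality of e and ē
  -- makes these crossed pairs q-commute without a scalar term.
  refine wickSum_mem (abs_lt.mpr q.2) (arakiWoods q U).toStarSubalgebra.toSubalgebra
    (creation_add_annihilation_conj_mem q U e) h2 (μ := inner ℂ (toHU U e) (toHU U e)) ?_ ?_ ?_ k m
  · rw [annihilation_mul_creation, ← inner_conj_symm, he]; simp
  · exact annihilation_mul_creation q _ _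
  · rw [annihilation_mul_creation, he]; simp

end WickAlgebra

/-! ### Bounds and limits of the q-products -/

section Constants

variable {q : ℝ} (hq : |q| < 1)

/-- The partial products of `constC`. -/
def cFin (q : ℝ) (n : ℕ) : ℝ := ∏ j ∈ Finset.range n, 1 / (1 - |q| ^ (j + 1))

include hq in
theorem one_sub_abs_pow_pos (n : ℕ) : 0 < 1 - |q| ^ (n + 1) := by
  have : |q| ^ (n + 1) < 1 := pow_lt_one₀ (abs_nonneg q) hq (Nat.succ_ne_zero n)
  linarith

theorem cFin_succ (n : ℕ) : cFin q (n + 1) = cFin q n * (1 / (1 - |q| ^ (n + 1))) :=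
  Finset.prod_range_succ _ _

include hq in
theorem one_le_factor (n : ℕ) : 1 ≤ 1 / (1 - |q| ^ (n + 1)) := by
  rw [le_div_iff₀ (one_sub_abs_pow_pos hq n)]
  have : 0 ≤ |q| ^ (n + 1) := by positivity
  linarith

include hq in
-- From (1+x)(1-x) ≤ 1. Hence the one constant C_q dominates products of factors 1 - q^j as well as
-- their inverses.
theorem one_add_le_factor (n : ℕ) : 1 + |q| ^ (n + 1) ≤ 1 / (1 - |q| ^ (n + 1)) := by
  rw [le_div_iff₀ (one_sub_abs_pow_pos hq n)]
  nlinarith [sq_nonneg (|q| ^ (n + 1))]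

include hq in
theorem one_le_cFin (n : ℕ) : 1 ≤ cFin q n := by
  induction n with
  | zero => simp [cFin]
  | succ n ih => rw [cFin_succ]; exact one_le_mul_of_one_le_of_one_le ih (one_le_factor hq n)

include hq in
theorem cFin_mono : Monotone (cFin q) := by
  refine monotone_nat_of_le_succ fun n => ?_
  rw [cFin_succ]
  exact le_mul_of_one_le_right (by linarith [one_le_cFin hq n]) (one_le_factor hq n)

include hq in
theorem cFin_le_constC (n : ℕ) : cFin q n ≤ constC q := by
  have h0 := abs_nonneg q
  have hs : Summable fun j : ℕ => |q| ^ (j + 1) / (1 - |q| ^ (j + 1)) := by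
    refine Summable.of_nonneg_of_le (fun j => div_nonneg (by positivity)
      (one_sub_abs_pow_pos hq j).le) (fun j => ?_)
      (((summable_geometric_of_lt_one h0 hq).mul_left |q|).mul_right (1 / (1 - |q|)))
    rw [← pow_succ', div_eq_mul_one_div]
    refine mul_le_mul_of_nonneg_left ?_ (by positivity)
    refine one_div_le_one_div_of_le (by linarith) ?_
    have : |q| ^ (j + 1) ≤ |q| := pow_le_of_le_one h0 hq.le (Nat.succ_ne_zero j)
    linarith
  have hm : Multipliable fun j : ℕ => 1 / (1 - |q| ^ (j + 1)) := by
    refine (Real.multipliable_one_add_of_summable hs).congr fun j => ?_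
    have := (one_sub_abs_pow_pos hq j).ne'
    field_simp
    ring
  exact (cFin_mono hq).ge_of_tendsto hm.hasProd.tendsto_prod_nat n

include hq in
theorem one_le_constC : 1 ≤ constC q := (one_le_cFin hq 0).trans (cFin_le_constC hq 0)

theorem dFin_eq_prod_range (n : ℕ) : dFin q n = ∏ j ∈ Finset.range n, (1 - q ^ (j + 1)) := by
  induction n with
  | zero => simp
  | succ n ih => rw [dFin_succ, ih, Finset.prod_range_succ]

include hq in
theorem tendsto_dFin : Tendsto (dFin q) atTop (𝓝 (dInf q)) := by
  have hs : Summable fun j : ℕ => -q ^ (j + 1) := by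
    simpa [pow_succ] using ((summable_geometric_of_abs_lt_one hq).mul_right q).neg
  have hm : Multipliable fun j : ℕ => 1 - q ^ (j + 1) :=
    (Real.multipliable_one_add_of_summable hs).congr fun j => by ring
  refine hm.hasProd.tendsto_prod_nat.congr fun n => ?_
  rw [dFin_eq_prod_range]

include hq in
theorem dFin_le_cFin (n : ℕ) : dFin q n ≤ cFin q n := by
  induction n with
  | zero => simp [cFin]
  | succ n ih =>
    rw [dFin_succ, cFin_succ]
    have h1 := neg_abs_le (q ^ (n + 1))
    rw [abs_pow] at h1
    refine mul_le_mul ih ?_ ?_ (by linarith [one_le_cFin hq n])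
    · exact le_trans (by linarith) (one_add_le_factor hq n)
    · have h2 := le_abs_self (q ^ (n + 1))
      rw [abs_pow] at h2
      linarith [one_sub_abs_pow_pos hq n]

include hq in
theorem dFin_le (n : ℕ) : dFin q n ≤ constC q := (dFin_le_cFin hq n).trans (cFin_le_constC hq n)

include hq in
theorem one_div_dFin_le (n : ℕ) : 1 / dFin q n ≤ constC q := by
  refine le_trans ?_ (cFin_le_constC hq n)
  induction n with
  | zero => simp [cFin]
  | succ n ih =>
    rw [dFin_succ, cFin_succ, one_div, mul_inv, ← one_div, ← one_div]
    have h2 := le_abs_self (q ^ (n + 1))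
    rw [abs_pow] at h2
    have h3 := one_sub_abs_pow_pos hq n
    refine mul_le_mul ih (one_div_le_one_div_of_le h3 (by linarith)) ?_
      (by linarith [one_le_cFin hq n])
    exact one_div_nonneg.mpr (by linarith)

include hq in
theorem dInf_pos : 0 < dInf q := by
  have hC : 0 < constC q := by linarith [one_le_constC hq]
  have h : 1 / constC q ≤ dInf q := by
    refine ge_of_tendsto' (tendsto_dFin hq) fun n => ?_
    have h1 := one_div_dFin_le hq n
    have h2 := dFin_pos hq n
    rw [div_le_iff₀ hC]
    rw [div_le_iff₀ h2] at h1
    linarith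
  exact lt_of_lt_of_le (by positivity) h

include hq in
theorem qBinom_eq {m i j : ℕ} (h : i + j = m) :
    qBinom q m i = dFin q m * (1 / dFin q i) * (1 / dFin q j) := by
  subst h
  rw [← qBinom_mul_dFin]
  have h1 := (dFin_pos hq i).ne'
  have h2 := (dFin_pos hq j).ne'
  field_simp

include hq in
theorem abs_qBinom_le {m i j : ℕ} (h : i + j = m) : |qBinom q m i| ≤ constC q ^ 3 := by
  have h0 := dFin_pos hq m
  have h1 := dFin_pos hq i
  have h2 := dFin_pos hq j
  have hC := one_le_constC hq
  rw [qBinom_eq hq h, abs_of_pos (by positivity)]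
  calc _ ≤ constC q * constC q * constC q := by
        gcongr
        · exact dFin_le hq m
        · exact one_div_dFin_le hq i
        · exact one_div_dFin_le hq j
    _ = _ := by ring

include hq in
theorem tendsto_qBinom (i : ℕ) :
    Tendsto (fun m => qBinom q m i) atTop (𝓝 (1 / dFin q i)) := by
  have h1 : Tendsto (fun m => dFin q m * (1 / dFin q i) * (1 / dFin q (m - i))) atTop
      (𝓝 (dInf q * (1 / dFin q i) * (1 / dInf q))) := by
    refine ((tendsto_dFin hq).mul_const _).mul ?_
    refine Tendsto.div tendsto_const_nhds ?_ (dInf_pos hq).ne'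
    exact (tendsto_dFin hq).comp (tendsto_sub_atTop_nat i)
  have h2 : dInf q * (1 / dFin q i) * (1 / dInf q) = 1 / dFin q i := by
    have := (dInf_pos hq).ne'
    field_simp
  rw [h2] at h1
  refine h1.congr' ?_
  filter_upwards [eventually_ge_atTop i] with m hm
  rw [qBinom_eq hq (show i + (m - i) = m by omega)]

end Constants

/-! ### Operator-valued q-products -/

section Products

variable {B : Type*} [NormedRing B] [NormedAlgebra ℂ B] [NormOneClass B]

/-- The product `∏_{j=1}^n (1 - c q^j X)`. -/
def qPoch (q : ℝ) (X : B) (c : ℂ) : ℕ → B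
  | 0 => 1
  | n + 1 => qPoch q X c n * (1 - (c * (q : ℂ) ^ (n + 1)) • X)

variable {q : ℝ} (hq : |q| < 1) {X : B} (hX : ‖X‖ ≤ 1) {c : ℂ} (hc : ‖c‖ ≤ 1)

theorem norm_ofReal_pow (q : ℝ) (n : ℕ) : ‖(q : ℂ) ^ n‖ = |q| ^ n := by
  rw [norm_pow, Complex.norm_real, Real.norm_eq_abs]

include hX hc in
theorem norm_factor_le (n : ℕ) : ‖(c * (q : ℂ) ^ n) • X‖ ≤ |q| ^ n := by
  rw [norm_smul, norm_mul, norm_ofReal_pow]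
  calc ‖c‖ * |q| ^ n * ‖X‖ ≤ 1 * |q| ^ n * 1 := by gcongr
    _ = _ := by ring

include hq hX hc in
theorem norm_qPoch_le_cFin (n : ℕ) : ‖qPoch q X c n‖ ≤ cFin q n := by
  induction n with
  | zero => simp [qPoch, cFin]
  | succ n ih =>
    rw [qPoch, cFin_succ]
    refine (norm_mul_le _ _).trans (mul_le_mul ih ?_ (norm_nonneg _) (by linarith [one_le_cFin hq n]))
    refine (norm_sub_le _ _).trans (le_trans ?_ (one_add_le_factor hq n))
    rw [norm_one]
    have := norm_factor_le (q := q) hX hc (n + 1)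
    linarith

include hq hX hc in
theorem norm_qPoch_le (n : ℕ) : ‖qPoch q X c n‖ ≤ constC q :=
  (norm_qPoch_le_cFin hq hX hc n).trans (cFin_le_constC hq n)

/-- Moving X past b^p multiplies it by q^p. This shift is why the product carries the parameter c.
-/
theorem qPoch_mul_pow {b : B} (h : X * b = (q : ℂ) • (b * X)) (n p : ℕ) :
    qPoch q X c n * b ^ p = b ^ p * qPoch q X (c * (q : ℂ) ^ p) n := by
  induction n with
  | zero => simp [qPoch]
  | succ n ih =>
    rw [qPoch, qPoch, mul_assoc, sub_mul, smul_mul_assoc, mul_pow_of_qcomm h, one_mul,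
      ← mul_assoc, ← ih, mul_assoc]
    congr 1
    rw [mul_sub, mul_one, mul_smul_comm, smul_smul]
    congr 2
    ring

include hq hX in
theorem cauchySeq_qPoch : CauchySeq (qPoch q X 1) := by
  refine cauchySeq_of_le_geometric |q| (constC q * |q|) hq fun n => ?_
  rw [dist_eq_norm, qPoch, mul_sub, mul_one, sub_sub_cancel]
  refine (norm_mul_le _ _).trans ?_
  rw [mul_assoc, ← pow_succ']
  exact mul_le_mul (norm_qPoch_le hq hX (by simp) n) (norm_factor_le hX (by simp) _)
    (norm_nonneg _) (by linarith [one_le_constC hq])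

include hq hX in
-- Each factor is inverted by a Neumann series with norm at most 1/(1 - |q|^j). The resulting bound
-- stays below C_q for every n, so invertibility passes to the limit.
theorem exists_qPoch_inverse [CompleteSpace B] (n : ℕ) : ∃ V : B, qPoch q X 1 n * V = 1 ∧
    V * qPoch q X 1 n = 1 ∧ ‖V‖ ≤ cFin q n := by
  induction n with
  | zero => exact ⟨1, by simp [qPoch, cFin]⟩
  | succ n ih =>
    obtain ⟨V, h1, h2, h3⟩ := ih
    set t : B := ((1 : ℂ) * (q : ℂ) ^ (n + 1)) • X with ht
    have hn : ‖t‖ ≤ |q| ^ (n + 1) := norm_factor_le hX (by simp) _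
    have hpos := one_sub_abs_pow_pos hq n
    obtain ⟨u, hu⟩ := isUnit_one_sub_of_norm_lt_one (x := t) (by linarith)
    have hu1 : (1 - t) * ↑u⁻¹ = 1 := by rw [← hu]; simp
    have hu2 : (↑u⁻¹ : B) * (1 - t) = 1 := by rw [← hu]; simp
    have hu3 : ‖(↑u⁻¹ : B)‖ ≤ 1 / (1 - |q| ^ (n + 1)) := by
      have h4 : (↑u⁻¹ : B) = 1 + t * ↑u⁻¹ := by
        rw [sub_mul, one_mul] at hu1
        rw [← hu1]; abel
      have h5 : ‖(↑u⁻¹ : B)‖ ≤ 1 + |q| ^ (n + 1) * ‖(↑u⁻¹ : B)‖ := by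
        conv_lhs => rw [h4]
        refine (norm_add_le _ _).trans ?_
        rw [norm_one]
        gcongr
        exact (norm_mul_le _ _).trans (by gcongr)
      rw [le_div_iff₀ hpos]
      linarith
    refine ⟨↑u⁻¹ * V, ?_, ?_, ?_⟩
    · rw [qPoch, ← ht, mul_assoc, ← mul_assoc (1 - t), hu1, one_mul, h1]
    · rw [qPoch, ← ht, mul_assoc, ← mul_assoc V, h2, one_mul, hu2]
    · rw [cFin_succ, mul_comm (cFin q n)]
      exact (norm_mul_le _ _).trans (mul_le_mul hu3 h3 (norm_nonneg _) (by positivity))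

include hq hX in
theorem exists_qPoch_limit [CompleteSpace B] : ∃ T V : B,
    Tendsto (qPoch q X 1) atTop (𝓝 T) ∧ T * V = 1 ∧ V * T = 1 ∧ ‖V‖ ≤ constC q ∧
      ‖T‖ ≤ constC q := by
  obtain ⟨T, hT⟩ := cauchySeq_tendsto_of_complete (cauchySeq_qPoch hq hX)
  choose V h1 h2 h3 using exists_qPoch_inverse hq hX
  have hC := one_le_constC hq
  have h3' : ∀ n, ‖V n‖ ≤ constC q := fun n => (h3 n).trans (cFin_le_constC hq n)
  have hcau : CauchySeq V := by
    rw [Metric.cauchySeq_iff]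
    intro ε hε
    obtain ⟨N, hN⟩ := Metric.cauchySeq_iff.mp (cauchySeq_qPoch hq hX) (ε / constC q ^ 2)
      (by positivity)
    refine ⟨N, fun m hm n hn => ?_⟩
    -- The resolvent identity: with a uniform bound on the inverses, they inherit the Cauchy
    -- property from the products.
    have h4 : V m - V n = V m * (qPoch q X 1 n - qPoch q X 1 m) * V n := by
      rw [mul_sub, h2, sub_mul, mul_assoc, h1, one_mul, mul_one]
    have h5 := hN n hn m hm
    rw [dist_eq_norm] at h5 ⊢
    rw [lt_div_iff₀ (by positivity)] at h5
    rw [h4]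
    calc _ ≤ ‖V m‖ * ‖qPoch q X 1 n - qPoch q X 1 m‖ * ‖V n‖ := norm_mul₃_le
      _ ≤ constC q * ‖qPoch q X 1 n - qPoch q X 1 m‖ * constC q := by
          gcongr
          · exact h3' m
          · exact h3' n
      _ = ‖qPoch q X 1 n - qPoch q X 1 m‖ * constC q ^ 2 := by ring
      _ < ε := h5
  obtain ⟨W, hW⟩ := cauchySeq_tendsto_of_complete hcau
  refine ⟨T, W, hT, ?_, ?_, ?_, ?_⟩
  · exact tendsto_nhds_unique (hT.mul hW) (tendsto_const_nhds.congr fun n => (h1 n).symm)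
  · exact tendsto_nhds_unique (hW.mul hT) (tendsto_const_nhds.congr fun n => (h2 n).symm)
  · exact le_of_tendsto' hW.norm h3'
  · exact le_of_tendsto' hT.norm fun n => norm_qPoch_le hq hX (by simp) n

end Products

/-! ### Powers of normalised q-oscillators -/

section Oscillator

variable {B : Type*} [CStarAlgebra B] [NormOneClass B]

/-- A normalised `q`-oscillator: `a* a = (1 - q) + q a a*` and `‖1 - a a*‖ ≤ 1`. -/
structure IsOscillator (q : ℝ) (a : B) : Prop where
  rel : star a * a = (1 - (q : ℂ)) • 1 + (q : ℂ) • (a * star a)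
  norm_le : ‖1 - a * star a‖ ≤ 1

variable {q : ℝ} (hq : |q| < 1) {a b : B}

namespace IsOscillator

variable (ha : IsOscillator q a)

include ha in
theorem star_mul_self : star a * a = 1 - (q : ℂ) • (1 - a * star a) := by
  rw [ha.rel]
  module

include ha in
theorem comm : (1 - a * star a) * a = (q : ℂ) • (a * (1 - a * star a)) := by
  rw [sub_mul, one_mul, mul_assoc, ha.star_mul_self]
  simp only [mul_sub, mul_smul_comm, smul_sub, mul_one]
  abel

include ha in
-- Replace the innermost a*a by 1 - qX and move X to the right through aⁿ, which multiplies it by qⁿ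
-- and gives the next factor 1 - q^{n+1} X.
theorem star_pow_mul_pow (n : ℕ) : star a ^ n * a ^ n = qPoch q (1 - a * star a) 1 n := by
  induction n with
  | zero => simp [qPoch]
  | succ n ih =>
    have h1 : star a ^ (n + 1) * a ^ (n + 1) = star a ^ n * (star a * a) * a ^ n := by
      rw [pow_succ, pow_succ']; simp only [mul_assoc]
    rw [h1, ha.star_mul_self, mul_assoc, sub_mul, one_mul, smul_mul_assoc,
      mul_pow_of_qcomm ha.comm, qPoch, ← ih, mul_assoc]
    simp only [mul_sub, mul_one, one_mul, mul_smul_comm, smul_smul, smul_sub, ← pow_succ']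

include ha in
theorem star_pow_mul_pow_of_le {m k : ℕ} (h : k ≤ m) :
    star a ^ k * a ^ m = qPoch q (1 - a * star a) 1 k * a ^ (m - k) := by
  rw [← ha.star_pow_mul_pow, mul_assoc, ← pow_add, Nat.add_sub_cancel' h]

include ha hq in
theorem norm_pow_sq_le (n : ℕ) : ‖a ^ n‖ ^ 2 ≤ constC q := by
  rw [sq, ← CStarRing.norm_star_mul_self, star_pow, ha.star_pow_mul_pow]
  exact norm_qPoch_le hq ha.norm_le (by simp) n

include ha hq in
theorem norm_pow_le (n : ℕ) : ‖a ^ n‖ ≤ constC q := by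
  have h := ha.norm_pow_sq_le hq n
  have hC := one_le_constC hq
  nlinarith [norm_nonneg (a ^ n)]

include ha hq in
theorem norm_star_pow_le (n : ℕ) : ‖star a ^ n‖ ≤ constC q := by
  rw [← star_pow, norm_star]
  exact ha.norm_pow_le hq n

end IsOscillator

theorem star_qcomm (hab : star a * b = (q : ℂ) • (b * star a)) :
    star b * a = (q : ℂ) • (a * star b) := by
  have h := congrArg star hab
  rw [star_mul, star_star, star_smul, star_mul, star_star, Complex.star_def, Complex.conj_ofReal] at h
  exact h

theorem pow_qcomm {x y : B} (h : x * y = (q : ℂ) • (y * x)) (k p : ℕ) :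
    x ^ k * y ^ p = (q : ℂ) ^ (k * p) • (y ^ p * x ^ k) := by
  induction k with
  | zero => simp
  | succ k ih =>
    rw [pow_succ, mul_assoc, mul_pow_of_qcomm h, mul_smul_comm, ← mul_assoc, ih, smul_mul_assoc,
      smul_smul, mul_assoc, ← pow_add]
    congr 2
    ring

/-- The remainder in `b*^n b^n a^m ≈ d_n a^m`. -/
theorem norm_qPoch_mul_pow_sub (hq : |q| < 1) (ha : IsOscillator q a) (hb : IsOscillator q b)
    (hab : star a * b = (q : ℂ) • (b * star a)) (n m : ℕ) :
    ‖qPoch q (1 - b * star b) 1 n * a ^ m - (dFin q n : ℂ) • a ^ m‖ ≤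
      cFin q n * (n * (constC q ^ 4 * |q| ^ m)) := by
  have hC := one_le_constC hq
  induction n with
  | zero => simp [qPoch]
  | succ n ih =>
    -- Since b* passes a^m at the cost of q^m, the operator 1 - bb* fixes a^m up to O(|q|^m). Each
    -- factor of the product therefore acts as the scalar 1 - q^{n+1} up to such an error, and the
    -- errors add up linearly in n.
    have hX : (1 - b * star b) * a ^ m = a ^ m - (q : ℂ) ^ m • (b * a ^ m * star b) := by
      rw [sub_mul, one_mul, mul_assoc, mul_pow_of_qcomm (star_qcomm hab), mul_smul_comm, mul_assoc]
    have h1 : qPoch q (1 - b * star b) 1 (n + 1) * a ^ m - (dFin q (n + 1) : ℂ) • a ^ m =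
        (1 - (q : ℂ) ^ (n + 1)) • (qPoch q (1 - b * star b) 1 n * a ^ m - (dFin q n : ℂ) • a ^ m) +
        ((q : ℂ) ^ (n + 1) * (q : ℂ) ^ m) •
          (qPoch q (1 - b * star b) 1 n * (b * a ^ m * star b)) := by
      rw [qPoch, mul_assoc, sub_mul, one_mul, smul_mul_assoc, hX, dFin_succ, one_mul]
      simp only [mul_sub, mul_smul_comm, smul_sub]
      push_cast
      module
    have h2 : ‖(1 - (q : ℂ) ^ (n + 1))‖ ≤ 1 / (1 - |q| ^ (n + 1)) := by
      refine (norm_sub_le _ _).trans (le_trans ?_ (one_add_le_factor hq n))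
      rw [norm_one, norm_ofReal_pow]
    have h3 : ‖((q : ℂ) ^ (n + 1) * (q : ℂ) ^ m) •
        (qPoch q (1 - b * star b) 1 n * (b * a ^ m * star b))‖ ≤ constC q ^ 4 * |q| ^ m := by
      rw [norm_smul, norm_mul, norm_ofReal_pow, norm_ofReal_pow]
      have h4 : |q| ^ (n + 1) ≤ 1 := pow_le_one₀ (abs_nonneg q) hq.le
      have h5 := norm_qPoch_le hq hb.norm_le (c := 1) (by simp) n
      have h6 : ‖b‖ ≤ constC q := by simpa using hb.norm_pow_le hq 1
      have h7 := ha.norm_pow_le hq m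
      calc _ ≤ |q| ^ (n + 1) * |q| ^ m *
            (‖qPoch q (1 - b * star b) 1 n‖ * (‖b‖ * ‖a ^ m‖ * ‖star b‖)) := by
            refine mul_le_mul_of_nonneg_left ((norm_mul_le _ _).trans ?_) (by positivity)
            exact mul_le_mul_of_nonneg_left norm_mul₃_le (norm_nonneg _)
        _ ≤ 1 * |q| ^ m * (constC q * (constC q * constC q * constC q)) := by
            rw [norm_star]; gcongr
        _ = _ := by ring
    rw [h1]
    refine (norm_add_le _ _).trans ?_
    rw [norm_smul]
    calc _ ≤ 1 / (1 - |q| ^ (n + 1)) * (cFin q n * (n * (constC q ^ 4 * |q| ^ m))) +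
          1 * (constC q ^ 4 * |q| ^ m) := by
            rw [one_mul]
            refine add_le_add ?_ h3
            exact mul_le_mul h2 ih (norm_nonneg _) ((norm_nonneg _).trans h2)
      _ ≤ 1 / (1 - |q| ^ (n + 1)) * (cFin q n * (n * (constC q ^ 4 * |q| ^ m))) +
          cFin q (n + 1) * (constC q ^ 4 * |q| ^ m) := by
            have := one_le_cFin hq (n + 1)
            gcongr
      _ = _ := by rw [cFin_succ]; push_cast; ring

theorem tendsto_star_pow_mul_pow_sub (hq : |q| < 1) (ha : IsOscillator q a)
    (hb : IsOscillator q b) (hab : star a * b = (q : ℂ) • (b * star a)) :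
    Tendsto (fun m => star b ^ m * b ^ m * a ^ m - (dFin q m : ℂ) • a ^ m) atTop (𝓝 0) := by
  have hC := one_le_constC hq
  have h := (tendsto_self_mul_const_pow_of_lt_one (abs_nonneg q) hq).const_mul
    (constC q * constC q ^ 4)
  rw [mul_zero] at h
  refine squeeze_zero_norm (fun m => ?_) h
  rw [hb.star_pow_mul_pow]
  refine (norm_qPoch_mul_pow_sub hq ha hb hab m m).trans ?_
  calc _ ≤ constC q * (m * (constC q ^ 4 * |q| ^ m)) := by
        gcongr
        exact cFin_le_constC hq m
    _ = _ := by ring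

end Oscillator

/-! ### Limits of the terms of the Wick expansion -/

section Limits

variable {B : Type*} [CStarAlgebra B] [NormOneClass B]
variable {q : ℝ} (hq : |q| < 1) {a b : B} (ha : IsOscillator q a) (hb : IsOscillator q b)
  (hab : star a * b = (q : ℂ) • (b * star a)) {r : ℝ} (hr0 : 0 < r) (hr1 : r < 1)

/-! ### The main contribution -/

/-- The terms of the series defining the limit. -/
def limitTerm (q r : ℝ) (a b T : B) (k : ℕ) : B :=
  ((dInf q / dFin q k * r ^ k : ℝ) : ℂ) • (b ^ k * T * a ^ k)

include hq ha hb hr0 in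
theorem norm_limitTerm_le {T : B} (hT : ‖T‖ ≤ constC q) (k : ℕ) :
    ‖limitTerm q r a b T k‖ ≤ dInf q * (constC q ^ 3 * r ^ k) := by
  have h1 := ha.norm_pow_sq_le hq k
  have h2 := hb.norm_pow_sq_le hq k
  have hC := one_le_constC hq
  have hd := dInf_pos hq
  have hdk := dFin_pos hq k
  -- Using the squared bounds ‖b^k‖², ‖a^k‖² ≤ C_q costs one factor C_q instead of two. The
  -- threshold (1 + C_q⁴)⁻² depends on this saving.
  have h3 : ‖b ^ k‖ * ‖a ^ k‖ ≤ constC q := by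
    refine abs_le_of_sq_le_sq' ?_ (by linarith) |>.2
    rw [mul_pow, sq (constC q)]
    exact mul_le_mul h2 h1 (sq_nonneg _) (by linarith)
  rw [limitTerm, norm_smul, Complex.norm_real, Real.norm_eq_abs, abs_of_pos (by positivity)]
  calc _ ≤ dInf q / dFin q k * r ^ k * (‖b ^ k‖ * ‖T‖ * ‖a ^ k‖) := by
        gcongr; exact norm_mul₃_le
    _ = dInf q * (1 / dFin q k) * r ^ k * (‖T‖ * (‖b ^ k‖ * ‖a ^ k‖)) := by ring
    _ ≤ dInf q * constC q * r ^ k * (constC q * constC q) := by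
        gcongr
        exact one_div_dFin_le hq k
    _ = _ := by ring

include hq ha hb hr0 hr1 in
theorem summable_limitTerm {T : B} (hT : ‖T‖ ≤ constC q) : Summable (limitTerm q r a b T) :=
  Summable.of_norm_bounded (((summable_geometric_of_lt_one hr0.le hr1).mul_left _).mul_left _)
    (norm_limitTerm_le hq ha hb hr0 hT)

/-- The contribution without the creation operators `a`. -/
def mainPart (q r : ℝ) (a b : B) (m : ℕ) : B :=
  ∑ i ∈ Finset.range (m + 1), ((qBinom q m i * r ^ i : ℝ) : ℂ) •
    (b ^ i * star a ^ (m - i) * star b ^ m * b ^ m * a ^ m)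

include hq ha hb hab hr0 hr1 in
-- For fixed i, b*^m b^m a^m may be replaced by d_m a^m, then a*^{m-i} a^m = (a*^{m-i} a^{m-i}) aⁱ →
-- T aⁱ, while the binomial tends to 1/dᵢ. The weight rⁱ gives a summable majorant.
theorem tendsto_mainPart {T : B} (hT : Tendsto (qPoch q (1 - a * star a) 1) atTop (𝓝 T)) :
    Tendsto (mainPart q r a b) atTop (𝓝 (∑' k, limitTerm q r a b T k)) := by
  have hC := one_le_constC hq
  let f : ℕ → ℕ → B := fun m i => if i < m + 1 then ((qBinom q m i * r ^ i : ℝ) : ℂ) •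
    (b ^ i * star a ^ (m - i) * star b ^ m * b ^ m * a ^ m) else 0
  have hf : ∀ m, mainPart q r a b m = ∑' i, f m i := by
    intro m
    rw [tsum_eq_sum (s := Finset.range (m + 1)) fun i hi => if_neg (by simpa using hi)]
    exact Finset.sum_congr rfl fun i hi => (if_pos (Finset.mem_range.mp hi)).symm
  refine (tendsto_congr hf).mpr ?_
  refine tendsto_tsum_of_dominated_convergence (bound := fun i => constC q ^ 8 * r ^ i)
    ((summable_geometric_of_lt_one hr0.le hr1).mul_left _) (fun i => ?_)
    (Eventually.of_forall fun m i => ?_)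
  · have h1 : Tendsto (fun m => star a ^ (m - i) *
        (star b ^ m * b ^ m * a ^ m - (dFin q m : ℂ) • a ^ m)) atTop (𝓝 0) := by
      have h2 := (tendsto_star_pow_mul_pow_sub hq ha hb hab).norm.const_mul (constC q)
      rw [norm_zero, mul_zero] at h2
      refine squeeze_zero_norm (fun m => ?_) h2
      exact (norm_mul_le _ _).trans
        (mul_le_mul_of_nonneg_right (ha.norm_star_pow_le hq _) (norm_nonneg _))
    have h3 : Tendsto (fun m => (dFin q m : ℂ) • (star a ^ (m - i) * a ^ m)) atTop
        (𝓝 ((dInf q : ℂ) • (T * a ^ i))) := by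
      refine Tendsto.smul ((Complex.continuous_ofReal.tendsto _).comp (tendsto_dFin hq)) ?_
      refine Tendsto.congr' ?_ ((hT.comp (tendsto_sub_atTop_nat i)).mul_const (a ^ i))
      filter_upwards [eventually_ge_atTop i] with m hm
      rw [ha.star_pow_mul_pow_of_le (Nat.sub_le m i), Nat.sub_sub_self hm]
      rfl
    have h4 := h1.add h3
    rw [zero_add] at h4
    have h5 := (((Complex.continuous_ofReal.tendsto _).comp
      ((tendsto_qBinom hq i).mul_const (r ^ i)))).smul (h4.const_mul (b ^ i))
    have h6 : ((1 / dFin q i * r ^ i : ℝ) : ℂ) • (b ^ i * ((dInf q : ℂ) • (T * a ^ i))) =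
        limitTerm q r a b T i := by
      rw [limitTerm, mul_smul_comm, smul_smul, mul_assoc]
      congr 1
      push_cast
      ring
    rw [h6] at h5
    refine h5.congr' ?_
    filter_upwards [eventually_ge_atTop i] with m hm
    simp only [f]
    rw [if_pos (by omega)]
    simp only [Function.comp]
    congr 1
    simp only [mul_sub, mul_smul_comm, mul_assoc, sub_add_cancel]
  · simp only [f]
    split_ifs with h
    · rw [norm_smul, Complex.norm_real, Real.norm_eq_abs, abs_mul, abs_of_pos (pow_pos hr0 i)]
      have h1 := abs_qBinom_le hq (show i + (m - i) = m by omega)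
      have h2 : ‖b ^ i * star a ^ (m - i) * star b ^ m * b ^ m * a ^ m‖ ≤ constC q ^ 5 := by
        calc _ ≤ ‖b ^ i‖ * ‖star a ^ (m - i)‖ * ‖star b ^ m‖ * ‖b ^ m‖ * ‖a ^ m‖ := by
              refine (norm_mul_le _ _).trans ?_
              gcongr
              refine (norm_mul_le _ _).trans ?_
              gcongr
              exact norm_mul₃_le
          _ ≤ constC q * constC q * constC q * constC q * constC q := by
              gcongr
              · exact hb.norm_pow_le hq _
              · exact ha.norm_star_pow_le hq _
              · exact hb.norm_star_pow_le hq _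
              · exact hb.norm_pow_le hq _
              · exact ha.norm_pow_le hq _
          _ = _ := by ring
      calc _ ≤ constC q ^ 3 * r ^ i * constC q ^ 5 := by gcongr
        _ = _ := by ring
    · rw [norm_zero]; positivity

/-! ### The contribution of the mixed terms -/

include hr0 hr1 in
-- Write K = k+1 and J = j+1, so i + K = m. If J ≤ i, the total exponent KJ + i - J equals m - 1 +
-- (K-1)(J-1) ≥ m - 1. If J = i + P with P ≥ 1, then KJ = mP + i(m - J) ≥ mP, and s^{mP} beats
-- r^{-P} as soon as s^m ≤ r.
theorem mixed_weight_le {s : ℝ} (hs0 : 0 ≤ s) {τ : ℝ} (hsτ : s ≤ τ) (hrτ : r ≤ τ) (hτ : τ ≤ 1)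
    {m : ℕ} (hm : s ^ m ≤ r) {i j k : ℕ} (hik : i + (k + 1) = m) (hj : j + 1 ≤ m) :
    s ^ ((k + 1) * (j + 1)) * (r ^ i / r ^ (j + 1)) ≤ τ ^ (m - 1) + s ^ m / r := by
  have hτ0 : 0 ≤ τ := hs0.trans hsτ
  rcases le_or_gt (j + 1) i with h | h
  · have h1 : r ^ i / r ^ (j + 1) = r ^ (i - (j + 1)) := by
      rw [div_eq_iff (by positivity), ← pow_add, Nat.sub_add_cancel h]
    rw [h1]
    have h2 : m - 1 ≤ (k + 1) * (j + 1) + (i - (j + 1)) := by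
      have : (k + 1) * (j + 1) = k * j + k + j + 1 := by ring
      have h3 := Nat.zero_le (k * j)
      omega
    calc _ ≤ τ ^ ((k + 1) * (j + 1)) * τ ^ (i - (j + 1)) := by gcongr
      _ = τ ^ ((k + 1) * (j + 1) + (i - (j + 1))) := (pow_add _ _ _).symm
      _ ≤ τ ^ (m - 1) := pow_le_pow_of_le_one hτ0 hτ h2
      _ ≤ _ := le_add_of_nonneg_right (by positivity)
  · obtain ⟨p, hp⟩ : ∃ p, j + 1 = i + (p + 1) := ⟨j - i, by omega⟩
    have h1 : r ^ i / r ^ (j + 1) = 1 / r ^ (p + 1) := by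
      rw [hp, pow_add]
      field_simp
    have h2 : m * (p + 1) ≤ (k + 1) * (j + 1) := by
      rw [hp, ← hik]
      have h3 : p + 1 ≤ k + 1 := by omega
      nlinarith
    have hs1 : s ≤ 1 := hsτ.trans hτ
    rw [h1]
    calc _ ≤ s ^ (m * (p + 1)) * (1 / r ^ (p + 1)) := by
          refine mul_le_mul_of_nonneg_right (pow_le_pow_of_le_one hs0 hs1 h2) (by positivity)
      _ = (s ^ m / r) ^ (p + 1) := by rw [pow_mul, div_pow]; ring
      _ ≤ s ^ m / r := pow_le_of_le_one (by positivity)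
          ((div_le_one hr0).mpr hm) (Nat.succ_ne_zero p)
      _ ≤ _ := le_add_of_nonneg_left (by positivity)

/-- A term of the Wick expansion. -/
def wickTerm (q r : ℝ) (a b : B) (m i k j l : ℕ) : B :=
  ((qBinom q m i * qBinom q m j * q ^ (k * j) * (r ^ i / r ^ j) : ℝ) : ℂ) •
    (b ^ i * a ^ j * star a ^ k * star b ^ l * b ^ m * a ^ m)

include hq ha hb hr0 in
theorem norm_wickTerm_le {m i k j l : ℕ} (hik : i + k = m) (hjl : j + l = m) :
    ‖wickTerm q r a b m i k j l‖ ≤ constC q ^ 12 * (|q| ^ (k * j) * (r ^ i / r ^ j)) := by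
  have hC := one_le_constC hq
  rw [wickTerm, norm_smul, Complex.norm_real, Real.norm_eq_abs, abs_mul, abs_mul, abs_mul, abs_pow,
    abs_of_pos (show 0 < r ^ i / r ^ j by positivity)]
  have h1 := abs_qBinom_le hq hik
  have h2 := abs_qBinom_le hq hjl
  have h3 : ‖b ^ i * a ^ j * star a ^ k * star b ^ l * b ^ m * a ^ m‖ ≤ constC q ^ 6 := by
    calc _ ≤ ‖b ^ i‖ * ‖a ^ j‖ * ‖star a ^ k‖ * ‖star b ^ l‖ * ‖b ^ m‖ * ‖a ^ m‖ := by
          refine (norm_mul_le _ _).trans ?_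
          gcongr
          refine (norm_mul_le _ _).trans ?_
          gcongr
          refine (norm_mul_le _ _).trans ?_
          gcongr
          exact norm_mul₃_le
      _ ≤ constC q * constC q * constC q * constC q * constC q * constC q := by
          gcongr
          · exact hb.norm_pow_le hq _
          · exact ha.norm_pow_le hq _
          · exact ha.norm_star_pow_le hq _
          · exact hb.norm_star_pow_le hq _
          · exact hb.norm_pow_le hq _
          · exact ha.norm_pow_le hq _
      _ = _ := by ring
  calc _ ≤ constC q ^ 3 * constC q ^ 3 * |q| ^ (k * j) * (r ^ i / r ^ j) * constC q ^ 6 := by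
        gcongr
    _ = _ := by ring

/-- The contribution of the mixed terms of the Wick expansion of degree `n + 1`. -/
def mixedPart (q r : ℝ) (a b : B) (n : ℕ) : B :=
  ∑ p ∈ Finset.HasAntidiagonal.antidiagonal n, ∑ s ∈ Finset.HasAntidiagonal.antidiagonal n,
    wickTerm q r a b (n + 1) p.1 (p.2 + 1) (s.1 + 1) s.2

include hq ha hb hr0 hr1 in
-- There are (n+1)² terms, each exponentially small by `mixed_weight_le` once |q|^{n+1} ≤ r.
theorem tendsto_mixedPart : Tendsto (mixedPart q r a b) atTop (𝓝 0) := by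
  have hC := one_le_constC hq
  set τ := max |q| r with hτ
  have hτ1 : τ < 1 := max_lt hq hr1
  have hτ0 : 0 ≤ τ := (abs_nonneg q).trans (le_max_left _ _)
  have h1 : ∀ᶠ n : ℕ in atTop, |q| ^ (n + 1) ≤ r := by
    have := (tendsto_pow_atTop_nhds_zero_of_lt_one (abs_nonneg q) hq).comp (tendsto_add_atTop_nat 1)
    exact (this.eventually (gt_mem_nhds hr0)).mono fun n hn => le_of_lt hn
  have hlim : Tendsto (fun n : ℕ => constC q ^ 12 * (((n : ℝ) + 1) ^ 2 *
      (τ ^ n + |q| ^ (n + 1) / r))) atTop (𝓝 0) := by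
    have h2 : ∀ x : ℝ, 0 ≤ x → x < 1 →
        Tendsto (fun n : ℕ => ((n : ℝ) + 1) ^ 2 * x ^ n) atTop (𝓝 0) := by
      intro x hx0 hx1
      have e2 := tendsto_pow_const_mul_const_pow_of_lt_one 2 hx0 hx1
      have e1 := (tendsto_self_mul_const_pow_of_lt_one hx0 hx1).const_mul 2
      have e0 := tendsto_pow_atTop_nhds_zero_of_lt_one hx0 hx1
      have e := (e2.add e1).add e0
      rw [mul_zero, add_zero, add_zero] at e
      refine e.congr fun n => ?_
      ring
    have h3 := ((h2 τ hτ0 hτ1).add ((h2 |q| (abs_nonneg q) hq).mul_const (|q| / r))).const_mul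
      (constC q ^ 12)
    rw [zero_mul, add_zero, mul_zero] at h3
    refine h3.congr fun n => ?_
    rw [pow_succ |q|]
    ring
  refine squeeze_zero_norm' ?_ hlim
  filter_upwards [h1] with n hn
  have hterm : ∀ p ∈ Finset.HasAntidiagonal.antidiagonal n,
      ∀ s ∈ Finset.HasAntidiagonal.antidiagonal n,
      ‖wickTerm q r a b (n + 1) p.1 (p.2 + 1) (s.1 + 1) s.2‖ ≤
        constC q ^ 12 * (τ ^ n + |q| ^ (n + 1) / r) := by
    intro p hp s hs
    rw [Finset.HasAntidiagonal.mem_antidiagonal] at hp hs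
    refine (norm_wickTerm_le hq ha hb hr0 (by omega) (by omega)).trans ?_
    refine mul_le_mul_of_nonneg_left ?_ (by positivity)
    exact mixed_weight_le hr0 hr1 (abs_nonneg q) (le_max_left _ _) (le_max_right _ _) hτ1.le hn
      (by omega) (by omega)
  calc ‖mixedPart q r a b n‖ ≤ ∑ p ∈ Finset.HasAntidiagonal.antidiagonal n,
        ∑ s ∈ Finset.HasAntidiagonal.antidiagonal n,
          constC q ^ 12 * (τ ^ n + |q| ^ (n + 1) / r) := by
        refine (norm_sum_le _ _).trans (Finset.sum_le_sum fun p hp => ?_)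
        exact (norm_sum_le _ _).trans (Finset.sum_le_sum fun s hs => hterm p hp s hs)
    _ = _ := by
        rw [Finset.sum_const, Finset.sum_const, Finset.Nat.card_antidiagonal]
        simp only [nsmul_eq_mul]
        push_cast
        ring

end Limits

/-! ### Sums of almost orthogonal elements -/

theorem sum_range_pow_dist_le {ρ : ℝ} (h0 : 0 ≤ ρ) (h1 : ρ < 1) {s N : ℕ} (hs : s < N) :
    ∑ t ∈ Finset.range N, ρ ^ (Nat.dist s t) ≤ 2 / (1 - ρ) := by
  have hg : ∀ n, ∑ t ∈ Finset.range n, ρ ^ t ≤ 1 / (1 - ρ) := fun n => by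
    rw [one_div, ← tsum_geometric_of_lt_one h0 h1]
    exact (summable_geometric_of_lt_one h0 h1).sum_le_tsum _ fun _ _ => by positivity
  have h2 : ∑ t ∈ Finset.range s, ρ ^ (Nat.dist s t) ≤ ∑ t ∈ Finset.range (s + 1), ρ ^ t := by
    rw [← Finset.sum_range_reflect (fun t => ρ ^ t), Finset.sum_range_succ]
    have : ∑ t ∈ Finset.range s, ρ ^ (Nat.dist s t) =
        ∑ t ∈ Finset.range s, ρ ^ (s + 1 - 1 - t) :=
      Finset.sum_congr rfl fun t ht => by
        rw [Nat.dist_eq_sub_of_le_right (Finset.mem_range.mp ht).le, Nat.add_sub_cancel]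
    rw [this]
    exact le_add_of_nonneg_right (by positivity)
  have h3 : ∑ t ∈ Finset.Ico s N, ρ ^ (Nat.dist s t) = ∑ t ∈ Finset.range (N - s), ρ ^ t := by
    rw [Finset.sum_Ico_eq_sum_range]
    exact Finset.sum_congr rfl fun t _ => by
      rw [Nat.dist_eq_sub_of_le (Nat.le_add_right s t), Nat.add_sub_cancel_left]
  rw [← Finset.sum_range_add_sum_Ico _ hs.le, h3]
  calc _ ≤ 1 / (1 - ρ) + 1 / (1 - ρ) := add_le_add (h2.trans (hg _)) (hg _)
    _ = _ := by ring

/-- In the expansion of the C*-identity the term (s, t) decays like ρ^{|s-t|}, so only a band around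
the diagonal matters. The squared norm then grows like N instead of N². -/
theorem norm_sum_mul_sq_le {B : Type*} [CStarAlgebra B] {P Q : ℕ → B} {ρ c D : ℝ} (h0 : 0 ≤ ρ)
    (h1 : ρ < 1) (hD : 0 ≤ D) (hP : ∀ t p, ‖star (P t) * P (t + p)‖ ≤ D * ρ ^ p)
    (hQ : ∀ t, ‖Q t‖ ≤ c) (N : ℕ) :
    ‖∑ t ∈ Finset.range N, P t * Q t‖ ^ 2 ≤ c ^ 2 * D * (2 / (1 - ρ)) * N := by
  have hc : 0 ≤ c := (norm_nonneg _).trans (hQ 0)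
  have hdist : ∀ s t, ‖star (P s) * P t‖ ≤ D * ρ ^ (Nat.dist s t) := by
    intro s t
    rcases le_total s t with h | h
    · obtain ⟨p, rfl⟩ := Nat.exists_eq_add_of_le h
      rw [Nat.dist_eq_sub_of_le h, Nat.add_sub_cancel_left]
      exact hP s p
    · obtain ⟨p, rfl⟩ := Nat.exists_eq_add_of_le h
      rw [Nat.dist_eq_sub_of_le_right h, Nat.add_sub_cancel_left, ← norm_star, star_mul, star_star]
      exact hP t p
  have hterm : ∀ s t, ‖star (P s * Q s) * (P t * Q t)‖ ≤ c ^ 2 * D * ρ ^ (Nat.dist s t) := by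
    intro s t
    have e : star (P s * Q s) * (P t * Q t) = star (Q s) * (star (P s) * P t) * Q t := by
      rw [star_mul]; simp only [mul_assoc]
    rw [e]
    calc _ ≤ ‖star (Q s)‖ * ‖star (P s) * P t‖ * ‖Q t‖ := norm_mul₃_le
      _ ≤ c * (D * ρ ^ (Nat.dist s t)) * c := by
          gcongr
          · rw [norm_star]; exact hQ s
          · exact hdist s t
          · exact hQ t
      _ = _ := by ring
  rw [sq, ← CStarRing.norm_star_mul_self, star_sum, Finset.sum_mul_sum]
  calc _ ≤ ∑ s ∈ Finset.range N, ∑ t ∈ Finset.range N, c ^ 2 * D * ρ ^ (Nat.dist s t) :=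
        (norm_sum_le _ _).trans (Finset.sum_le_sum fun s _ =>
          (norm_sum_le _ _).trans (Finset.sum_le_sum fun t _ => hterm s t))
    _ ≤ ∑ s ∈ Finset.range N, c ^ 2 * D * (2 / (1 - ρ)) := by
        refine Finset.sum_le_sum fun s hs => ?_
        rw [← Finset.mul_sum]
        exact mul_le_mul_of_nonneg_left
          (sum_range_pow_dist_le h0 h1 (Finset.mem_range.mp hs)) (by positivity)
    _ = _ := by
        rw [Finset.sum_const, Finset.card_range, nsmul_eq_mul]
        ring

section Limits

variable {B : Type*} [CStarAlgebra B] [NormOneClass B]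
variable {q : ℝ} (hq : |q| < 1) {a b : B} (ha : IsOscillator q a) (hb : IsOscillator q b)
  (hab : star a * b = (q : ℂ) • (b * star a)) {r : ℝ} (hr0 : 0 < r) (hr1 : r < 1)

/-! ### The contribution of the terms with all creation operators -/

include hq ha hb hab in
-- The common powers of b collapse to a bounded q-product, leaving b^p between a*^{t+1} and the
-- rest. Exchanging a*^{t+1} with b^p produces q^{(t+1)p}.
theorem norm_star_pow_mul_pow_le (l t p : ℕ) :
    ‖star (b ^ (l + t + 1) * a ^ (t + 1)) * (b ^ (l + (t + p) + 1) * a ^ (t + p + 1))‖ ≤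
      constC q ^ 4 * |q| ^ p := by
  have hC := one_le_constC hq
  have e : star (b ^ (l + t + 1) * a ^ (t + 1)) * (b ^ (l + (t + p) + 1) * a ^ (t + p + 1)) =
      ((q : ℂ) ^ ((t + 1) * p)) • (b ^ p * star a ^ (t + 1) *
        qPoch q (1 - b * star b) (1 * (q : ℂ) ^ p) (l + t + 1) * a ^ (t + p + 1)) := by
    rw [star_mul, star_pow, star_pow, ← mul_assoc, mul_assoc (star a ^ (t + 1)),
      hb.star_pow_mul_pow_of_le (by omega), show l + (t + p) + 1 - (l + t + 1) = p by omega,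
      qPoch_mul_pow hb.comm, ← mul_assoc (star a ^ (t + 1)), pow_qcomm hab]
    simp only [smul_mul_assoc]
  rw [e, norm_smul, norm_pow, Complex.norm_real, Real.norm_eq_abs]
  have h1 : |q| ^ ((t + 1) * p) ≤ |q| ^ p :=
    pow_le_pow_of_le_one (abs_nonneg q) hq.le (Nat.le_mul_of_pos_left p (Nat.succ_pos t))
  have h2 : ‖qPoch q (1 - b * star b) (1 * (q : ℂ) ^ p) (l + t + 1)‖ ≤ constC q := by
    refine norm_qPoch_le hq hb.norm_le ?_ _
    rw [one_mul, norm_pow, Complex.norm_real, Real.norm_eq_abs]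
    exact pow_le_one₀ (abs_nonneg q) hq.le
  have h3 : ‖b ^ p * star a ^ (t + 1) *
        qPoch q (1 - b * star b) (1 * (q : ℂ) ^ p) (l + t + 1) * a ^ (t + p + 1)‖ ≤
      constC q ^ 4 := by
    calc _ ≤ ‖b ^ p‖ * ‖star a ^ (t + 1)‖ *
          ‖qPoch q (1 - b * star b) (1 * (q : ℂ) ^ p) (l + t + 1)‖ * ‖a ^ (t + p + 1)‖ := by
          refine (norm_mul_le _ _).trans ?_
          gcongr
          exact norm_mul₃_le
      _ ≤ constC q * constC q * constC q * constC q := by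
          gcongr
          · exact hb.norm_pow_le hq _
          · exact ha.norm_star_pow_le hq _
          · exact ha.norm_pow_le hq _
      _ = _ := by ring
  calc _ ≤ |q| ^ p * constC q ^ 4 := by gcongr
    _ = _ := mul_comm _ _

/-- The contribution without the annihilation operators `star a`, in degree `n + 1`. -/
def creationPart (q r : ℝ) (a b : B) (n : ℕ) : B :=
  ∑ s ∈ Finset.HasAntidiagonal.antidiagonal n, wickTerm q r a b (n + 1) (n + 1) 0 (s.1 + 1) s.2

theorem wickTerm_creation (hr0 : 0 < r) (l t : ℕ) :
    wickTerm q r a b (l + t + 1) (l + t + 1) 0 (t + 1) l =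
      ((r ^ l : ℝ) : ℂ) • (b ^ (l + t + 1) * a ^ (t + 1) *
        ((qBinom q (l + t + 1) (t + 1) : ℂ) •
          (star b ^ l * b ^ (l + t + 1) * a ^ (l + t + 1)))) := by
  have h2 : r ^ (l + t + 1) / r ^ (t + 1) = r ^ l := by
    rw [div_eq_iff (by positivity), ← pow_add, add_assoc]
  rw [wickTerm, qBinom_self, h2, mul_smul_comm, smul_smul]
  simp only [zero_mul, pow_zero, mul_one, one_mul, mul_assoc]
  congr 1
  push_cast
  ring

/-- Regrouping by the exponent l of b* makes the weight r^l constant in each inner sum, which runs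
over degrees l + t + 1 ≤ N and has the almost orthogonal left factors b^{l+t+1} a^{t+1}. -/
theorem sum_creationPart (hr0 : 0 < r) (N : ℕ) :
    ∑ n ∈ Finset.range N, creationPart q r a b n = ∑ l ∈ Finset.range N, ((r ^ l : ℝ) : ℂ) •
      ∑ t ∈ Finset.range (N - l), b ^ (l + t + 1) * a ^ (t + 1) *
        ((qBinom q (l + t + 1) (t + 1) : ℂ) •
          (star b ^ l * b ^ (l + t + 1) * a ^ (l + t + 1))) := by
  have h1 : ∀ n, creationPart q r a b n = ∑ l ∈ Finset.range (n + 1),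
      wickTerm q r a b (n + 1) (n + 1) 0 (n - l + 1) l := by
    intro n
    rw [creationPart, ← Finset.Nat.sum_antidiagonal_swap,
      Finset.Nat.sum_antidiagonal_eq_sum_range_succ_mk]
    rfl
  rw [Finset.sum_congr rfl fun n _ => h1 n, Finset.sum_comm' (t' := Finset.range N)
    (s' := fun l => Finset.Ico l N) (by intro n l; simp only [Finset.mem_range, Finset.mem_Ico]; omega)]
  refine Finset.sum_congr rfl fun l _ => ?_
  rw [Finset.sum_Ico_eq_sum_range, Finset.smul_sum]
  refine Finset.sum_congr rfl fun t _ => ?_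
  rw [Nat.add_sub_cancel_left, wickTerm_creation hr0]

include hq ha hb hab hr0 hr1 in
-- For fixed l the weight r^l gives no decay in the degree, and averaging replaces it. Almost
-- orthogonality bounds each inner sum by K√N uniformly in l, and the geometric series in r^l sums
-- these bounds.
theorem tendsto_cesaro_creationPart :
    Tendsto (fun N : ℕ => (1 / (N : ℂ)) • ∑ n ∈ Finset.range N, creationPart q r a b n)
      atTop (𝓝 0) := by
  have hC := one_le_constC hq
  have hq' : 0 < 1 - |q| := by linarith
  set K : ℝ := √((constC q ^ 6) ^ 2 * constC q ^ 4 * (2 / (1 - |q|))) with hK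
  have hl : ∀ N l : ℕ, ‖∑ t ∈ Finset.range (N - l), b ^ (l + t + 1) * a ^ (t + 1) *
        ((qBinom q (l + t + 1) (t + 1) : ℂ) •
          (star b ^ l * b ^ (l + t + 1) * a ^ (l + t + 1)))‖ ≤ K * √N := by
    intro N l
    have h1 := norm_sum_mul_sq_le (P := fun t => b ^ (l + t + 1) * a ^ (t + 1))
      (Q := fun t => (qBinom q (l + t + 1) (t + 1) : ℂ) •
          (star b ^ l * b ^ (l + t + 1) * a ^ (l + t + 1))) (c := constC q ^ 6)
      (abs_nonneg q) hq (by positivity) (norm_star_pow_mul_pow_le hq ha hb hab l)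
      (fun t => by
        rw [norm_smul, Complex.norm_real, Real.norm_eq_abs]
        have e1 := abs_qBinom_le hq (show t + 1 + l = l + t + 1 by omega)
        calc _ ≤ constC q ^ 3 * (‖star b ^ l‖ * ‖b ^ (l + t + 1)‖ * ‖a ^ (l + t + 1)‖) := by
              gcongr
              exact norm_mul₃_le
          _ ≤ constC q ^ 3 * (constC q * constC q * constC q) := by
              gcongr
              · exact hb.norm_star_pow_le hq _
              · exact hb.norm_pow_le hq _
              · exact ha.norm_pow_le hq _
          _ = _ := by ring) (N - l)
    rw [hK, ← Real.sqrt_mul (by positivity)]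
    refine Real.le_sqrt_of_sq_le (h1.trans ?_)
    gcongr
    exact Nat.sub_le N l
  have hlim : Tendsto (fun N : ℕ => K / (1 - r) * (1 / √(N : ℝ))) atTop (𝓝 0) := by
    have := (tendsto_const_nhds (x := (1 : ℝ))).div_atTop
      (Real.tendsto_sqrt_atTop.comp tendsto_natCast_atTop_atTop)
    simpa using this.const_mul (K / (1 - r))
  refine squeeze_zero_norm (fun N => ?_) hlim
  rw [norm_smul, sum_creationPart hr0, norm_div, norm_one, Complex.norm_natCast]
  have h2 : ‖∑ l ∈ Finset.range N, ((r ^ l : ℝ) : ℂ) •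
      ∑ t ∈ Finset.range (N - l), b ^ (l + t + 1) * a ^ (t + 1) *
        ((qBinom q (l + t + 1) (t + 1) : ℂ) •
          (star b ^ l * b ^ (l + t + 1) * a ^ (l + t + 1)))‖ ≤ 1 / (1 - r) * (K * √N) := by
    calc _ ≤ ∑ l ∈ Finset.range N, r ^ l * (K * √N) := by
          refine (norm_sum_le _ _).trans (Finset.sum_le_sum fun l _ => ?_)
          rw [norm_smul, Complex.norm_real, Real.norm_eq_abs, abs_of_pos (pow_pos hr0 l)]
          exact mul_le_mul_of_nonneg_left (hl N l) (by positivity)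
      _ ≤ _ := by
          rw [← Finset.sum_mul]
          refine mul_le_mul_of_nonneg_right ?_ (by positivity)
          rw [one_div, ← tsum_geometric_of_lt_one hr0.le hr1]
          exact (summable_geometric_of_lt_one hr0.le hr1).sum_le_tsum _ fun _ _ => by positivity
  calc _ ≤ 1 / (N : ℝ) * (1 / (1 - r) * (K * √N)) := by gcongr
    _ = K / (1 - r) * (√N / N) := by ring
    _ = _ := by rw [Real.sqrt_div_self']

/-! ### The Cesàro limit -/

/-- The Wick expansion of degree `m`, times `b ^ m * a ^ m`. -/
def wickPart (q r : ℝ) (a b : B) (m : ℕ) : B :=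
  ∑ p ∈ Finset.HasAntidiagonal.antidiagonal m, ∑ s ∈ Finset.HasAntidiagonal.antidiagonal m,
    wickTerm q r a b m p.1 p.2 s.1 s.2

/-- Split off exponent 0 of a, which is the main part, and in the rest exponent 0 of a*, which is
the creation part. -/
theorem wickPart_succ (n : ℕ) : wickPart q r a b (n + 1) =
    mainPart q r a b (n + 1) + creationPart q r a b n + mixedPart q r a b n := by
  have hm : ∑ p ∈ Finset.HasAntidiagonal.antidiagonal (n + 1),
      wickTerm q r a b (n + 1) p.1 p.2 0 (n + 1) = mainPart q r a b (n + 1) := by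
    rw [Finset.Nat.sum_antidiagonal_eq_sum_range_succ_mk, mainPart]
    refine Finset.sum_congr rfl fun i _ => ?_
    simp only [wickTerm, qBinom_zero_right, mul_zero, pow_zero, div_one, mul_one]
  rw [wickPart, ← hm, add_assoc]
  simp only [Finset.Nat.sum_antidiagonal_succ (n := n) (f := fun s : ℕ × ℕ => wickTerm q r a b (n + 1) _ _ s.1 s.2)]
  rw [Finset.sum_add_distrib]
  congr 1
  rw [Finset.Nat.sum_antidiagonal_succ']
  rfl

include hq ha hb hab hr0 hr1 in
theorem tendsto_cesaro_wickPart {T : B}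
    (hT : Tendsto (qPoch q (1 - a * star a) 1) atTop (𝓝 T)) :
    Tendsto (fun N : ℕ => (1 / (N : ℂ)) • ∑ m ∈ Finset.Icc 1 N, wickPart q r a b m)
      atTop (𝓝 (∑' k, limitTerm q r a b T k)) := by
  have hces : ∀ {u : ℕ → B} {l : B}, Tendsto u atTop (𝓝 l) →
      Tendsto (fun N : ℕ => (1 / (N : ℂ)) • ∑ n ∈ Finset.range N, u n) atTop (𝓝 l) := by
    intro u l hu
    refine hu.cesaro_smul.congr fun N => ?_
    rw [one_div, ← Complex.ofReal_natCast, ← Complex.ofReal_inv, Complex.coe_smul]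
  have h1 := hces (((tendsto_add_atTop_iff_nat 1).mpr
    (tendsto_mainPart hq ha hb hab hr0 hr1 hT)))
  have h2 := hces (tendsto_mixedPart hq ha hb hr0 hr1)
  have h3 := (h1.add (tendsto_cesaro_creationPart hq ha hb hab hr0 hr1)).add h2
  rw [add_zero, add_zero] at h3
  refine h3.congr fun N => ?_
  rw [← smul_add, ← smul_add, ← Finset.sum_add_distrib, ← Finset.sum_add_distrib,
    ← Finset.sum_congr rfl fun n _ => wickPart_succ n]
  congr 1
  rw [Finset.range_eq_Ico, Finset.sum_Ico_add' (fun m => wickPart q r a b m) 0 N 1]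
  rfl

/-! ### Invertibility of the limit -/

include hq ha hb hr0 hr1 in
-- With R the tail k ≥ 1 and V = T⁻¹, the sum is d_∞ T(1 + d_∞⁻¹ V R). The perturbation has norm at
-- most C_q⁴ r/(1-r), which is below 1 exactly when r(1 + C_q⁴) < 1.
theorem isUnit_tsum_limitTerm {T V : B} (hTV : T * V = 1) (hVT : V * T = 1) (hT : ‖T‖ ≤ constC q)
    (hV : ‖V‖ ≤ constC q) (hr : r * (1 + constC q ^ 4) < 1) :
    IsUnit (∑' k, limitTerm q r a b T k) := by
  have hC := one_le_constC hq
  have hd := dInf_pos hq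
  have hs := summable_limitTerm hq ha hb hr0 hr1 hT
  set R := ∑' k, limitTerm q r a b T (k + 1) with hR
  have h0 : limitTerm q r a b T 0 = (dInf q : ℂ) • T := by simp [limitTerm, dFin]
  have hRn : ‖R‖ ≤ dInf q * (constC q ^ 3 * (r / (1 - r))) := by
    have hg : HasSum (fun k : ℕ => dInf q * (constC q ^ 3 * r ^ (k + 1)))
        (dInf q * (constC q ^ 3 * (r / (1 - r)))) := by
      have := ((hasSum_geometric_of_lt_one hr0.le hr1).mul_left r)
      simp only [← pow_succ'] at this
      exact (this.mul_left _).mul_left _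
    exact tsum_of_norm_bounded hg fun k => norm_limitTerm_le hq ha hb hr0 hT (k + 1)
  have hx : ‖((dInf q)⁻¹ : ℂ) • (V * R)‖ < 1 := by
    rw [norm_smul, norm_inv, Complex.norm_real, Real.norm_eq_abs, abs_of_pos hd]
    calc _ ≤ (dInf q)⁻¹ * (constC q * (dInf q * (constC q ^ 3 * (r / (1 - r))))) := by
          gcongr
          refine (norm_mul_le _ _).trans ?_
          gcongr
      _ = constC q ^ 4 * r / (1 - r) := by field_simp
      _ < 1 := by
          rw [div_lt_one (by linarith)]
          linarith
  have hu : IsUnit (1 + ((dInf q)⁻¹ : ℂ) • (V * R)) := by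
    have := isUnit_one_sub_of_norm_lt_one (x := -(((dInf q)⁻¹ : ℂ) • (V * R))) (by rwa [norm_neg])
    rwa [sub_neg_eq_add] at this
  have hTu : IsUnit T := ⟨⟨T, V, hTV, hVT⟩, rfl⟩
  have hdu : IsUnit (algebraMap ℂ B (dInf q : ℂ)) :=
    (IsUnit.mk0 (dInf q : ℂ) (by exact_mod_cast hd.ne')).map (algebraMap ℂ B)
  have e : ∑' k, limitTerm q r a b T k =
      algebraMap ℂ B (dInf q : ℂ) * (T * (1 + ((dInf q)⁻¹ : ℂ) • (V * R))) := by
    rw [hs.tsum_eq_zero_add, h0, ← hR, Algebra.algebraMap_eq_smul_one, smul_mul_assoc, one_mul,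
      mul_add, mul_one, smul_add, mul_smul_comm, ← mul_assoc, hTV, one_mul,
      smul_inv_smul₀ (by exact_mod_cast hd.ne')]
  rw [e]
  exact hdu.mul (hTu.mul hu)

end Limits

/-! ### Normalised oscillators on a Hilbert space -/

section Normalise

variable {F : Type*} [NormedAddCommGroup F] [InnerProductSpace ℂ F] [CompleteSpace F]

/-- It is enough that ‖ay‖² ≤ 2‖y‖², since ‖x - aa*x‖² = ‖x‖² - 2‖a*x‖² + ‖aa*x‖². For q ≥ 0 the
relation forces ‖a‖ ≤ 1. For q < 0 its last term is negative and 1 - q < 2. -/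
theorem isOscillator_of_rel {q : ℝ} (hq : |q| < 1) {a : F →L[ℂ] F}
    (h : star a * a = (1 - (q : ℂ)) • 1 + (q : ℂ) • (a * star a)) : IsOscillator q a := by
  refine ⟨h, ?_⟩
  obtain ⟨hq1, hq2⟩ := abs_lt.mp hq
  have hsq : ∀ y, ‖a y‖ ^ 2 = (1 - q) * ‖y‖ ^ 2 + q * ‖star a y‖ ^ 2 := by
    intro y
    have h1 : inner ℂ y ((star a * a) y) = (1 - (q : ℂ)) * inner ℂ y y +
        (q : ℂ) * inner ℂ y (a (star a y)) := by
      rw [h]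
      simp only [_root_.add_apply, _root_.smul_apply, one_apply_eq_self, mul_apply_eq_comp,
        inner_add_right, inner_smul_right]
    rw [mul_apply_eq_comp, ContinuousLinearMap.star_eq_adjoint,
      ContinuousLinearMap.adjoint_inner_right,
      ← ContinuousLinearMap.adjoint_inner_left a _ y,
      inner_self_eq_norm_sq_to_K, inner_self_eq_norm_sq_to_K, inner_self_eq_norm_sq_to_K] at h1
    rw [ContinuousLinearMap.star_eq_adjoint]
    refine Complex.ofReal_injective ?_
    push_cast
    exact h1
  have hle : ∀ y, ‖a y‖ ^ 2 ≤ 2 * ‖y‖ ^ 2 := by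
    intro y
    have hy := sq_nonneg ‖y‖
    rcases le_or_gt 0 q with h0 | h0
    · have h1 : ‖a‖ * ‖a‖ ≤ (1 - q) + q * (‖a‖ * ‖a‖) := by
        calc ‖a‖ * ‖a‖ = ‖(1 - (q : ℂ)) • (1 : F →L[ℂ] F) + (q : ℂ) • (a * star a)‖ := by
              rw [← h, CStarRing.norm_star_mul_self]
          _ ≤ ‖(1 - (q : ℂ)) • (1 : F →L[ℂ] F)‖ + ‖(q : ℂ) • (a * star a)‖ := norm_add_le _ _
          _ ≤ _ := by
            rw [norm_smul, norm_smul, CStarRing.norm_self_mul_star,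
              Complex.norm_real, Real.norm_eq_abs, abs_of_nonneg h0, ← Complex.ofReal_one,
              ← Complex.ofReal_sub, Complex.norm_real, Real.norm_eq_abs,
              abs_of_pos (by linarith : (0 : ℝ) < 1 - q)]
            gcongr
            calc _ ≤ (1 - q) * 1 := by
                  gcongr
                  exact ContinuousLinearMap.norm_id_le
              _ = _ := mul_one _
      have h2 : ‖a‖ * ‖a‖ ≤ 1 := by nlinarith
      have h3 : ‖a y‖ ^ 2 ≤ (‖a‖ * ‖y‖) ^ 2 := by gcongr; exact a.le_opNorm y
      nlinarith
    · have := hsq y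
      have h1 := mul_nonneg (neg_pos.mpr h0).le (sq_nonneg ‖star a y‖)
      nlinarith
  refine ContinuousLinearMap.opNorm_le_bound _ zero_le_one fun x => ?_
  rw [one_mul]
  refine abs_le_of_sq_le_sq' ?_ (norm_nonneg _) |>.2
  have e1 : (1 - a * star a) x = x - a (star a x) := rfl
  have e2 : RCLike.re (inner ℂ x (a (star a x))) = ‖star a x‖ ^ 2 := by
    rw [ContinuousLinearMap.star_eq_adjoint, ← ContinuousLinearMap.adjoint_inner_left,
      inner_self_eq_norm_sq]
  rw [e1, norm_sub_sq (𝕜 := ℂ), e2]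
  linarith [hle (star a x)]

theorem isOscillator_smul {q : ℝ} (hq : |q| < 1) {c : F →L[ℂ] F} {s : ℝ} (hs : 0 < s)
    (h : star c * c = (s : ℂ) • 1 + (q : ℂ) • (c * star c)) :
    IsOscillator q (((√((1 - q) / s) : ℝ) : ℂ) • c) := by
  have h1 : ((√((1 - q) / s) : ℝ) : ℂ) * ((√((1 - q) / s) : ℝ) : ℂ) * (s : ℂ) = 1 - (q : ℂ) := by
    rw [← Complex.ofReal_mul, Real.mul_self_sqrt (div_nonneg (by linarith [(abs_lt.mp hq).2]) hs.le),
      ← Complex.ofReal_mul, div_mul_cancel₀ _ hs.ne']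
    push_cast; rfl
  refine isOscillator_of_rel hq ?_
  rw [star_smul, Complex.star_def, Complex.conj_ofReal, smul_mul_smul_comm, smul_mul_smul_comm, h,
    smul_add, smul_smul, h1, smul_comm]

theorem isPositive_of_tendsto {T : F →L[ℂ] F} {u : ℕ → F →L[ℂ] F} (hu : ∀ n, (u n).IsPositive)
    (h : Tendsto u atTop (𝓝 T)) : T.IsPositive := by
  rw [ContinuousLinearMap.isPositive_iff_complex]
  intro x
  have h1 : (0 : ℂ) ≤ inner ℂ (T x) x := by
    refine ge_of_tendsto' (x := atTop) (f := fun n => inner ℂ (u n x) x) ?_ fun n => (hu n).inner_nonneg_left x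
    have h2 : Tendsto (fun n => u n x) atTop (𝓝 (T x)) :=
      ((ContinuousLinearMap.apply ℂ F x).continuous.tendsto T).comp h
    exact h2.inner tendsto_const_nhds
  obtain ⟨h2, h3⟩ := Complex.nonneg_iff.mp h1
  exact ⟨Complex.ext (by simp) (by simpa using h3), h2⟩

end Normalise

/-! ### Rescaling -/

section Rescale

variable {B : Type*} [CStarAlgebra B] {q : ℝ} {c d : B} {α β r : ℝ}

theorem limitTerm_smul (T : B) (h : α * β = 1 - q) (k : ℕ) :
    limitTerm q r ((α : ℂ) • c) ((β : ℂ) • d) T k =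
      ((dInf q / dFin q k * (1 - q) ^ k * r ^ k : ℝ) : ℂ) • (d ^ k * T * c ^ k) := by
  rw [limitTerm, smul_pow, smul_pow, smul_mul_assoc, smul_mul_assoc, mul_smul_comm, smul_smul,
    smul_smul, ← h]
  congr 1
  push_cast
  ring

/-- The unequal scalings of c and d are what produces the weights r^i/r^j of `wickTerm`: together
with them every monomial carries the same total factor (αβ)^{2m}. -/
theorem wickPart_smul (hr : r ≠ 0) (h : α * β = 1 - q) (hαβ : β * r = α) (m : ℕ) :
    wickPart q r ((α : ℂ) • c) ((β : ℂ) • d) m =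
      (((1 - q) ^ (2 * m) : ℝ) : ℂ) •
        (wickSum q c d (star c) (star d) m m * d ^ m * c ^ m) := by
  rw [wickPart, wickSum, Finset.sum_mul, Finset.sum_mul, Finset.smul_sum]
  refine Finset.sum_congr rfl fun p hp => ?_
  rw [smul_mul_assoc, smul_mul_assoc, Finset.sum_mul, Finset.sum_mul, Finset.smul_sum,
    Finset.smul_sum]
  refine Finset.sum_congr rfl fun s hs => ?_
  rw [Finset.HasAntidiagonal.mem_antidiagonal] at hp hs
  rw [wickTerm]
  simp only [star_smul, smul_pow, smul_mul_assoc, mul_smul_comm, smul_smul, Complex.star_def,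
    Complex.conj_ofReal]
  congr 1
  have e : r ^ p.1 / r ^ s.1 * (α ^ m * β ^ m * β ^ s.2 * α ^ p.2 * α ^ s.1 * β ^ p.1) =
      (1 - q) ^ (2 * m) := by
    have h1 : β ^ p.1 * r ^ p.1 = α ^ p.1 := by rw [← mul_pow, hαβ]
    have h2 : α ^ s.1 / r ^ s.1 = β ^ s.1 := by
      rw [← hαβ, mul_pow, mul_div_cancel_right₀ _ (pow_ne_zero _ hr)]
    calc _ = α ^ m * β ^ m * (β ^ s.2 * (α ^ s.1 / r ^ s.1)) * (α ^ p.2 * (β ^ p.1 * r ^ p.1)) := by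
          ring
      _ = α ^ m * β ^ m * β ^ (s.1 + s.2) * α ^ (p.1 + p.2) := by
          rw [h1, h2, pow_add, pow_add]; ring
      _ = _ := by rw [hp, hs, ← h, pow_mul, mul_pow, mul_pow]; ring
  rw [← e]
  push_cast
  ring

end Rescale

/-! ### Nontriviality of the Fock space -/

section Vacuum

variable {H : Type*} [NormedAddCommGroup H] [InnerProductSpace ℝ H]

/-- The vacuum has norm 1. Nontriviality gives the identity operator norm 1, as the `NormOneClass`
hypotheses above require. -/
instance nontrivial_fock (q : Set.Ioo (-1 : ℝ) 1) (K : Type*) [NormedAddCommGroup K]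
    [InnerProductSpace ℂ K] : Nontrivial (Fock q K) := by
  refine ⟨⟨vacuum q, 0, fun h => ?_⟩⟩
  have h1 : inner ℂ (vacuum q : Fock q K) (vacuum q) = (1 : ℂ) := by
    rw [vacuum, inner_tensor]
    simp [qInner, inversions]
  rw [h, inner_zero_left] at h1
  exact zero_ne_one h1

end Vacuum

end QArakiWoods

end

/-! ### The main theorem -/

open QArakiWoods in
theorem mainTheorem3 {H : Type*} [NormedAddCommGroup H] [InnerProductSpace ℝ H] [CompleteSpace H]
    (U : OrthogonalGroup H) (q : Set.Ioo (-1 : ℝ) 1)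
    (lam : ℝ) (hlam : lam ∈ Set.Ioo (0 : ℝ) 1) (f₁ f₂ : H) (hf : IsRotationBlock U lam f₁ f₂)
    (e : Cplx H) (he : e = blockVector lam f₁ f₂) :
    ∃ T S : Fock q (HU U) →L[ℂ] Fock q (HU U),
      Tendsto (seqT q U lam e) atTop (𝓝 T) ∧ T.IsPositive ∧ IsUnit T ∧
      HasSum (fun k : ℕ =>
        ((dInf q / dFin q k * (1 - (q : ℝ)) ^ k * lam ^ ((k : ℝ) / 2) : ℝ) : ℂ) •
          (creation q (toHU U e.conj) ^ k * T * creation q (toHU U e) ^ k)) S ∧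
      Tendsto (cesaroS q U e) atTop (𝓝 S) ∧
      (lam < ((1 + constC q ^ 4) ^ 2)⁻¹ → IsUnit S) := by
  obtain ⟨hl0, hl1⟩ := hlam
  have hq : |(q : ℝ)| < 1 := abs_lt.mpr q.2
  have hq1 : 0 < 1 - (q : ℝ) := by linarith [q.2.2]
  have hee := inner_toHU_blockVector hl0 hf
  have hef := inner_toHU_blockVector_conj hl0 hf
  have hff := inner_toHU_conj_blockVector hl0 hf
  rw [← he] at hee hef hff
  set c := creation q (toHU U e) with hc
  set d := creation q (toHU U e.conj) with hd
  set r := √lam with hr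
  have hr0 : 0 < r := Real.sqrt_pos.mpr hl0
  have hr1 : r < 1 := (Real.sqrt_lt' one_pos).mpr (by simpa using hl1)
  have hpow : ∀ k : ℕ, lam ^ ((k : ℝ) / 2) = r ^ k := fun k => by
    rw [hr, Real.sqrt_eq_rpow, ← Real.rpow_mul_natCast hl0.le]
    congr 1
    ring
  -- Since ‖e‖² = r⁻¹ and ‖ē‖² = r, these scalars normalise both oscillators, and they satisfy αβ =
  -- 1 - q and βr = α, the two relations used for rescaling.
  set α : ℝ := √((1 - (q : ℝ)) / r⁻¹) with hα
  set β : ℝ := √((1 - (q : ℝ)) / r) with hβ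
  have hαα : α * α = (1 - (q : ℝ)) * r := by
    rw [hα, Real.mul_self_sqrt (by positivity), div_inv_eq_mul]
  have hβr : β * r = α := by
    refine (Real.sqrt_eq_iff_mul_self_eq (by positivity) (by positivity)).mpr ?_ |>.symm
    rw [mul_mul_mul_comm, hβ, Real.mul_self_sqrt (by positivity)]
    field_simp
  have hαβ : α * β = 1 - (q : ℝ) := by
    rw [← hβr, mul_right_comm, hβ, Real.mul_self_sqrt (by positivity), div_mul_cancel₀ _ hr0.ne']
  have ha : IsOscillator (q : ℝ) ((α : ℂ) • c) := by
    refine isOscillator_smul hq (inv_pos.mpr hr0) ?_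
    rw [← hee]
    exact annihilation_mul_creation q _ _
  have hb : IsOscillator (q : ℝ) ((β : ℂ) • d) := by
    refine isOscillator_smul hq hr0 ?_
    rw [← hff]
    exact annihilation_mul_creation q _ _
  have hab : star ((α : ℂ) • c) * ((β : ℂ) • d) =
      ((q : ℝ) : ℂ) • (((β : ℂ) • d) * star ((α : ℂ) • c)) := by
    have h1 : star c * d = ((q : ℝ) : ℂ) • (d * star c) := by
      have := annihilation_mul_creation q (toHU U e) (toHU U e.conj)
      rwa [hef, zero_smul, zero_add] at this
    rw [star_smul, smul_mul_smul_comm, smul_mul_smul_comm, h1, smul_comm, mul_comm (β : ℂ)]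
  have hseq : ∀ n, seqT q U lam e n = star (((α : ℂ) • c) ^ n) * ((α : ℂ) • c) ^ n := by
    intro n
    rw [seqT, hpow, smul_pow, star_smul, smul_mul_smul_comm, star_pow, star_pow, Complex.star_def,
      Complex.conj_ofReal, ← mul_pow, ← mul_pow, ← Complex.ofReal_mul, hαα, ← Complex.ofReal_pow,
      mul_pow]
    rfl
  obtain ⟨T, V, hT, hTV, hVT, hVn, hTn⟩ := exists_qPoch_limit hq ha.norm_le
  have hTs : Tendsto (seqT q U lam e) atTop (𝓝 T) := hT.congr fun n => by
    rw [hseq, star_pow, ha.star_pow_mul_pow]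
  have hs := (summable_limitTerm hq ha hb hr0 hr1 hTn).hasSum
  refine ⟨T, _, hTs, ?_, ⟨⟨T, V, hTV, hVT⟩, rfl⟩, hs.congr_fun ?_, ?_, fun h => ?_⟩
  · refine isPositive_of_tendsto (fun n => ?_) hTs
    rw [hseq]
    exact ContinuousLinearMap.isPositive_adjoint_comp_self _
  · intro k
    rw [limitTerm_smul T hαβ, hpow]
  · refine (tendsto_cesaro_wickPart hq ha hb hab hr0 hr1 hT).congr fun n => ?_
    rw [cesaroS]
    congr 1
    refine Finset.sum_congr rfl fun m _ => ?_
    rw [wickPart_smul hr0.ne' hαβ hβr, wick_replicate q U hef]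
    rfl
  · refine isUnit_tsum_limitTerm hq ha hb hr0 hr1 hTV hVT hTn hVn ?_
    have hC := one_le_constC hq
    have h1 : (r * (1 + constC q ^ 4)) ^ 2 < 1 ^ 2 := by
      rw [mul_pow, hr, Real.sq_sqrt hl0.le, one_pow]
      calc _ < ((1 + constC q ^ 4) ^ 2)⁻¹ * (1 + constC q ^ 4) ^ 2 := by gcongr
        _ = 1 := inv_mul_cancel₀ (by positivity)
    exact lt_of_pow_lt_pow_left₀ 2 zero_le_one h1
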